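/- Let $(\Sigma,\mathbf p)$ be a topological space with a Borel probability measure of compact support (i.e. $\mathbf p(\Sigma\setminus K)=0$ for some compact $K$), with expectation $\mathbf E$, and let $(T_{\lambda,\sigma})_{\lambda\in\mathbb R,\sigma\in\Sigma}$ be matrices in $\mathrm{SL}(2,\mathbb R)$ depending smoothly on $\lambda$, all $\lambda$-derivatives being jointly continuous in $(\lambda,\sigma)$. Suppose $T_{0,\sigma}=\pm\mathbf 1$ for every $\sigma$ (an anomaly of first order; the sign may depend on $\sigma$). Fix $M\in\mathrm{SL}(2,\mathbb R)$ and let $P_\sigma,Q_\sigma\in\mathrm{sl}(2,\mathbb R)$ be given by $$M\,T_{\lambda,\sigma}\,M^{-1}=\pm\exp\bigl(\lambda P_\sigma+\lambda^2Q_\sigma+\mathcal O(\lambda^3)\bigr),\qquad \lambda\to0 .$$ Suppose $\mathbf E(P_\sigma)=0$ while the variance of $P_\sigma$ does not vanish (second degree). Put $e_\theta=(\cos\theta,\sin\theta)^{T}$, $v=\frac1{\sqrt2}(1,-i)^{T}$, let $\langle\cdot|\cdot\rangle$ be antilinear in the first argument, and set $$p_\sigma(\theta)=\Im\frac{\langle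 v|P_\sigma|e_\theta\rangle}{\langle v|e_\theta\rangle},\qquad q_\sigma(\theta)=\Im\frac{\langle v|Q_\sigma|e_\theta\rangle}{\langle v|e_\theta\rangle},\qquad \beta_\sigma=\langle\overline v|P_\sigma|v\rangle,\qquad |P_\sigma|^2=P_\sigma^{T}P_\sigma .$$ Suppose $\mathbf E(p_\sigma(\theta)^2)>0$ for every $\theta$. Define $$\kappa(\theta)=\int_0^\theta\frac{2\,\mathbf E(q_\sigma(t))}{\mathbf E(p_\sigma(t)^2)}\,dt,\qquad K(\theta)=\int_0^\theta 2\,\mathbf E(p_\sigma(t)^2)^{-1/2}e^{-\kappa(t)}\,dt,\qquad C=\frac{e^{-\kappa(2\pi)}-1}{K(2\pi)},$$ $$\rho_0(\theta)=\frac{c\,e^{\kappa(\theta)}}{\mathbf E(p_\sigma(\theta)^2)^{1/2}}\bigl(C\,K(\theta)+1\bigr),$$ where $c$ is the constant normalizing $\int_0^{2\pi}\rho_0\,\frac{d\theta}{2\pi}$ to $1$. Then $\rho_0$ is positive, $2\pi$-periodic, real-analytic, satisfies $\int_0^{2\pi}\rho_0\,\frac{d\theta}{2\pi}=1$, and solves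 the Fokker–Planck equation $$\partial_\theta\Bigl(\tfrac12\mathbf E(p_\sigma^2)\,\partial_\theta\rho_0+\tfrac12\mathbf E(p_\sigma\,\partial_\theta p_\sigma)\,\rho_0-\mathbf E(q_\sigma)\,\rho_0\Bigr)=0 .$$ Moreover, for all $\lambda$ in a neighbourhood of $0$ the Lyapunov exponent $$\gamma(\lambda)=\lim_{N\to\infty}\frac1N\,\mathbf E\log\bigl\|T_{\lambda,\sigma_N}\cdots T_{\lambda,\sigma_1}e_\theta\bigr\|\qquad(\sigma_1,\sigma_2,\dots\text{ independent with law }\mathbf p)$$ exists for every $\theta$ and does not depend on $\theta$, and as $\lambda\to0$ $$\gamma(\lambda)=\frac{\lambda^2}{2}\,\Re\int_0^{2\pi}\frac{d\theta}{2\pi}\,\rho_0(\theta)\Bigl[\mathbf E(|\beta_\sigma|^2)+\mathbf E\bigl(\langle\overline v|(|P_\sigma|^2+2Q_\sigma)|v\rangle\bigr)e^{2i\theta}-\mathbf E(\beta_\sigma^2)\,e^{4i\theta}\Bigr]+\mathcal O(\lambda^3).$$ -/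

import Mathlib

open MeasureTheory ProbabilityTheory Filter Topology Asymptotics
open scoped Matrix ContDiff

noncomputable section

namespace Anomaly

/-- Real two by two matrices. -/
abbrev Mat2 : Type := Matrix (Fin 2) (Fin 2) ℝ

/-- The group `SL(2, ℝ)`. -/
abbrev SL2 : Type := Matrix.SpecialLinearGroup (Fin 2) ℝ

/-- The unit vector `e_θ = (cos θ, sin θ)`. -/
def e (θ : ℝ) : Fin 2 → ℝ := ![Real.cos θ, Real.sin θ]

/-- The unit vector `v = (1, -i) / √2`. -/
def v : Fin 2 → ℂ := ![1 / (Real.sqrt 2 : ℂ), -Complex.I / (Real.sqrt 2 : ℂ)]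

/-- The matrix element `⟨x|A|y⟩`, antilinear in `x`, of a real matrix `A`. -/
def braket (x : Fin 2 → ℂ) (A : Mat2) (y : Fin 2 → ℂ) : ℂ :=
  star x ⬝ᵥ (A.map (fun r : ℝ => (r : ℂ)) *ᵥ y)

/-- `e_θ` regarded as a complex vector. -/
def eC (θ : ℝ) : Fin 2 → ℂ := fun i => (e θ i : ℂ)

/-- `Im (⟨v|A|e_θ⟩ / ⟨v|e_θ⟩)`: for `A = P_σ` this is `p_σ(θ)`, for `A = Q_σ` it is `q_σ(θ)`. -/
def phase (A : Mat2) (θ : ℝ) : ℝ := (braket v A (eC θ) / (star v ⬝ᵥ eC θ)).im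

/-- `⟨v̄|A|v⟩`: for `A = P_σ` this is `β_σ`. -/
def offDiag (A : Mat2) : ℂ := braket (star v) A v

section Family

variable {S : Type*}

/-- The family is smooth in the coupling `l`, with all `l`-derivatives
jointly continuous in the coupling and the random parameter. -/
def IsSmoothFamily [TopologicalSpace S] (T : ℝ → S → SL2) : Prop :=
  (∀ (s : S) (i j : Fin 2), ContDiff ℝ ∞ (fun l : ℝ => (T l s).1 i j)) ∧
  ∀ (k : ℕ) (i j : Fin 2),
    Continuous (fun x : ℝ × S => iteratedDeriv k (fun l : ℝ => (T l x.2).1 i j) x.1)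

/-- The value `0` of the coupling is an anomaly of first order: `T_{0,σ} = ± 1` for all `σ`. -/
def IsFirstOrderAnomaly (T : ℝ → S → SL2) : Prop :=
  ∀ s, (T 0 s).1 = 1 ∨ (T 0 s).1 = -1

/-- `A(l) = ± exp (l P + l² Q + O(l³))` as `l → 0`, where `P` and `Q` are traceless. -/
def HasExpansion (A : ℝ → Mat2) (P Q : Mat2) : Prop :=
  P.trace = 0 ∧ Q.trace = 0 ∧
  ∃ ε : ℝ, (ε = 1 ∨ ε = -1) ∧ ∃ R : ℝ → Mat2,
    (∀ i j, (fun l => R l i j) =O[𝓝 0] (fun l : ℝ => l ^ 3)) ∧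
    ∀ᶠ l in 𝓝 (0 : ℝ), A l = ε • NormedSpace.exp (l • P + l ^ 2 • Q + R l)

/-- The product `T_{l,σ_N} ⋯ T_{l,σ_1}`, where the code `w` is indexed from `0`,
so that `σ_{n+1} = w n`. -/
def transfer (T : ℝ → S → SL2) (l : ℝ) (w : ℕ → S) : ℕ → SL2
  | 0 => 1
  | n + 1 => T l (w n) * transfer T l w n

/-- `log ‖T_{l,σ_N} ⋯ T_{l,σ_1} e_θ‖`, with the Euclidean norm. -/
def logGrowth (T : ℝ → S → SL2) (l θ : ℝ) (N : ℕ) (w : ℕ → S) : ℝ :=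
  Real.log ‖(WithLp.toLp 2 ((transfer T l w N).1 *ᵥ e θ) : EuclideanSpace ℝ (Fin 2))‖

variable [MeasurableSpace S] (μ : Measure S)

/-- `E(P_σ) = 0`, but the variance of `P_σ` does not vanish. -/
def IsSecondDegree (P : S → Mat2) : Prop :=
  (∀ i j, Integrable (fun s => P s i j) μ ∧ ∫ s, P s i j ∂μ = 0) ∧
  ∃ i j, Var[fun s => P s i j; μ] ≠ 0

/-- `γ` is the Lyapunov exponent at the coupling `l`: whatever the initial angle `θ`,
`γ = lim (1/N) E log ‖T_{l,σ_N} ⋯ T_{l,σ_1} e_θ‖`, where the code `(σ_n)` is independent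
and identically distributed with law `μ`. -/
def IsLyapunovExponent [IsProbabilityMeasure μ] (T : ℝ → S → SL2) (l γ : ℝ) : Prop :=
  ∀ θ : ℝ,
    (∀ N, Integrable (logGrowth T l θ N) (Measure.infinitePi (fun _ : ℕ => μ))) ∧
    Tendsto (fun N : ℕ =>
        (1 / (N : ℝ)) * ∫ w, logGrowth T l θ N w ∂(Measure.infinitePi (fun _ : ℕ => μ)))
      atTop (𝓝 γ)

/-- The diffusion coefficient `E(p_σ(θ)²)`. -/
def diffusion (P : S → Mat2) (θ : ℝ) : ℝ := ∫ s, phase (P s) θ ^ 2 ∂μ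

/-- `E(q_σ(θ))`. -/
def meanQ (Q : S → Mat2) (θ : ℝ) : ℝ := ∫ s, phase (Q s) θ ∂μ

/-- `κ(θ) = ∫₀^θ 2 E(q_σ) / E(p_σ²)`. -/
def kappa (P Q : S → Mat2) (θ : ℝ) : ℝ :=
  ∫ t in (0 : ℝ)..θ, 2 * meanQ μ Q t / diffusion μ P t

/-- `K(θ) = ∫₀^θ 2 E(p_σ²)^{-1/2} e^{-κ}`. -/
def bigK (P Q : S → Mat2) (θ : ℝ) : ℝ :=
  ∫ t in (0 : ℝ)..θ, 2 * (Real.sqrt (diffusion μ P t))⁻¹ * Real.exp (-kappa μ P Q t)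

/-- `C = (e^{-κ(2π)} - 1) / K(2π)`. -/
def bigC (P Q : S → Mat2) : ℝ :=
  (Real.exp (-kappa μ P Q (2 * Real.pi)) - 1) / bigK μ P Q (2 * Real.pi)

/-- The density `e^{κ} E(p_σ²)^{-1/2} (C K + 1)` before normalization. -/
def preDensity (P Q : S → Mat2) (θ : ℝ) : ℝ :=
  Real.exp (kappa μ P Q θ) / Real.sqrt (diffusion μ P θ) * (bigC μ P Q * bigK μ P Q θ + 1)

/-- The density `ρ₀`, normalized with respect to `dθ / 2π`. -/
def rho (P Q : S → Mat2) (θ : ℝ) : ℝ :=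
  ((∫ t in (0 : ℝ)..(2 * Real.pi), preDensity μ P Q t) / (2 * Real.pi))⁻¹ * preDensity μ P Q θ

/-- `(1/2) E(p_σ²) ρ' + (1/2) E(p_σ p_σ') ρ - E(q_σ) ρ`; the Fokker-Planck operator applied
to `ρ` is the derivative of this function. -/
def flux (P Q : S → Mat2) (ρ : ℝ → ℝ) (θ : ℝ) : ℝ :=
  (1 / 2) * diffusion μ P θ * deriv ρ θ
    + (1 / 2) * (∫ s, phase (P s) θ * deriv (phase (P s)) θ ∂μ) * ρ θ
    - meanQ μ Q θ * ρ θ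

/-- `E|β_σ|² + E⟨v̄|(|P_σ|² + 2 Q_σ)|v⟩ e^{2iθ} - E(β_σ²) e^{4iθ}`,
where `|P|² = Pᵀ P` for a real matrix. -/
def lyapIntegrand (P Q : S → Mat2) (θ : ℝ) : ℂ :=
  ((∫ s, ‖offDiag (P s)‖ ^ 2 ∂μ : ℝ) : ℂ)
    + (∫ s, offDiag ((P s)ᵀ * P s + (2 : ℝ) • Q s) ∂μ) * Complex.exp (2 * Complex.I * θ)
    - (∫ s, offDiag (P s) ^ 2 ∂μ) * Complex.exp (4 * Complex.I * θ)

/-- `Re ∫₀^{2π} (dθ / 2π) ρ₀(θ) [⋯]`. -/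
def lyapCoefficient (P Q : S → Mat2) : ℝ :=
  ((1 / (2 * Real.pi) : ℂ) *
    ∫ θ in (0 : ℝ)..(2 * Real.pi), (rho μ P Q θ : ℂ) * lyapIntegrand μ P Q θ).re

end Family

end Anomaly

end

/-! Write `ell` for the logarithm of the Euclidean norm. Its growth along an orbit is an additive
functional of a random walk on directions, and at order `l ^ 2` this walk resembles a diffusion on
the circle with diffusion coefficient E(p²) =: D. The proof uses no invariant measure of the walk,
only an approximate Poisson equation. If a bounded function Φ of the direction makes E[ell(A y) -
ell(y)] - E[Φ(A y) - Φ(y)] equal to a constant g up to an error ε, for every y ≠ 0, then summing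
over N steps puts the exponent within ε of g (`abs_growth_sub_le`).

Let Φ(y) = φ(arg y). The terms of order `l` are linear in P and average to zero because E(P) = 0.
The terms of order `l ^ 2` are half the real part of the bracket in the asymptotic formula, minus ½
D φ'' + (¼ D' + E(q)) φ'. They reduce to a constant c when φ solves the corresponding ordinary
differential equation. This equation is of first order in φ' and is solved by variation of
constants; the solution can be made periodic when the right-hand side is orthogonal to ρ₀
(`exists_poisson_solution`), which holds when c is half of `lyapCoefficient` (`lyapCoefficient_eq`).
The density ρ₀ is itself explicit: its probability flux is constant, and C is the value that makes
it periodic.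

Existence of the exponent is a separate matter. The least and the greatest mean growth over N steps
are super- and subadditive, so they have rates α ≤ β. For small `l ≠ 0` every direction is moved on
average, because D > 0. Suppose α < β and take x of nearly least growth. For a unimodular product W
and independent directions x and y = A_s x, at least one of them grows nearly as much as any third
direction z (`ell_le_max`), while the other is rarely slower than a rate g just below α, by an
exponential moment bound (`exists_integral_deficit_le`). So x and A_s x together grow at rate at
least β + g > 2α whenever A_s moves x. But both grow at rate about α on average, since the growth of
x over N + 1 steps is the mean over s of the growth of A_s x over N steps. This contradiction is
quantified in `growth_gap_bound`.

Both arguments need expansions that are uniform in σ. They come from Taylor's formula on the compact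
support, after conjugation by M, removal of the sign and replacement of the matrices off the support
by the identity (`exists_isUniformFamily`). None of these changes affects the exponent
(`isLyapunovExponent_of_conj`). -/

noncomputable section

namespace Anomaly

/-! ### Random products of unimodular matrices acting on the plane -/

/-- Real vectors in the plane. -/
abbrev Vec : Type := Fin 2 → ℝ

/-- The square of the Euclidean norm. -/
def nsq (x : Vec) : ℝ := x 0 ^ 2 + x 1 ^ 2

/-- The logarithm of the Euclidean norm. -/
def ell (x : Vec) : ℝ := Real.log (nsq x) / 2

/-- The oriented area of the parallelogram spanned by two vectors. -/
def wedge (x y : Vec) : ℝ := x 0 * y 1 - x 1 * y 0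

lemma nsq_nonneg (x : Vec) : 0 ≤ nsq x := by unfold nsq; positivity

lemma nsq_pos {x : Vec} (hx : x ≠ 0) : 0 < nsq x := by
  refine lt_of_le_of_ne (nsq_nonneg x) fun h => hx ?_
  have h' : x 0 ^ 2 + x 1 ^ 2 = 0 := h.symm
  have h0 : x 0 = 0 := by nlinarith [sq_nonneg (x 0), sq_nonneg (x 1)]
  have h1 : x 1 = 0 := by nlinarith [sq_nonneg (x 0), sq_nonneg (x 1)]
  ext i; fin_cases i <;> simp [h0, h1]

lemma ne_zero_of_nsq_pos {x : Vec} (hx : 0 < nsq x) : x ≠ 0 := by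
  rintro rfl; simp [nsq] at hx

lemma measurable_nsq : Measurable nsq := by unfold nsq; fun_prop

lemma measurable_ell : Measurable ell := by
  unfold ell; exact (Real.measurable_log.comp measurable_nsq).div_const 2

lemma mulVec_zero_apply (A : Mat2) (x : Vec) : (A *ᵥ x) 0 = A 0 0 * x 0 + A 0 1 * x 1 := by
  simp [Matrix.mulVec, dotProduct, Fin.sum_univ_two]

lemma mulVec_one_apply (A : Mat2) (x : Vec) : (A *ᵥ x) 1 = A 1 0 * x 0 + A 1 1 * x 1 := by
  simp [Matrix.mulVec, dotProduct, Fin.sum_univ_two]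

/-- The square of the Frobenius norm. -/
def frob (A : Mat2) : ℝ := A 0 0 ^ 2 + A 0 1 ^ 2 + A 1 0 ^ 2 + A 1 1 ^ 2

lemma nsq_mulVec_le (A : Mat2) (x : Vec) : nsq (A *ᵥ x) ≤ frob A * nsq x := by
  simp only [nsq, frob, mulVec_zero_apply, mulVec_one_apply]
  nlinarith [sq_nonneg (A 0 0 * x 1 - A 0 1 * x 0), sq_nonneg (A 1 0 * x 1 - A 1 1 * x 0)]

/-- The inverse of a unimodular matrix is its adjugate, which has the same entries up to order and
sign and hence the same Frobenius norm. -/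
lemma nsq_le_mulVec {A : Mat2} (hA : A.det = 1) (x : Vec) :
    nsq x ≤ frob A * nsq (A *ᵥ x) := by
  have h : x = A.adjugate *ᵥ (A *ᵥ x) := by
    rw [Matrix.mulVec_mulVec, Matrix.adjugate_mul, hA, one_smul, Matrix.one_mulVec]
  have h2 : frob A.adjugate = frob A := by
    simp only [frob, Matrix.adjugate_fin_two, Matrix.of_apply, Matrix.cons_val', Matrix.cons_val_zero,
      Matrix.cons_val_one, Matrix.cons_val_fin_one]
    ring
  calc nsq x = nsq (A.adjugate *ᵥ (A *ᵥ x)) := by rw [← h]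
    _ ≤ _ := by rw [← h2]; exact nsq_mulVec_le _ _

lemma two_le_frob {A : Mat2} (hA : A.det = 1) : 2 ≤ frob A := by
  rw [Matrix.det_fin_two] at hA
  unfold frob
  nlinarith [sq_nonneg (A 0 0 - A 1 1), sq_nonneg (A 0 1 + A 1 0)]

lemma mulVec_ne_zero {A : Mat2} (hA : A.det = 1) {x : Vec} (hx : x ≠ 0) : A *ᵥ x ≠ 0 := by
  intro h
  have := nsq_le_mulVec hA x
  rw [h] at this
  have h2 := nsq_pos hx
  simp [nsq] at this h2
  linarith

lemma ell_mulVec_le {A : Mat2} (hA : A.det = 1) {B : ℝ} (hB : frob A ≤ B) {x : Vec} (hx : x ≠ 0) :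
    |ell (A *ᵥ x) - ell x| ≤ Real.log B / 2 := by
  have h0 := nsq_pos hx
  have h1 := nsq_pos (mulVec_ne_zero hA hx)
  have hB0 : 0 < B := by linarith [two_le_frob hA]
  have h2 : Real.log (nsq (A *ᵥ x)) ≤ Real.log B + Real.log (nsq x) := by
    rw [← Real.log_mul hB0.ne' h0.ne']
    exact Real.log_le_log h1 ((nsq_mulVec_le A x).trans (by gcongr))
  have h3 : Real.log (nsq x) ≤ Real.log B + Real.log (nsq (A *ᵥ x)) := by
    rw [← Real.log_mul hB0.ne' h1.ne']
    exact Real.log_le_log h0 ((nsq_le_mulVec hA x).trans (by gcongr))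
  unfold ell
  rw [abs_le]; constructor <;> linarith

/-- Among two independent directions, at least one is expanded almost as much as any third one. -/
lemma ell_le_max {W : Mat2} (hW : W.det = 1) {x y z : Vec} {B : ℝ} (hB : 1 ≤ B) (hx : x ≠ 0)
    (hz : z ≠ 0) (hy : nsq y ≤ B * nsq x) (hω : wedge x y ≠ 0) :
    ell x + (ell (W *ᵥ z) - ell z) + Real.log (|wedge x y| / nsq x) - Real.log (4 * B) / 2
      ≤ max (ell (W *ᵥ x)) (ell (W *ᵥ y)) := by
  have hy0 : y ≠ 0 := by
    rintro rfl; simp [wedge] at hω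
  have hnx := nsq_pos hx
  have hnz := nsq_pos hz
  have hWx := nsq_pos (mulVec_ne_zero hW hx)
  have hWy := nsq_pos (mulVec_ne_zero hW hy0)
  have hWz := nsq_pos (mulVec_ne_zero hW hz)
  set m := max (nsq (W *ᵥ x)) (nsq (W *ᵥ y)) with hm
  have hm0 : 0 < m := lt_max_of_lt_left hWx
  have hmax : max (ell (W *ᵥ x)) (ell (W *ᵥ y)) = Real.log m / 2 := by
    unfold ell
    rcases le_total (nsq (W *ᵥ x)) (nsq (W *ᵥ y)) with h | h
    · rw [hm, max_eq_right h, max_eq_right]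
      have := Real.log_le_log hWx h; linarith
    · rw [hm, max_eq_left h, max_eq_left]
      have := Real.log_le_log hWy h; linarith
  have key : wedge x y ^ 2 * nsq (W *ᵥ z) ≤ 4 * B * nsq x * nsq z * m := by
    have hc1 : wedge z y ^ 2 ≤ nsq z * nsq y := by
      unfold wedge nsq; nlinarith [sq_nonneg (z 0 * y 0 + z 1 * y 1)]
    have hc2 : wedge x z ^ 2 ≤ nsq x * nsq z := by
      unfold wedge nsq; nlinarith [sq_nonneg (z 0 * x 0 + z 1 * x 1)]
    -- Cramer's rule: `wedge x y • z = wedge z y • x + wedge x z • y`, to which `W` is applied.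
    have h1 : wedge x y ^ 2 * nsq (W *ᵥ z)
        = nsq (wedge z y • (W *ᵥ x) + wedge x z • (W *ᵥ y)) := by
      simp only [nsq, wedge, mulVec_zero_apply, mulVec_one_apply, Pi.add_apply, Pi.smul_apply,
        smul_eq_mul]
      ring
    have h2 : ∀ (a b : ℝ) (u w : Vec), nsq (a • u + b • w) ≤ 2 * (a ^ 2 * nsq u) + 2 * (b ^ 2 * nsq w) := by
      intro a b u w
      simp only [nsq, Pi.add_apply, Pi.smul_apply, smul_eq_mul]
      nlinarith [sq_nonneg (a * u 0 - b * w 0), sq_nonneg (a * u 1 - b * w 1)]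
    have h3 : wedge z y ^ 2 * nsq (W *ᵥ x) ≤ (nsq z * (B * nsq x)) * m := by
      apply mul_le_mul (hc1.trans (by gcongr)) (le_max_left _ _) hWx.le (by positivity)
    have h4 : wedge x z ^ 2 * nsq (W *ᵥ y) ≤ (nsq z * (B * nsq x)) * m := by
      refine mul_le_mul (hc2.trans ?_) (le_max_right _ _) hWy.le (by positivity)
      have := mul_le_mul_of_nonneg_right hB (mul_pos hnx hnz).le
      linarith
    rw [h1]
    refine (h2 _ _ _ _).trans ?_
    linarith
  have hω2 : 0 < wedge x y ^ 2 := by positivity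
  have hlog := Real.log_le_log (by positivity) key
  have hB0 : 0 < B := by linarith
  rw [Real.log_mul hω2.ne' hWz.ne', Real.log_mul (by positivity) hm0.ne',
    Real.log_mul (by positivity) hnz.ne', Real.log_mul (by positivity) hnx.ne', Real.log_pow] at hlog
  rw [hmax, Real.log_div (abs_pos.mpr hω).ne' hnx.ne', Real.log_abs]
  unfold ell
  push_cast at hlog
  linarith

section Cocycle

variable {S : Type*}

/-- The product `A (w (n - 1)) ⋯ A (w 0)`. -/
def cocycle (A : S → Mat2) (w : ℕ → S) : ℕ → Mat2
  | 0 => 1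
  | n + 1 => A (w n) * cocycle A w n

/-- Prepending a letter to an infinite word. -/
def consWord (p : S × (ℕ → S)) : ℕ → S
  | 0 => p.1
  | n + 1 => p.2 n

/-- The prepended letter acts first, so conditioning on it leaves a product over the other letters
started at `A s *ᵥ x`. -/
lemma cocycle_consWord (A : S → Mat2) (s : S) (w : ℕ → S) (n : ℕ) :
    cocycle A (consWord (s, w)) (n + 1) = cocycle A w n * A s := by
  induction n with
  | zero => simp [cocycle, consWord]
  | succ n ih =>
    rw [cocycle, ih, cocycle, ← mul_assoc]
    rfl

variable [MeasurableSpace S]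

lemma measurable_consWord : Measurable (consWord : S × (ℕ → S) → ℕ → S) := by
  refine measurable_pi_lambda _ fun n => ?_
  cases n with
  | zero => exact measurable_fst
  | succ n => exact (measurable_pi_apply n).comp measurable_snd

/-- This is the Markov property at time one: an independent letter followed by an independent word
is again such a word. It suffices to compare measures of cylinders. -/
lemma map_consWord (μ : Measure S) [IsProbabilityMeasure μ] :
    Measure.map consWord (μ.prod (Measure.infinitePi fun _ : ℕ => μ))
      = Measure.infinitePi fun _ : ℕ => μ := by
  classical
  refine Measure.eq_infinitePi _ fun F t ht => ?_
  obtain ⟨n, hn⟩ := F.exists_nat_subset_range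
  -- Unconstrained coordinates get the whole space, so that the cylinder rests on an initial segment
  -- and splits into a condition on the first letter and one on the rest.
  set t' : ℕ → Set S := fun i => if i ∈ F then t i else Set.univ with ht'
  have hm : ∀ i, MeasurableSet (t' i) := by
    intro i; simp only [ht']; split_ifs with h
    · exact ht i
    · exact MeasurableSet.univ
  have hset : Set.pi (F : Set ℕ) t = Set.pi (Finset.range (n + 1) : Set ℕ) t' := by
    ext w
    simp only [Set.mem_pi, Finset.mem_coe, ht', Finset.mem_range]
    constructor
    · intro h i _
      split_ifs with hi
      · exact h i hi
      · trivial
    · intro h i hi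
      have := h i (by have := Finset.mem_range.mp (hn hi); omega)
      simpa [hi] using this
  have hprod : ∏ i ∈ F, μ (t i) = ∏ i ∈ Finset.range (n + 1), μ (t' i) := by
    have hsub : F ⊆ Finset.range (n + 1) := fun i hi => by
      have := Finset.mem_range.mp (hn hi); simp; omega
    rw [← Finset.prod_subset hsub (fun i _ hi => by simp [ht', hi])]
    exact Finset.prod_congr rfl fun i hi => by simp [ht', hi]
  rw [hset, hprod, Measure.map_apply measurable_consWord
    (MeasurableSet.pi (Finset.countable_toSet _) fun i _ => hm i)]
  have hpre : consWord ⁻¹' (Set.pi (Finset.range (n + 1) : Set ℕ) t')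
      = t' 0 ×ˢ Set.pi (Finset.range n : Set ℕ) (fun i => t' (i + 1)) := by
    ext ⟨s, w⟩
    simp only [Set.mem_preimage, Set.mem_pi, Finset.mem_coe, Finset.mem_range, Set.mem_prod]
    constructor
    · intro h
      exact ⟨h 0 (by omega), fun i hi => h (i + 1) (by omega)⟩
    · rintro ⟨h0, h1⟩ i hi
      cases i with
      | zero => exact h0
      | succ i => exact h1 i (by omega)
  rw [hpre, Measure.prod_prod, Measure.infinitePi_pi _ (fun i _ => hm (i + 1)),
    Finset.prod_range_succ', mul_comm]

/-- A random unimodular matrix with bounded entries. -/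
structure IsBoundedUnimodular (A : S → Mat2) (B : ℝ) : Prop where
  meas : ∀ i j, Measurable fun s => A s i j
  det : ∀ s, (A s).det = 1
  bound : ∀ s, frob (A s) ≤ B

/-- Measurable functions which are bounded on every annulus around the origin. -/
def LocBdd (φ : Vec → ℝ) : Prop :=
  Measurable φ ∧ ∀ r : ℝ, ∃ C, ∀ x, nsq x ≤ r → 1 ≤ r * nsq x → |φ x| ≤ C

lemma LocBdd.add {φ ψ : Vec → ℝ} (hφ : LocBdd φ) (hψ : LocBdd ψ) :
    LocBdd (fun x => φ x + ψ x) := by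
  refine ⟨hφ.1.add hψ.1, fun r => ?_⟩
  obtain ⟨C, hC⟩ := hφ.2 r
  obtain ⟨D, hD⟩ := hψ.2 r
  exact ⟨C + D, fun x h1 h2 => (abs_add_le _ _).trans (add_le_add (hC x h1 h2) (hD x h1 h2))⟩

lemma LocBdd.const_mul {φ : Vec → ℝ} (hφ : LocBdd φ) (c : ℝ) : LocBdd (fun x => c * φ x) := by
  refine ⟨hφ.1.const_mul c, fun r => ?_⟩
  obtain ⟨C, hC⟩ := hφ.2 r
  refine ⟨|c| * C, fun x h1 h2 => ?_⟩
  rw [abs_mul]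
  exact mul_le_mul_of_nonneg_left (hC x h1 h2) (abs_nonneg _)

lemma locBdd_const (c : ℝ) : LocBdd fun _ => c :=
  ⟨measurable_const, fun _ => ⟨|c|, fun _ _ _ => le_rfl⟩⟩

lemma locBdd_of_bound {φ : Vec → ℝ} (hφ : Measurable φ) {C : ℝ} (h : ∀ x, |φ x| ≤ C) : LocBdd φ :=
  ⟨hφ, fun _ => ⟨C, fun x _ _ => h x⟩⟩

lemma LocBdd.exp {φ : Vec → ℝ} (hφ : LocBdd φ) : LocBdd (fun x => Real.exp (φ x)) := by
  refine ⟨Real.measurable_exp.comp hφ.1, fun r => ?_⟩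
  obtain ⟨C, hC⟩ := hφ.2 r
  refine ⟨Real.exp C, fun x h1 h2 => ?_⟩
  rw [abs_of_pos (Real.exp_pos _)]
  exact Real.exp_le_exp.mpr ((le_abs_self _).trans (hC x h1 h2))

lemma locBdd_ell : LocBdd ell := by
  refine ⟨measurable_ell, fun r => ⟨Real.log r / 2, fun x h1 h2 => ?_⟩⟩
  have h0 := nsq_nonneg x
  have hr : 0 < r := by
    by_contra! h
    nlinarith
  have hx : 0 < nsq x := by
    by_contra! h
    have : nsq x = 0 := le_antisymm h h0
    rw [this] at h2; linarith
  have e1 := Real.log_le_log hx h1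
  have e2 := Real.log_le_log one_pos h2
  rw [Real.log_one, Real.log_mul hr.ne' hx.ne'] at e2
  unfold ell
  rw [abs_le]; constructor <;> linarith

/-- Averaging a function over one step of the random walk. -/
def step (A : S → Mat2) (μ : Measure S) (φ : Vec → ℝ) (x : Vec) : ℝ := ∫ s, φ (A s *ᵥ x) ∂μ

namespace IsBoundedUnimodular

variable {A : S → Mat2} {B : ℝ} (hA : IsBoundedUnimodular A B)
include hA

lemma measurable_mulVec : Measurable fun p : S × Vec => A p.1 *ᵥ p.2 := by
  refine measurable_pi_lambda _ fun i => ?_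
  simp only [Matrix.mulVec, dotProduct, Fin.sum_univ_two]
  exact (((hA.meas i 0).comp measurable_fst).mul ((measurable_pi_apply 0).comp measurable_snd)).add
    (((hA.meas i 1).comp measurable_fst).mul ((measurable_pi_apply 1).comp measurable_snd))

lemma measurable_mulVec_left (x : Vec) : Measurable fun s => A s *ᵥ x :=
  hA.measurable_mulVec.comp (measurable_id.prodMk measurable_const)

lemma two_le [Nonempty S] : 2 ≤ B :=
  (two_le_frob (hA.det (Classical.arbitrary S))).trans (hA.bound _)

/-- Each `A s` maps the annulus with parameter `r` into the one with parameter `B * r`. -/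
lemma bounded_mulVec {φ : Vec → ℝ} (hφ : LocBdd φ) (r : ℝ) :
    ∃ C, ∀ x, nsq x ≤ r → 1 ≤ r * nsq x → ∀ s, |φ (A s *ᵥ x)| ≤ C := by
  obtain ⟨C, hC⟩ := hφ.2 (B * r)
  refine ⟨C, fun x h1 h2 s => hC _ ?_ ?_⟩
  · refine (nsq_mulVec_le _ _).trans (mul_le_mul (hA.bound s) h1 (nsq_nonneg _) ?_)
    linarith [two_le_frob (hA.det s), hA.bound s]
  · have hr : 0 ≤ r := (nsq_nonneg x).trans h1
    calc 1 ≤ r * nsq x := h2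
      _ ≤ r * (B * nsq (A s *ᵥ x)) := by
        refine mul_le_mul_of_nonneg_left ((nsq_le_mulVec (hA.det s) x).trans ?_) hr
        exact mul_le_mul_of_nonneg_right (hA.bound s) (nsq_nonneg _)
      _ = _ := by ring

lemma bounded_mulVec_of_ne_zero {φ : Vec → ℝ} (hφ : LocBdd φ) {x : Vec} (hx : x ≠ 0) :
    ∃ C, ∀ s, |φ (A s *ᵥ x)| ≤ C := by
  have h := nsq_pos hx
  -- This parameter is large enough for the annulus to contain the point `x`.
  obtain ⟨C, hC⟩ := hA.bounded_mulVec hφ (nsq x + (nsq x)⁻¹)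
  refine ⟨C, hC x ?_ ?_⟩
  · have : 0 < (nsq x)⁻¹ := by positivity
    linarith
  · rw [add_mul, inv_mul_cancel₀ h.ne']
    nlinarith

variable {μ : Measure S} [IsProbabilityMeasure μ]

lemma integrable_mulVec {φ : Vec → ℝ} (hφ : LocBdd φ) {x : Vec} (hx : x ≠ 0) :
    Integrable (fun s => φ (A s *ᵥ x)) μ := by
  obtain ⟨C, hC⟩ := hA.bounded_mulVec_of_ne_zero hφ hx
  exact Integrable.of_bound (hφ.1.comp (hA.measurable_mulVec_left x)).aestronglyMeasurable C
    (ae_of_all _ hC)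

lemma locBdd_step {φ : Vec → ℝ} (hφ : LocBdd φ) : LocBdd (step A μ φ) := by
  constructor
  · have : StronglyMeasurable fun p : Vec × S => φ (A p.2 *ᵥ p.1) :=
      (hφ.1.comp (hA.measurable_mulVec.comp measurable_swap)).stronglyMeasurable
    exact this.integral_prod_right.measurable
  · intro r
    obtain ⟨C, hC⟩ := hA.bounded_mulVec hφ r
    refine ⟨C, fun x h1 h2 => ?_⟩
    have hb : ∀ᵐ s ∂μ, ‖φ (A s *ᵥ x)‖ ≤ C := ae_of_all _ (hC x h1 h2)
    simpa [step] using norm_integral_le_of_norm_le_const hb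

lemma locBdd_iterate {φ : Vec → ℝ} (hφ : LocBdd φ) (n : ℕ) : LocBdd ((step A μ)^[n] φ) := by
  induction n with
  | zero => exact hφ
  | succ n ih => rw [Function.iterate_succ_apply']; exact hA.locBdd_step ih

lemma step_mono {φ ψ : Vec → ℝ} (hφ : LocBdd φ) (hψ : LocBdd ψ) (h : ∀ x ≠ 0, φ x ≤ ψ x) :
    ∀ x ≠ 0, step A μ φ x ≤ step A μ ψ x := fun _ hx =>
  integral_mono (hA.integrable_mulVec hφ hx) (hA.integrable_mulVec hψ hx)
    fun s => h _ (mulVec_ne_zero (hA.det s) hx)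

lemma iterate_mono {φ ψ : Vec → ℝ} (hφ : LocBdd φ) (hψ : LocBdd ψ) (h : ∀ x ≠ 0, φ x ≤ ψ x)
    (n : ℕ) : ∀ x ≠ 0, (step A μ)^[n] φ x ≤ (step A μ)^[n] ψ x := by
  induction n with
  | zero => exact h
  | succ n ih =>
    rw [Function.iterate_succ_apply', Function.iterate_succ_apply']
    exact hA.step_mono (hA.locBdd_iterate hφ n) (hA.locBdd_iterate hψ n) ih

omit [IsProbabilityMeasure μ] in
lemma step_congr {φ ψ : Vec → ℝ} (h : ∀ x ≠ 0, φ x = ψ x) :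
    ∀ x ≠ 0, step A μ φ x = step A μ ψ x := fun x hx => by
  unfold step
  congr 1; ext s; exact h _ (mulVec_ne_zero (hA.det s) hx)

lemma step_add {φ ψ : Vec → ℝ} (hφ : LocBdd φ) (hψ : LocBdd ψ) {x : Vec} (hx : x ≠ 0) :
    step A μ (fun x => φ x + ψ x) x = step A μ φ x + step A μ ψ x :=
  integral_add (hA.integrable_mulVec hφ hx) (hA.integrable_mulVec hψ hx)

omit [IsProbabilityMeasure μ] hA in
lemma step_const_mul (c : ℝ) (φ : Vec → ℝ) (x : Vec) :
    step A μ (fun x => c * φ x) x = c * step A μ φ x := integral_const_mul _ _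

omit hA in
lemma step_const (c : ℝ) (x : Vec) : step A μ (fun _ => c) x = c := by simp [step]

lemma iterate_add_const {φ : Vec → ℝ} (hφ : LocBdd φ) (c : ℝ) (n : ℕ) :
    ∀ x ≠ 0, (step A μ)^[n] (fun x => φ x + c) x = (step A μ)^[n] φ x + c := by
  induction n with
  | zero => exact fun _ _ => rfl
  | succ n ih =>
    intro x hx
    rw [Function.iterate_succ_apply', Function.iterate_succ_apply', hA.step_congr ih x hx,
      hA.step_add (hA.locBdd_iterate hφ n) (locBdd_const c) hx, step_const]

omit [IsProbabilityMeasure μ] hA in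
lemma iterate_const_mul (c : ℝ) (φ : Vec → ℝ) (n : ℕ) :
    (step A μ)^[n] (fun x => c * φ x) = fun x => c * (step A μ)^[n] φ x := by
  induction n with
  | zero => rfl
  | succ n ih =>
    rw [Function.iterate_succ_apply', Function.iterate_succ_apply', ih]
    ext x; exact integral_const_mul _ _

omit [IsProbabilityMeasure μ] in
lemma det_cocycle (w : ℕ → S) (n : ℕ) : (cocycle A w n).det = 1 := by
  induction n with
  | zero => simp [cocycle]
  | succ n ih => rw [cocycle, Matrix.det_mul, hA.det, ih, one_mul]

omit [IsProbabilityMeasure μ] in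
lemma frob_cocycle_le (n : ℕ) : ∃ C, ∀ w, frob (cocycle A w n) ≤ C := by
  induction n with
  | zero => exact ⟨2, fun w => by norm_num [cocycle, frob]⟩
  | succ n ih =>
    obtain ⟨C, hC⟩ := ih
    refine ⟨B * C, fun w => ?_⟩
    have h1 : ∀ M N : Mat2, frob (M * N) ≤ frob M * frob N := by
      intro M N
      simp only [frob, Matrix.mul_apply, Fin.sum_univ_two]
      nlinarith [sq_nonneg (M 0 0 * N 1 0 - M 0 1 * N 0 0), sq_nonneg (M 0 0 * N 1 1 - M 0 1 * N 0 1),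
        sq_nonneg (M 1 0 * N 1 0 - M 1 1 * N 0 0), sq_nonneg (M 1 0 * N 1 1 - M 1 1 * N 0 1)]
    refine (h1 _ _).trans (mul_le_mul (hA.bound _) (hC w) (by unfold frob; positivity) ?_)
    linarith [two_le_frob (hA.det (w 0)), hA.bound (w 0)]

omit [IsProbabilityMeasure μ] in
lemma measurable_cocycle (n : ℕ) (i j : Fin 2) : Measurable fun w => cocycle A w n i j := by
  induction n generalizing i j with
  | zero => exact measurable_const
  | succ n ih =>
    simp only [cocycle, Matrix.mul_apply, Fin.sum_univ_two]
    exact (((hA.meas i 0).comp (measurable_pi_apply n)).mul (ih 0 j)).add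
      (((hA.meas i 1).comp (measurable_pi_apply n)).mul (ih 1 j))

omit [IsProbabilityMeasure μ] in
lemma cocycle_isBounded (n : ℕ) : ∃ C, IsBoundedUnimodular (fun w => cocycle A w n) C := by
  obtain ⟨C, hC⟩ := hA.frob_cocycle_le n
  exact ⟨C, hA.measurable_cocycle n, fun w => hA.det_cocycle w n, hC⟩

lemma integrable_cocycle {φ : Vec → ℝ} (hφ : LocBdd φ) {x : Vec} (hx : x ≠ 0) (n : ℕ) :
    Integrable (fun w => φ (cocycle A w n *ᵥ x)) (Measure.infinitePi fun _ : ℕ => μ) := by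
  obtain ⟨C, hC⟩ := hA.cocycle_isBounded n
  exact hC.integrable_mulVec hφ hx

/-- Induction on the first letter. Expectations over infinite words thereby become iterates of the
averaging operator `step`, with which all later estimates are made. -/
theorem integral_cocycle {φ : Vec → ℝ} (hφ : LocBdd φ) (n : ℕ) : ∀ x ≠ 0,
    ∫ w, φ (cocycle A w n *ᵥ x) ∂(Measure.infinitePi fun _ : ℕ => μ) = (step A μ)^[n] φ x := by
  induction n with
  | zero => intro x _; simp [cocycle]
  | succ n ih =>
    intro x hx
    have hint := hA.integrable_cocycle (μ := μ) hφ hx (n + 1)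
    rw [← map_consWord μ] at hint ⊢
    rw [integral_map measurable_consWord.aemeasurable hint.aestronglyMeasurable]
    refine (integral_prod _ (hint.comp_measurable measurable_consWord)).trans ?_
    rw [Function.iterate_succ_apply']
    unfold step
    congr 1; ext s
    simp only [Function.comp_apply]
    simp only [cocycle_consWord, ← Matrix.mulVec_mulVec]
    exact ih _ (mulVec_ne_zero (hA.det s) hx)

end IsBoundedUnimodular

end Cocycle

end Anomaly

end
noncomputable section

namespace Anomaly

/-! ### Existence of the Lyapunov exponent -/

namespace IsBoundedUnimodular

variable {S : Type*} [MeasurableSpace S] {A : S → Mat2} {B : ℝ} (hA : IsBoundedUnimodular A B)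
  {μ : Measure S} [IsProbabilityMeasure μ]
include hA

/-- A one-step drift bound accumulates linearly, because `step` is monotone and commutes with adding
constants. It serves for crude bounds on `ell` and, later, for `ell` with a corrector. -/
lemma iterate_le {ψ : Vec → ℝ} (hψ : LocBdd ψ) {g : ℝ} (h : ∀ x ≠ 0, step A μ ψ x ≤ ψ x + g)
    (n : ℕ) : ∀ x ≠ 0, (step A μ)^[n] ψ x ≤ ψ x + n * g := by
  induction n with
  | zero => intro x _; simp
  | succ n ih =>
    intro x hx
    rw [Function.iterate_succ_apply]
    have h1 := hA.iterate_mono (μ := μ) (hA.locBdd_step hψ) (hψ.add (locBdd_const g)) h n x hx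
    rw [hA.iterate_add_const hψ g n x hx] at h1
    have h2 := ih x hx
    push_cast; linarith

lemma le_iterate {ψ : Vec → ℝ} (hψ : LocBdd ψ) {g : ℝ} (h : ∀ x ≠ 0, ψ x + g ≤ step A μ ψ x)
    (n : ℕ) : ∀ x ≠ 0, ψ x + n * g ≤ (step A μ)^[n] ψ x := by
  induction n with
  | zero => intro x _; simp
  | succ n ih =>
    intro x hx
    rw [Function.iterate_succ_apply]
    have h1 := hA.iterate_mono (μ := μ) (hψ.add (locBdd_const g)) (hA.locBdd_step hψ) h n x hx
    rw [hA.iterate_add_const hψ g n x hx] at h1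
    have h2 := ih x hx
    push_cast; linarith

lemma abs_ell_mulVec_sub_le {x : Vec} (hx : x ≠ 0) (s : S) :
    |ell (A s *ᵥ x) - ell x| ≤ Real.log B / 2 :=
  ell_mulVec_le (hA.det s) (hA.bound s) hx

lemma step_ell_le {x : Vec} (hx : x ≠ 0) : step A μ ell x ≤ ell x + Real.log B / 2 := by
  have : step A μ ell x ≤ step A μ (fun _ => ell x + Real.log B / 2) x :=
    integral_mono (hA.integrable_mulVec locBdd_ell hx) (integrable_const _) fun s => by
      have := (abs_le.mp (hA.abs_ell_mulVec_sub_le hx s)).2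
      dsimp only; linarith
  rwa [step_const] at this

lemma le_step_ell {x : Vec} (hx : x ≠ 0) : ell x + -(Real.log B / 2) ≤ step A μ ell x := by
  have : step A μ (fun _ => ell x + -(Real.log B / 2)) x ≤ step A μ ell x :=
    integral_mono (integrable_const _) (hA.integrable_mulVec locBdd_ell hx) fun s => by
      have := (abs_le.mp (hA.abs_ell_mulVec_sub_le hx s)).1
      dsimp only; linarith
  rwa [step_const] at this

lemma abs_iterate_ell_sub_le (n : ℕ) {x : Vec} (hx : x ≠ 0) :
    |(step A μ)^[n] ell x - ell x| ≤ n * (Real.log B / 2) := by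
  have h1 := hA.iterate_le (μ := μ) locBdd_ell (fun x hx => hA.step_ell_le hx) n x hx
  have h2 := hA.le_iterate (μ := μ) locBdd_ell (fun x hx => hA.le_step_ell hx) n x hx
  rw [abs_le]; constructor <;> linarith

omit [IsProbabilityMeasure μ] in
lemma log_bound_nonneg [Nonempty S] : 0 ≤ Real.log B / 2 := by
  have := Real.log_nonneg (by linarith [hA.two_le] : (1 : ℝ) ≤ B)
  linarith

omit hA [IsProbabilityMeasure μ] in
/-- The smallest mean growth after `n` steps. -/
def _root_.Anomaly.minGrowth (A : S → Mat2) (μ : Measure S) (n : ℕ) : ℝ :=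
  ⨅ x : {x : Vec // x ≠ 0}, ((step A μ)^[n] ell x - ell x)

omit hA [IsProbabilityMeasure μ] in
/-- The largest mean growth after `n` steps. -/
def _root_.Anomaly.maxGrowth (A : S → Mat2) (μ : Measure S) (n : ℕ) : ℝ :=
  ⨆ x : {x : Vec // x ≠ 0}, ((step A μ)^[n] ell x - ell x)

omit hA [IsProbabilityMeasure μ] in
instance _root_.Anomaly.nonempty_nonzero : Nonempty {x : Vec // x ≠ 0} :=
  ⟨⟨![1, 0], fun h => by simpa using congrFun h 0⟩⟩

lemma minGrowth_le (n : ℕ) {x : Vec} (hx : x ≠ 0) :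
    minGrowth A μ n ≤ (step A μ)^[n] ell x - ell x :=
  ciInf_le (f := fun x : {x : Vec // x ≠ 0} => (step A μ)^[n] ell x - ell x)
    ⟨-(n * (Real.log B / 2)), by
      rintro _ ⟨y, rfl⟩
      exact (abs_le.mp (hA.abs_iterate_ell_sub_le n y.2)).1⟩ ⟨x, hx⟩

lemma le_maxGrowth (n : ℕ) {x : Vec} (hx : x ≠ 0) :
    (step A μ)^[n] ell x - ell x ≤ maxGrowth A μ n :=
  le_ciSup (f := fun x : {x : Vec // x ≠ 0} => (step A μ)^[n] ell x - ell x)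
    ⟨n * (Real.log B / 2), by
      rintro _ ⟨y, rfl⟩
      exact (abs_le.mp (hA.abs_iterate_ell_sub_le n y.2)).2⟩ ⟨x, hx⟩

/-- After the first `n` steps the walk is at some nonzero vector, from which the next `m` steps gain
at least `minGrowth A μ m` on average. -/
lemma minGrowth_add (m n : ℕ) :
    minGrowth A μ m + minGrowth A μ n ≤ minGrowth A μ (m + n) := by
  refine le_ciInf fun ⟨x, hx⟩ => ?_
  dsimp only
  rw [add_comm m n, Function.iterate_add_apply]
  have h := hA.iterate_mono (μ := μ) (locBdd_ell.add (locBdd_const (minGrowth A μ m)))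
    (hA.locBdd_iterate locBdd_ell m)
    (fun y hy => by linarith [hA.minGrowth_le (μ := μ) m hy]) n x hx
  rw [hA.iterate_add_const locBdd_ell _ n x hx] at h
  linarith [hA.minGrowth_le (μ := μ) n hx]

lemma maxGrowth_add (m n : ℕ) :
    maxGrowth A μ (m + n) ≤ maxGrowth A μ m + maxGrowth A μ n := by
  refine ciSup_le fun ⟨x, hx⟩ => ?_
  dsimp only
  rw [add_comm m n, Function.iterate_add_apply]
  have h := hA.iterate_mono (μ := μ) (hA.locBdd_iterate locBdd_ell m)
    (locBdd_ell.add (locBdd_const (maxGrowth A μ m)))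
    (fun y hy => by linarith [hA.le_maxGrowth (μ := μ) m hy]) n x hx
  rw [hA.iterate_add_const locBdd_ell _ n x hx] at h
  linarith [hA.le_maxGrowth (μ := μ) n hx]

lemma minGrowth_le_maxGrowth (n : ℕ) : minGrowth A μ n ≤ maxGrowth A μ n := by
  obtain ⟨x, hx⟩ := nonempty_nonzero
  exact (hA.minGrowth_le n hx).trans (hA.le_maxGrowth n hx)

/-- Fekete's lemma for the negative of a superadditive sequence; the limit is also the supremum of
the quotients, which gives the second claim. -/
lemma exists_min_rate : ∃ α, Tendsto (fun n : ℕ => minGrowth A μ n / n) atTop (𝓝 α) ∧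
    ∀ n : ℕ, minGrowth A μ n ≤ n * α := by
  have hs : Subadditive fun n => -minGrowth A μ n := fun m n => by
    linarith [hA.minGrowth_add (μ := μ) m n]
  have hne : Nonempty S := nonempty_of_isProbabilityMeasure μ
  have hL := hA.log_bound_nonneg
  have hbdd : BddBelow (Set.range fun n : ℕ => -minGrowth A μ n / n) := by
    refine ⟨-(Real.log B / 2), ?_⟩
    rintro _ ⟨n, rfl⟩
    obtain ⟨x, hx⟩ := nonempty_nonzero
    have h1 := hA.minGrowth_le (μ := μ) n hx
    have h2 := (abs_le.mp (hA.abs_iterate_ell_sub_le (μ := μ) n hx)).2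
    -- For `n = 0` the quotient has the default value `0`, which respects the bound since `log B` is
    -- nonnegative.
    rcases Nat.eq_zero_or_pos n with rfl | hn
    · simpa using hL
    · have : (0 : ℝ) < n := by exact_mod_cast hn
      dsimp only
      rw [le_div_iff₀ this]; linarith
  refine ⟨-hs.lim, by simpa [neg_div] using (hs.tendsto_lim hbdd).neg, fun n => ?_⟩
  rcases Nat.eq_zero_or_pos n with rfl | hn
  · simp [minGrowth]
  · have h := hs.lim_le_div hbdd hn.ne'
    have : (0 : ℝ) < n := by exact_mod_cast hn
    rw [le_div_iff₀ this] at h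
    linarith

lemma exists_max_rate : ∃ α, Tendsto (fun n : ℕ => maxGrowth A μ n / n) atTop (𝓝 α) ∧
    ∀ n : ℕ, n * α ≤ maxGrowth A μ n := by
  have hs : Subadditive fun n => maxGrowth A μ n := fun m n => hA.maxGrowth_add m n
  have hne : Nonempty S := nonempty_of_isProbabilityMeasure μ
  have hL := hA.log_bound_nonneg
  have hbdd : BddBelow (Set.range fun n : ℕ => maxGrowth A μ n / n) := by
    refine ⟨-(Real.log B / 2), ?_⟩
    rintro _ ⟨n, rfl⟩
    obtain ⟨x, hx⟩ := nonempty_nonzero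
    have h1 := hA.le_maxGrowth (μ := μ) n hx
    have h2 := (abs_le.mp (hA.abs_iterate_ell_sub_le (μ := μ) n hx)).1
    rcases Nat.eq_zero_or_pos n with rfl | hn
    · simpa using hL
    · have : (0 : ℝ) < n := by exact_mod_cast hn
      dsimp only
      rw [le_div_iff₀ this]; linarith
  refine ⟨hs.lim, hs.tendsto_lim hbdd, fun n => ?_⟩
  rcases Nat.eq_zero_or_pos n with rfl | hn
  · simp [maxGrowth]
  · have h := hs.lim_le_div hbdd hn.ne'
    have : (0 : ℝ) < n := by exact_mod_cast hn
    rw [le_div_iff₀ this] at h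
    linarith

/-- Exponential moments of a function which increases by at least `m` on average. -/
lemma step_exp_le {ψ : Vec → ℝ} (hψ : LocBdd ψ) {m L t : ℝ} (ht : 0 ≤ t) (htL : t * L ≤ 1)
    (hL : ∀ x ≠ 0, ∀ s, |ψ (A s *ᵥ x) - ψ x| ≤ L)
    (hm : ∀ x ≠ 0, ψ x + m ≤ step A μ ψ x) {x : Vec} (hx : x ≠ 0) :
    step A μ (fun x => Real.exp (-t * ψ x)) x
      ≤ Real.exp (-t * m + t ^ 2 * L ^ 2) * Real.exp (-t * ψ x) := by
  -- This is `exp y ≤ 1 + y + y ^ 2` for `|y| ≤ 1`, applied to the increment of `ψ` multiplied by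
  -- `-t`.
  have h1 : ∀ s, Real.exp (-t * ψ (A s *ᵥ x)) ≤
      Real.exp (-t * ψ x) * (1 + -t * (ψ (A s *ᵥ x) - ψ x) + t ^ 2 * L ^ 2) := by
    intro s
    have hb := hL x hx s
    have h2 : |-t * (ψ (A s *ᵥ x) - ψ x)| ≤ t * L := by
      rw [abs_mul, abs_neg, abs_of_nonneg ht]; gcongr
    have h3 := (abs_le.mp (Real.abs_exp_sub_one_sub_id_le (h2.trans htL))).2
    have h4 : (-t * (ψ (A s *ᵥ x) - ψ x)) ^ 2 ≤ t ^ 2 * L ^ 2 := by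
      rw [← mul_pow, ← sq_abs]
      exact pow_le_pow_left₀ (abs_nonneg _) h2 2
    have h5 : Real.exp (-t * ψ (A s *ᵥ x))
        = Real.exp (-t * ψ x) * Real.exp (-t * (ψ (A s *ᵥ x) - ψ x)) := by
      rw [← Real.exp_add]; congr 1; ring
    rw [h5]
    apply mul_le_mul_of_nonneg_left _ (Real.exp_pos _).le
    linarith
  have hi := hA.integrable_mulVec (μ := μ) hψ hx
  have h6 : step A μ (fun x => Real.exp (-t * ψ x)) x ≤
      ∫ s, Real.exp (-t * ψ x) * (1 + -t * (ψ (A s *ᵥ x) - ψ x) + t ^ 2 * L ^ 2) ∂μ := by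
    refine integral_mono (hA.integrable_mulVec (hψ.const_mul (-t)).exp hx) ?_ h1
    exact (((integrable_const _).add ((hi.sub (integrable_const _)).const_mul _)).add
      (integrable_const _)).const_mul _
  have h7 : ∫ s, Real.exp (-t * ψ x) * (1 + -t * (ψ (A s *ᵥ x) - ψ x) + t ^ 2 * L ^ 2) ∂μ
      = Real.exp (-t * ψ x) * (1 + -t * (step A μ ψ x - ψ x) + t ^ 2 * L ^ 2) := by
    rw [integral_const_mul, integral_add _ (integrable_const _), integral_add (integrable_const _),
      integral_const_mul, integral_sub hi (integrable_const _)]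
    · simp [step]
    · exact (hi.sub (integrable_const _)).const_mul _
    · exact (integrable_const _).add ((hi.sub (integrable_const _)).const_mul _)
  rw [h7] at h6
  refine h6.trans ?_
  rw [mul_comm]
  apply mul_le_mul_of_nonneg_right _ (Real.exp_pos _).le
  have h8 := Real.add_one_le_exp (-t * m + t ^ 2 * L ^ 2)
  have h9 := mul_le_mul_of_nonneg_left (hm x hx) ht
  linarith

omit hA in
/-- Averages of `(step A μ)^[j] ell`, an approximate solution of the Poisson equation. -/
def _root_.Anomaly.meanGrowth (A : S → Mat2) (μ : Measure S) (n : ℕ) (x : Vec) : ℝ :=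
  (1 / n : ℝ) * ∑ j ∈ Finset.range n, (step A μ)^[j] ell x

lemma locBdd_sum_iterate (n : ℕ) :
    LocBdd fun x => ∑ j ∈ Finset.range n, (step A μ)^[j] ell x := by
  induction n with
  | zero => simpa using locBdd_const 0
  | succ n ih =>
    simp only [Finset.sum_range_succ]
    exact ih.add (hA.locBdd_iterate locBdd_ell n)

/-- The sum telescopes. Divided by `n`, it shows that `meanGrowth` gains in a single step exactly
the `n`-step mean growth per step, hence at least `minGrowth A μ n / n` from every direction. -/
lemma step_sum_iterate (n : ℕ) {x : Vec} (hx : x ≠ 0) :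
    step A μ (fun x => ∑ j ∈ Finset.range n, (step A μ)^[j] ell x) x
      = ∑ j ∈ Finset.range n, (step A μ)^[j] ell x + ((step A μ)^[n] ell x - ell x) := by
  induction n with
  | zero => simp [step]
  | succ n ih =>
    simp only [Finset.sum_range_succ]
    rw [hA.step_add (hA.locBdd_sum_iterate n) (hA.locBdd_iterate locBdd_ell n) hx, ih,
      Function.iterate_succ_apply']
    ring

lemma abs_meanGrowth_sub_le {n : ℕ} (hn : 0 < n) {x : Vec} (hx : x ≠ 0) :
    |meanGrowth A μ n x - ell x| ≤ n * (Real.log B / 2) := by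
  have hne : Nonempty S := nonempty_of_isProbabilityMeasure μ
  have hL := hA.log_bound_nonneg
  have hn' : (0 : ℝ) < n := by exact_mod_cast hn
  have h1 : meanGrowth A μ n x - ell x
      = (1 / n : ℝ) * ∑ j ∈ Finset.range n, ((step A μ)^[j] ell x - ell x) := by
    rw [meanGrowth, Finset.sum_sub_distrib]
    simp only [Finset.sum_const, Finset.card_range, nsmul_eq_mul]
    field_simp
  have h2 : |∑ j ∈ Finset.range n, ((step A μ)^[j] ell x - ell x)| ≤
      ∑ j ∈ Finset.range n, (n : ℝ) * (Real.log B / 2) := by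
    refine (Finset.abs_sum_le_sum_abs _ _).trans (Finset.sum_le_sum fun j hj => ?_)
    refine (hA.abs_iterate_ell_sub_le j hx).trans ?_
    have : (j : ℝ) ≤ n := by exact_mod_cast (Finset.mem_range.mp hj).le
    gcongr
  rw [h1, abs_mul, abs_of_pos (by positivity)]
  simp only [Finset.sum_const, Finset.card_range, nsmul_eq_mul] at h2
  calc (1 / n : ℝ) * |∑ j ∈ Finset.range n, ((step A μ)^[j] ell x - ell x)|
      ≤ (1 / n : ℝ) * (n * (n * (Real.log B / 2))) := by gcongr
    _ = _ := by field_simp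

/-- The growth along any direction falls only rarely below the minimal mean rate. -/
lemma exists_integral_deficit_le {g : ℝ} {n : ℕ} (hn : 0 < n) (hg : g < minGrowth A μ n / n) :
    ∃ C, 0 ≤ C ∧ ∀ N : ℕ, ∀ x ≠ 0, ∫ w, max 0 (N * g + ell x - ell (cocycle A w N *ᵥ x))
      ∂(Measure.infinitePi fun _ : ℕ => μ) ≤ C := by
  have hne : Nonempty S := nonempty_of_isProbabilityMeasure μ
  have hL := hA.log_bound_nonneg
  have hn' : (0 : ℝ) < n := by exact_mod_cast hn
  set L := Real.log B / 2 with hLdef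
  set ψ := meanGrowth A μ n with hψdef
  set m := minGrowth A μ n / n with hm
  have hψ : LocBdd ψ := (hA.locBdd_sum_iterate n).const_mul _
  have hψe : ∀ x ≠ 0, |ψ x - ell x| ≤ n * L := fun x hx => hA.abs_meanGrowth_sub_le hn hx
  -- Increments of `ψ` are those of `ell`, at most `L`, plus the cost `n * L` of passing between `ψ`
  -- and `ell` at each end.
  set L' := 2 * (n * L) + L with hL'
  have hL'0 : 0 ≤ L' := by positivity
  have hstep : ∀ x ≠ 0, ψ x + m ≤ step A μ ψ x := by
    intro x hx
    have h1 : step A μ ψ x = ψ x + (1 / n : ℝ) * ((step A μ)^[n] ell x - ell x) := by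
      rw [hψdef]; unfold meanGrowth
      rw [step_const_mul, hA.step_sum_iterate n hx]; ring
    rw [h1, hm, div_eq_inv_mul, one_div]
    have := hA.minGrowth_le (μ := μ) n hx
    gcongr
  have hbd : ∀ x ≠ 0, ∀ s, |ψ (A s *ᵥ x) - ψ x| ≤ L' := by
    intro x hx s
    have h1 := abs_le.mp (hψe x hx)
    have h2 := abs_le.mp (hψe _ (mulVec_ne_zero (hA.det s) hx))
    have h3 := abs_le.mp (hA.abs_ell_mulVec_sub_le hx s)
    rw [abs_le]; constructor <;> linarith [h1.1, h1.2, h2.1, h2.2, h3.1, h3.2]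
  -- The first entry gives `t * L' ≤ 1`, as the quadratic bound on the exponential requires. The
  -- second gives `t * L' ^ 2 ≤ m - g`, so that the decay of the exponential moment beats the factor
  -- `exp (t * N * g)`.
  set t := min (1 / (L' + 1)) ((m - g) / (L' + 1) ^ 2) with ht
  have ht0 : 0 < t := lt_min (by positivity) (div_pos (by linarith) (by positivity))
  have ht1 : t * L' ≤ 1 := by
    calc t * L' ≤ 1 / (L' + 1) * (L' + 1) := by
          apply mul_le_mul (min_le_left _ _) (by linarith) hL'0 (by positivity)
      _ = 1 := by field_simp
  have ht2 : t * L' ^ 2 ≤ m - g := by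
    calc t * L' ^ 2 ≤ (m - g) / (L' + 1) ^ 2 * (L' + 1) ^ 2 := by
          apply mul_le_mul (min_le_right _ _) (by gcongr; linarith) (by positivity)
          exact div_nonneg (by linarith) (by positivity)
      _ = m - g := by field_simp
  set q := Real.exp (-t * m + t ^ 2 * L' ^ 2) with hq
  have hexp : LocBdd fun x => Real.exp (-t * ψ x) := (hψ.const_mul (-t)).exp
  have hiter : ∀ N : ℕ, ∀ x ≠ 0, (step A μ)^[N] (fun x => Real.exp (-t * ψ x)) x
      ≤ q ^ N * Real.exp (-t * ψ x) := by
    intro N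
    induction N with
    | zero => intro x _; simp
    | succ N ih =>
      intro x hx
      rw [Function.iterate_succ_apply]
      have h1 := hA.iterate_mono (μ := μ) (hA.locBdd_step hexp) (hexp.const_mul q)
        (fun x hx => hA.step_exp_le hψ ht0.le ht1 hbd hstep hx) N x hx
      rw [iterate_const_mul] at h1
      have h2 := ih x hx
      calc _ ≤ _ := h1
        _ ≤ q * (q ^ N * Real.exp (-t * ψ x)) :=
            mul_le_mul_of_nonneg_left h2 (Real.exp_pos _).le
        _ = _ := by ring
  refine ⟨2 * (n * L) + 1 / t, by positivity, fun N x hx => ?_⟩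
  -- Chernoff's device: `a ≤ exp (t * a) / t` for every `a`. Replacing `ell` by `ψ` at both ends
  -- costs `2 * (n * L)`.
  have hpt : ∀ w, max 0 (N * g + ell x - ell (cocycle A w N *ᵥ x)) ≤
      2 * (n * L) + 1 / t * Real.exp (t * (N * g + ψ x)) * Real.exp (-t * ψ (cocycle A w N *ᵥ x)) := by
    intro w
    set y := cocycle A w N *ᵥ x with hy
    have hy0 : y ≠ 0 := mulVec_ne_zero (hA.det_cocycle w N) hx
    have h1 := abs_le.mp (hψe x hx)
    have h2 := abs_le.mp (hψe y hy0)
    have h3 : 1 / t * Real.exp (t * (N * g + ψ x)) * Real.exp (-t * ψ y)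
        = 1 / t * Real.exp (t * (N * g + ψ x - ψ y)) := by
      rw [mul_assoc, ← Real.exp_add]; congr 2; ring
    have h4 : N * g + ψ x - ψ y ≤ 1 / t * Real.exp (t * (N * g + ψ x - ψ y)) := by
      have := Real.add_one_le_exp (t * (N * g + ψ x - ψ y))
      rw [one_div, ← div_eq_inv_mul, le_div_iff₀ ht0]
      linarith
    rw [h3]
    apply max_le
    · positivity
    · linarith [h1.1, h1.2, h2.1, h2.2]
  have hli : LocBdd fun y => max 0 (N * g + ell x - ell y) := by
    have h0 := (locBdd_const (N * g + ell x)).add (locBdd_ell.const_mul (-1))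
    refine ⟨measurable_const.max (measurable_const.sub measurable_ell), fun r => ?_⟩
    obtain ⟨C, hC⟩ := h0.2 r
    refine ⟨C, fun y h1 h2 => ?_⟩
    have := hC y h1 h2
    rw [abs_of_nonneg (le_max_left _ _)]
    apply max_le ((abs_nonneg _).trans this)
    have := (le_abs_self _).trans this
    linarith
  have h5 := integral_mono (hA.integrable_cocycle (μ := μ) hli hx N)
    ((integrable_const (2 * (n * L))).add ((hA.integrable_cocycle (μ := μ) hexp hx N).const_mul
      (1 / t * Real.exp (t * (N * g + ψ x))))) hpt
  refine h5.trans ?_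
  simp only [Pi.add_apply]
  rw [integral_add (integrable_const _) ((hA.integrable_cocycle (μ := μ) hexp hx N).const_mul _),
    integral_const_mul (1 / t * Real.exp (t * (N * g + ψ x))), hA.integral_cocycle hexp N x hx,
    integral_const, probReal_univ, one_smul]
  have h6 : 1 / t * Real.exp (t * (N * g + ψ x)) * (step A μ)^[N] (fun x => Real.exp (-t * ψ x)) x
      ≤ 1 / t * Real.exp (t * (N * g + ψ x)) * (q ^ N * Real.exp (-t * ψ x)) := by
    have := hiter N x hx
    gcongr
  have h7 : 1 / t * Real.exp (t * (N * g + ψ x)) * (q ^ N * Real.exp (-t * ψ x)) ≤ 1 / t := by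
    rw [hq, ← Real.exp_nat_mul, mul_assoc, ← Real.exp_add, ← Real.exp_add]
    apply mul_le_of_le_one_right (by positivity)
    rw [Real.exp_le_one_iff]
    have : (N : ℝ) * t * (g - m + t * L' ^ 2) ≤ 0 :=
      mul_nonpos_of_nonneg_of_nonpos (by positivity) (by linarith)
    linarith
  linarith

end IsBoundedUnimodular

end Anomaly

end
noncomputable section

namespace Anomaly

/-! ### Equality of the minimal and maximal growth rates, and location of the exponent. -/

namespace IsBoundedUnimodular

variable {S : Type*} [MeasurableSpace S] {A : S → Mat2} {B : ℝ} (hA : IsBoundedUnimodular A B)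
  {μ : Measure S} [IsProbabilityMeasure μ]
include hA

/-- Two independent directions grow together at least at the sum of the maximal and the
minimal rate. -/
lemma two_point_growth {g C : ℝ} {N : ℕ}
    (hC : ∀ x ≠ 0, ∫ w, max 0 (N * g + ell x - ell (cocycle A w N *ᵥ x))
      ∂(Measure.infinitePi fun _ : ℕ => μ) ≤ C)
    {x z : Vec} (hx : x ≠ 0) (hz : z ≠ 0) (s : S) (hω : wedge x (A s *ᵥ x) ≠ 0) :
    2 * ell x + ((step A μ)^[N] ell z - ell z) + Real.log (|wedge x (A s *ᵥ x)| / nsq x)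
      - Real.log (4 * B) / 2 + N * g - Real.log B / 2 - 2 * C
      ≤ (step A μ)^[N] ell x + (step A μ)^[N] ell (A s *ᵥ x) := by
  have hne : Nonempty S := ⟨s⟩
  set y := A s *ᵥ x with hy
  have hy0 : y ≠ 0 := mulVec_ne_zero (hA.det s) hx
  have hly := abs_le.mp (hA.abs_ell_mulVec_sub_le hx s)
  rw [← hy] at hly
  set P := Measure.infinitePi fun _ : ℕ => μ with hP
  have hdef : ∀ v ≠ 0, Integrable (fun w => max 0 (N * g + ell v - ell (cocycle A w N *ᵥ v))) P := by
    intro v hv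
    exact ((integrable_const (N * g + ell v)).sub (hA.integrable_cocycle locBdd_ell hv N)).pos_part.congr
      (ae_of_all _ fun w => by dsimp only [Pi.sub_apply]; rw [max_comm])
  -- The sum of the two logarithms is their maximum plus their minimum. The maximum is bounded below
  -- through `z` by `ell_le_max`, the minimum by the rate `g` up to the deficits; `log B / 2` pays
  -- for the difference between `ell y` and `ell x`.
  have hpt : ∀ w, (2 * ell x - ell z + Real.log (|wedge x y| / nsq x)
      - Real.log (4 * B) / 2 + N * g - Real.log B / 2) + ell (cocycle A w N *ᵥ z)
      ≤ (ell (cocycle A w N *ᵥ x) + ell (cocycle A w N *ᵥ y))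
        + (max 0 (N * g + ell x - ell (cocycle A w N *ᵥ x))
          + max 0 (N * g + ell y - ell (cocycle A w N *ᵥ y))) := by
    intro w
    have h1 := ell_le_max (hA.det_cocycle w N) (by linarith [hA.two_le] : 1 ≤ B) hx hz
      ((nsq_mulVec_le (A s) x).trans
        (mul_le_mul_of_nonneg_right (hA.bound s) (nsq_nonneg x))) hω
    rw [← hy] at h1
    have h2 := le_max_right 0 (N * g + ell x - ell (cocycle A w N *ᵥ x))
    have h3 := le_max_right 0 (N * g + ell y - ell (cocycle A w N *ᵥ y))
    have h4 := le_max_left 0 (N * g + ell x - ell (cocycle A w N *ᵥ x))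
    have h5 := le_max_left 0 (N * g + ell y - ell (cocycle A w N *ᵥ y))
    rcases max_cases (ell (cocycle A w N *ᵥ x)) (ell (cocycle A w N *ᵥ y)) with ⟨h, _⟩ | ⟨h, _⟩ <;>
      rw [h] at h1 <;> linarith [hly.1, hly.2]
  have hix := hA.integrable_cocycle (μ := μ) locBdd_ell hx N
  have hiy := hA.integrable_cocycle (μ := μ) locBdd_ell hy0 N
  have hiz := hA.integrable_cocycle (μ := μ) locBdd_ell hz N
  have key := integral_mono (μ := P) ((integrable_const _).add hiz)
    ((hix.add hiy).add ((hdef x hx).add (hdef y hy0))) hpt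
  have hsplit := integral_add (hix.add hiy) ((hdef x hx).add (hdef y hy0))
  simp only [Pi.add_apply] at key hsplit
  rw [integral_add (integrable_const _) hiz, hsplit, integral_add hix hiy,
    integral_add (hdef x hx) (hdef y hy0), integral_const, probReal_univ,
    one_smul, hA.integral_cocycle locBdd_ell N x hx, hA.integral_cocycle locBdd_ell N y hy0,
    hA.integral_cocycle locBdd_ell N z hz] at key
  linarith [hC x hx, hC y hy0]

lemma iterate_succ_ell_le (n : ℕ) {x : Vec} (hx : x ≠ 0) :
    (step A μ)^[n + 1] ell x ≤ (step A μ)^[n] ell x + Real.log B / 2 := by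
  rw [Function.iterate_succ_apply]
  refine (hA.iterate_mono (μ := μ) (hA.locBdd_step locBdd_ell)
    (locBdd_ell.add (locBdd_const (Real.log B / 2))) (fun x hx => hA.step_ell_le hx) n x hx).trans ?_
  rw [hA.iterate_add_const locBdd_ell _ n x hx]

omit hA in
-- The two-point bound contains `log q`, where `q` measures how far a direction is moved, and this
-- is unbounded below for small `q`. The weight `q ^ 2` tames it.
lemma _root_.Anomaly.sq_mul_log_ge {q : ℝ} (hq : 0 ≤ q) : -1 ≤ q ^ 2 * Real.log q := by
  rcases hq.eq_or_lt with rfl | h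
  · simp
  · have h1 := Real.one_sub_inv_le_log_of_pos h
    have h2 : q ^ 2 * (1 - q⁻¹) ≤ q ^ 2 * Real.log q := by gcongr
    have h3 : q ^ 2 * (1 - q⁻¹) = q ^ 2 - q := by field_simp
    nlinarith [sq_nonneg (q - 1 / 2)]

omit hA in
lemma _root_.Anomaly.wedge_sq_le (x y : Vec) : wedge x y ^ 2 ≤ nsq x * nsq y := by
  unfold wedge nsq; nlinarith [sq_nonneg (x 0 * y 0 + x 1 * y 1)]

lemma measurable_wedge (x : Vec) : Measurable fun s => wedge x (A s *ᵥ x) := by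
  have h := hA.measurable_mulVec_left x
  exact (((measurable_pi_apply 1).comp h).const_mul _).sub
    (((measurable_pi_apply 0).comp h).const_mul _)

/-- If the random matrices move every direction, the minimal and the maximal growth rates
agree. -/
lemma growth_gap_bound {z₀ : ℝ}
    (hmove : ∀ x ≠ 0, z₀ * nsq x ^ 2 ≤ ∫ s, wedge x (A s *ᵥ x) ^ 2 ∂μ) {α β g C : ℝ} {N : ℕ}
    (hα : minGrowth A μ N ≤ N * α) (hβ : N * β ≤ maxGrowth A μ N) (hgap : 0 ≤ β + g - 2 * α)
    (hC0 : 0 ≤ C)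
    (hC : ∀ x ≠ 0, ∫ w, max 0 (N * g + ell x - ell (cocycle A w N *ᵥ x))
      ∂(Measure.infinitePi fun _ : ℕ => μ) ≤ C) :
    z₀ * (N * (β + g - 2 * α))
      ≤ 1 + B * (2 + Real.log (4 * B) / 2 + 2 * C) + B * (1 + Real.log B) := by
  have hne : Nonempty S := nonempty_of_isProbabilityMeasure μ
  have hB := hA.two_le
  have hL := hA.log_bound_nonneg
  have hlogB : 0 ≤ Real.log (4 * B) / 2 := by
    have := Real.log_nonneg (by linarith : 1 ≤ 4 * B); linarith
  -- Directions whose mean growth over `N` steps is within `1` of the least, and below within `1` of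
  -- the greatest.
  obtain ⟨⟨x, hx⟩, hxm⟩ := exists_lt_of_ciInf_lt
    (show minGrowth A μ N < minGrowth A μ N + 1 by linarith)
  obtain ⟨⟨z, hz⟩, hzm⟩ := exists_lt_of_lt_ciSup
    (show maxGrowth A μ N - 1 < maxGrowth A μ N by linarith)
  dsimp only at hxm hzm
  have hn := nsq_pos hx
  set L := Real.log B / 2 with hLd
  set c' := 2 + Real.log (4 * B) / 2 + 2 * C with hc'
  have hc0 : 0 ≤ c' := by positivity
  set b := minGrowth A μ N with hb
  -- The excess over the least growth after a first step `A s` from `x`. Adding `L` makes it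
  -- nonnegative, as `ell (A s *ᵥ x)` and `ell x` differ by at most `L`.
  set h : S → ℝ := fun s => (step A μ)^[N] ell (A s *ᵥ x) - ell x - b + L with hh
  have hh0 : ∀ s, 0 ≤ h s := by
    intro s
    have h1 := hA.minGrowth_le (μ := μ) N (mulVec_ne_zero (hA.det s) hx)
    have h2 := (abs_le.mp (hA.abs_ell_mulVec_sub_le hx s)).1
    simp only [hh]; linarith
  have hhi : Integrable h μ :=
    (((hA.integrable_mulVec (hA.locBdd_iterate locBdd_ell N) hx).sub (integrable_const _)).sub
      (integrable_const _)).add (integrable_const _)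
  -- Averaging over the first letter gives the growth of `x` over `N + 1` steps, which exceeds that
  -- over `N` steps by at most `L`. Thus the mean excess is bounded independently of `N`.
  have hhint : ∫ s, h s ∂μ ≤ 1 + 2 * L := by
    have h1 : ∫ s, h s ∂μ = (step A μ)^[N + 1] ell x - ell x - b + L := by
      have h0 := hA.integrable_mulVec (μ := μ) (hA.locBdd_iterate (μ := μ) locBdd_ell N) hx
      have h2 : h = fun s => (step A μ)^[N] ell (A s *ᵥ x) + (-ell x - b + L) := by
        rw [hh]; ext s; ring
      rw [Function.iterate_succ_apply', h2, integral_add h0 (integrable_const _), integral_const,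
        probReal_univ, one_smul, step]
      ring
    have h2 := hA.iterate_succ_ell_le (μ := μ) N hx
    rw [h1]; linarith
  set δ := β + g - 2 * α with hδ
  -- The two-point bound makes `h s` at least `N * δ + log q - c'` when `q ≠ 0`. Multiplication by
  -- `q ^ 2 ≤ B` turns this into an inequality valid for all `s`, whose integral involves the mean
  -- square displacement.
  have hpt : ∀ s, (N * δ / nsq x ^ 2) * wedge x (A s *ᵥ x) ^ 2 - (1 + B * c') ≤ B * h s := by
    intro s
    set q := |wedge x (A s *ᵥ x)| / nsq x with hq
    have hq0 : 0 ≤ q := by positivity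
    have hqe : (N * δ / nsq x ^ 2) * wedge x (A s *ᵥ x) ^ 2 = q ^ 2 * (N * δ) := by
      rw [hq, div_pow, sq_abs]; ring
    have hqB : q ^ 2 ≤ B := by
      rw [hq, div_pow, sq_abs, div_le_iff₀ (by positivity)]
      refine (wedge_sq_le _ _).trans ?_
      have := (nsq_mulVec_le (A s) x).trans
        (mul_le_mul_of_nonneg_right (hA.bound s) (nsq_nonneg x))
      calc _ ≤ nsq x * (B * nsq x) := by gcongr
        _ = _ := by ring
    rw [hqe]
    rcases eq_or_ne (wedge x (A s *ᵥ x)) 0 with hω | hω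
    · have : q = 0 := by rw [hq, hω]; simp
      rw [this]
      have := mul_nonneg (by linarith : 0 ≤ B) (hh0 s)
      have := mul_nonneg (by linarith : 0 ≤ B) hc0
      linarith
    · have h1 := hA.two_point_growth hC hx hz s hω
      rw [← hq] at h1
      have h2 : N * δ + Real.log q - c' ≤ h s := by
        simp only [hh, hδ, hc']
        linarith
      have h3 : q ^ 2 * (N * δ + Real.log q - c') ≤ q ^ 2 * h s := by gcongr
      have h4 : q ^ 2 * h s ≤ B * h s := mul_le_mul_of_nonneg_right hqB (hh0 s)
      have h5 := sq_mul_log_ge hq0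
      have h6 : q ^ 2 * c' ≤ B * c' := mul_le_mul_of_nonneg_right hqB hc0
      linarith
  have hwi : Integrable (fun s => wedge x (A s *ᵥ x) ^ 2) μ := by
    refine Integrable.of_bound ((hA.measurable_wedge x).pow_const 2).aestronglyMeasurable
      (nsq x * (B * nsq x)) (ae_of_all _ fun s => ?_)
    rw [Real.norm_of_nonneg (sq_nonneg _)]
    refine (wedge_sq_le _ _).trans ?_
    have := (nsq_mulVec_le (A s) x).trans
      (mul_le_mul_of_nonneg_right (hA.bound s) (nsq_nonneg x))
    gcongr
  have key := integral_mono (μ := μ) ((hwi.const_mul (N * δ / nsq x ^ 2)).sub (integrable_const _))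
    (hhi.const_mul B) hpt
  simp only [Pi.sub_apply] at key
  rw [integral_sub (hwi.const_mul _) (integrable_const _), integral_const_mul, integral_const_mul,
    integral_const, probReal_univ, one_smul] at key
  have h7 : N * δ / nsq x ^ 2 * (z₀ * nsq x ^ 2)
      ≤ N * δ / nsq x ^ 2 * ∫ s, wedge x (A s *ᵥ x) ^ 2 ∂μ := by
    have := hmove x hx
    gcongr
  have h8 : N * δ / nsq x ^ 2 * (z₀ * nsq x ^ 2) = z₀ * (N * δ) := by
    field_simp
  have h9 : B * ∫ s, h s ∂μ ≤ B * (1 + 2 * L) := by gcongr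
  have h10 : 2 * L = Real.log B := by rw [hLd]; ring
  rw [h10] at h9
  linarith

/-- If the random matrices move every direction, the Lyapunov exponent exists and does not depend
on the initial direction. -/
theorem exists_tendsto_growth {z₀ : ℝ} (hz₀ : 0 < z₀)
    (hmove : ∀ x ≠ 0, z₀ * nsq x ^ 2 ≤ ∫ s, wedge x (A s *ᵥ x) ^ 2 ∂μ) :
    ∃ γ, ∀ x ≠ 0, Tendsto (fun N : ℕ => (1 / (N : ℝ)) * (step A μ)^[N] ell x) atTop (𝓝 γ) := by
  obtain ⟨α, hαt, hα⟩ := hA.exists_min_rate (μ := μ)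
  obtain ⟨β, hβt, hβ⟩ := hA.exists_max_rate (μ := μ)
  have hαβ : α ≤ β := le_of_tendsto_of_tendsto' hαt hβt fun n => by
    have := hA.minGrowth_le_maxGrowth (μ := μ) n
    gcongr
  have heq : α = β := by
    by_contra hne
    have hlt : α < β := lt_of_le_of_ne hαβ hne
    -- The rate `g = α - (β - α) / 2` lies below `α`, as the deficit bound needs, yet leaves `β + g
    -- - 2 * α = (β - α) / 2` positive.
    obtain ⟨n, hn, hn0⟩ := ((hαt.eventually (lt_mem_nhds
      (show α - (β - α) / 2 < α by linarith))).and (eventually_gt_atTop 0)).exists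
    obtain ⟨C, hC0, hC⟩ := hA.exists_integral_deficit_le (μ := μ) hn0 hn
    -- The gap bound is linear in `N` on the left and constant on the right, so it fails for this
    -- `N`.
    obtain ⟨N, hN⟩ := exists_nat_gt
      ((1 + B * (2 + Real.log (4 * B) / 2 + 2 * C) + B * (1 + Real.log B)) / (z₀ * ((β - α) / 2)))
    have h1 := hA.growth_gap_bound hmove (hα N) (hβ N)
      (show 0 ≤ β + (α - (β - α) / 2) - 2 * α by linarith) hC0 (hC N)
    rw [div_lt_iff₀ (mul_pos hz₀ (by linarith))] at hN
    have h2 : z₀ * (N * (β + (α - (β - α) / 2) - 2 * α)) = N * (z₀ * ((β - α) / 2)) := by ring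
    linarith
  subst heq
  refine ⟨α, fun x hx => ?_⟩
  have hzero : Tendsto (fun N : ℕ => ell x / (N : ℝ)) atTop (𝓝 0) :=
    tendsto_const_nhds.div_atTop tendsto_natCast_atTop_atTop
  have h1 : Tendsto (fun N : ℕ => minGrowth A μ N / N + ell x / N) atTop (𝓝 α) := by
    simpa using hαt.add hzero
  have h2 : Tendsto (fun N : ℕ => maxGrowth A μ N / N + ell x / N) atTop (𝓝 α) := by
    simpa using hβt.add hzero
  refine tendsto_of_tendsto_of_tendsto_of_le_of_le h1 h2 (fun N => ?_) (fun N => ?_)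
  · have := hA.minGrowth_le (μ := μ) N hx
    dsimp only
    rw [← add_div, one_div, ← div_eq_inv_mul]
    gcongr; linarith
  · have := hA.le_maxGrowth (μ := μ) N hx
    dsimp only
    rw [← add_div, one_div, ← div_eq_inv_mul]
    gcongr; linarith

/-- An approximate solution of the Poisson equation locates the Lyapunov exponent. -/
theorem abs_growth_sub_le {γ : ℝ} {x : Vec} (hx : x ≠ 0)
    (hγ : Tendsto (fun N : ℕ => (1 / (N : ℝ)) * (step A μ)^[N] ell x) atTop (𝓝 γ))
    {Φ : Vec → ℝ} (hΦ : Measurable Φ) {C : ℝ} (hC : ∀ x, |Φ x| ≤ C) {g ε : ℝ}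
    (h : ∀ y ≠ 0, |(step A μ ell y - ell y) - (step A μ Φ y - Φ y) - g| ≤ ε) :
    |γ - g| ≤ ε := by
  have hΦl : LocBdd Φ := locBdd_of_bound hΦ hC
  have hC0 : 0 ≤ C := (abs_nonneg _).trans (hC 0)
  -- The corrected logarithm has one-step drift within `ε` of `g` from every direction, and differs
  -- from `ell` by a bounded amount that vanishes after division by `N`.
  set ψ : Vec → ℝ := fun x => ell x + (-1) * Φ x with hψ
  have hψl : LocBdd ψ := locBdd_ell.add (hΦl.const_mul (-1))
  have hst : ∀ y ≠ 0, step A μ ψ y = step A μ ell y - step A μ Φ y := by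
    intro y hy
    rw [hψ, hA.step_add locBdd_ell (hΦl.const_mul (-1)) hy, step_const_mul]; ring
  have hup : ∀ y ≠ 0, step A μ ψ y ≤ ψ y + (g + ε) := fun y hy => by
    have := (abs_le.mp (h y hy)).2
    rw [hst y hy]; simp only [hψ]; linarith
  have hlo : ∀ y ≠ 0, ψ y + (g - ε) ≤ step A μ ψ y := fun y hy => by
    have := (abs_le.mp (h y hy)).1
    rw [hst y hy]; simp only [hψ]; linarith
  have hle : ∀ y ≠ 0, ell y ≤ ψ y + C := fun y _ => by
    have := (abs_le.mp (hC y)).2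
    simp only [hψ]; linarith
  have hge : ∀ y ≠ 0, ψ y + (-C) ≤ ell y := fun y _ => by
    have := (abs_le.mp (hC y)).1
    simp only [hψ]; linarith
  have h1 : ∀ N : ℕ, (step A μ)^[N] ell x ≤ N * (g + ε) + (ψ x + C) := fun N => by
    have e1 := hA.iterate_mono (μ := μ) locBdd_ell (hψl.add (locBdd_const C)) hle N x hx
    rw [hA.iterate_add_const hψl _ N x hx] at e1
    linarith [hA.iterate_le hψl hup N x hx]
  have h2 : ∀ N : ℕ, N * (g - ε) + (ψ x - C) ≤ (step A μ)^[N] ell x := fun N => by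
    have e1 := hA.iterate_mono (μ := μ) (hψl.add (locBdd_const (-C))) locBdd_ell hge N x hx
    rw [hA.iterate_add_const hψl _ N x hx] at e1
    linarith [hA.le_iterate hψl hlo N x hx]
  have hlim : ∀ c d : ℝ, Tendsto (fun N : ℕ => (1 / (N : ℝ)) * (N * c + d)) atTop (𝓝 c) := by
    intro c d
    have hzero : Tendsto (fun N : ℕ => d / (N : ℝ)) atTop (𝓝 0) :=
      tendsto_const_nhds.div_atTop tendsto_natCast_atTop_atTop
    have : Tendsto (fun N : ℕ => c + d / (N : ℝ)) atTop (𝓝 c) := by simpa using hzero.const_add c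
    refine this.congr' ?_
    filter_upwards [eventually_gt_atTop 0] with N hN
    have : (N : ℝ) ≠ 0 := by exact_mod_cast hN.ne'
    field_simp
  have h3 : γ ≤ g + ε := le_of_tendsto_of_tendsto' hγ (hlim _ _) fun N =>
    mul_le_mul_of_nonneg_left (h1 N) (by positivity)
  have h4 : g - ε ≤ γ := le_of_tendsto_of_tendsto' (hlim _ _) hγ fun N =>
    mul_le_mul_of_nonneg_left (h2 N) (by positivity)
  rw [abs_le]; constructor <;> linarith

end IsBoundedUnimodular

end Anomaly

end
noncomputable section

namespace Anomaly

/-! ### Analytic primitives -/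

/-- A real analytic function of one variable extends holomorphically to a complex disc. -/
lemma _root_.AnalyticAt.exists_complex_extension {f : ℝ → ℝ} {x : ℝ} (hf : AnalyticAt ℝ f x) :
    ∃ r > 0, ∃ F : ℂ → ℂ, DifferentiableOn ℂ F (Metric.ball 0 r) ∧
      ∀ y : ℝ, |y| < r → F y = f (x + y) := by
  obtain ⟨p, R, hp⟩ := hf
  obtain ⟨r, hr0, hrR⟩ := ENNReal.lt_iff_exists_nnreal_btwn.mp hp.r_pos
  have hr0' : 0 < r := by exact_mod_cast hr0
  obtain ⟨C, -, hC⟩ := p.norm_mul_pow_le_of_lt_radius (hrR.trans_le hp.r_le)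
  set c : FormalMultilinearSeries ℂ ℂ ℂ :=
    FormalMultilinearSeries.ofScalars ℂ fun n => (p.coeff n : ℂ) with hc
  have hrad : (r : ENNReal) ≤ c.radius := by
    refine c.le_radius_of_bound C fun n => ?_
    rw [hc, FormalMultilinearSeries.ofScalars_norm, Complex.norm_real,
      ← FormalMultilinearSeries.norm_apply_eq_norm_coef]
    exact hC n
  have hcp := (c.hasFPowerSeriesOnBall (hr0.trans_le hrad)).mono hr0 hrad
  have hmem : ∀ z : ℂ, ‖z‖ < r → z ∈ Metric.eball (0 : ℂ) (r : ENNReal) := by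
    intro z hz
    rw [Metric.eball_coe]; simpa using hz
  refine ⟨r, hr0', c.sum, ?_, fun y hy => ?_⟩
  · have := hcp.differentiableOn
    rwa [Metric.eball_coe] at this
  · have hy' : y ∈ Metric.eball (0 : ℝ) R := by
      refine Metric.eball_subset_eball hrR.le ?_
      rw [Metric.eball_coe]; simpa using hy
    have h1 := hp.hasSum hy'
    have h2 := hcp.hasSum (hmem (y : ℂ) (by simpa using hy))
    rw [zero_add] at h2
    have h3 : (fun n => (c n) fun _ => (y : ℂ)) = fun n => (((p n) fun _ => y : ℝ) : ℂ) := by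
      ext n
      rw [hc, FormalMultilinearSeries.ofScalars_apply_eq, FormalMultilinearSeries.apply_eq_pow_smul_coeff]
      simp [mul_comm]
    rw [h3] at h2
    exact h2.unique (Complex.hasSum_ofReal.mpr h1)

/-- The derivative extends holomorphically to a disc and has a holomorphic primitive there. Its real
part on the real axis differs from `F` by a constant. -/
lemma _root_.AnalyticAt.of_hasDerivAt {F f : ℝ → ℝ} {x : ℝ} (hf : AnalyticAt ℝ f x)
    (hF : ∀ y, HasDerivAt F (f y) y) : AnalyticAt ℝ F x := by
  obtain ⟨r, hr, g, hg, hgf⟩ := hf.exists_complex_extension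
  obtain ⟨H, hH⟩ := hg.isExactOn_ball
  have hHa : AnalyticAt ℂ H 0 := by
    refine DifferentiableOn.analyticAt (s := Metric.ball 0 r)
      (fun z hz => (hH z hz).differentiableAt.differentiableWithinAt) (Metric.ball_mem_nhds _ hr)
  set h : ℝ → ℝ := fun y => (H (y : ℂ)).re with hh
  have hha : AnalyticAt ℝ h 0 := AnalyticAt.re_ofReal (by simpa using hHa)
  have hhd : ∀ y ∈ Metric.ball (0 : ℝ) r, HasDerivAt h (f (x + y)) y := by
    intro y hy
    have hy' : |y| < r := by simpa using hy
    have := (hH (y : ℂ) (by simpa using hy')).real_of_complex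
    rwa [hgf y hy', Complex.ofReal_re] at this
  have hd : ∀ y ∈ Metric.ball (0 : ℝ) r, HasDerivAt (fun y => F (x + y) - h y) 0 y := by
    intro y hy
    have h1 : HasDerivAt (fun y => F (x + y)) (f (x + y)) y := (hF (x + y)).comp_const_add x y
    exact (h1.sub (hhd y hy)).congr_deriv (sub_self _)
  have hconst : ∀ y ∈ Metric.ball (0 : ℝ) r, F (x + y) = h y + (F x - h 0) := by
    intro y hy
    have := Metric.isOpen_ball.is_const_of_deriv_eq_zero (convex_ball (0 : ℝ) r).isPreconnected
      (fun z hz => (hd z hz).differentiableAt.differentiableWithinAt)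
      (fun z hz => (hd z hz).deriv) hy (Metric.mem_ball_self hr)
    simp only [add_zero] at this
    linarith
  have h0 : AnalyticAt ℝ (fun y => F (x + y)) 0 := by
    refine (hha.add (analyticAt_const (v := F x - h 0))).congr ?_
    filter_upwards [Metric.ball_mem_nhds (0 : ℝ) hr] with y hy
    exact (hconst y hy).symm
  have h1 : AnalyticAt ℝ (fun y : ℝ => y - x) x := analyticAt_id.sub analyticAt_const
  have h2 := AnalyticAt.fun_comp (g := fun y => F (x + y)) (f := fun y => y - x) (x := x)
    (by simpa using h0) h1
  simpa using h2

lemma hasDerivAt_integral {f : ℝ → ℝ} (hf : Continuous f) (θ : ℝ) :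
    HasDerivAt (fun θ => ∫ t in (0 : ℝ)..θ, f t) (f θ) θ :=
  intervalIntegral.integral_hasDerivAt_right (hf.intervalIntegrable _ _)
    hf.stronglyMeasurable.stronglyMeasurableAtFilter hf.continuousAt

/-- Real analytic functions on the line. -/
abbrev IsAnalytic (f : ℝ → ℝ) : Prop := ∀ x, AnalyticAt ℝ f x

lemma IsAnalytic.continuous {f : ℝ → ℝ} (hf : IsAnalytic f) : Continuous f :=
  continuous_iff_continuousAt.mpr fun x => (hf x).continuousAt

lemma IsAnalytic.integral {f : ℝ → ℝ} (hf : IsAnalytic f) :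
    IsAnalytic fun θ => ∫ t in (0 : ℝ)..θ, f t :=
  fun x => (hf x).of_hasDerivAt (hasDerivAt_integral hf.continuous)

lemma IsAnalytic.contDiff {f : ℝ → ℝ} (hf : IsAnalytic f) {n : WithTop ℕ∞} : ContDiff ℝ n f :=
  contDiff_iff_contDiffAt.mpr fun x => (hf x).contDiffAt

lemma IsAnalytic.inv_sqrt {f : ℝ → ℝ} (hf : IsAnalytic f) (hpos : ∀ x, 0 < f x) :
    IsAnalytic fun x => (Real.sqrt (f x))⁻¹ := by
  have h : (fun x => (Real.sqrt (f x))⁻¹) = fun x => Real.exp (-(1 / 2) * Real.log (f x)) := by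
    ext x
    rw [Real.sqrt_eq_rpow, ← Real.rpow_neg (hpos x).le, Real.rpow_def_of_pos (hpos x), mul_comm]
  rw [h]
  intro x
  exact AnalyticAt.rexp (analyticAt_const.mul ((hf x).log (hpos x)))

/-- The primitive of a function which is multiplied by a constant over each period. -/
lemma integral_add_period {f : ℝ → ℝ} (hf : Continuous f) {p c : ℝ} (h : ∀ t, f (t + p) = c * f t)
    (θ : ℝ) : ∫ t in (0 : ℝ)..(θ + p), f t
      = (∫ t in (0 : ℝ)..p, f t) + c * ∫ t in (0 : ℝ)..θ, f t := by
  rw [← intervalIntegral.integral_add_adjacent_intervals (hf.intervalIntegrable 0 p)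
    (hf.intervalIntegrable p (θ + p)), ← intervalIntegral.integral_const_mul]
  congr 1
  have := intervalIntegral.integral_comp_add_right (a := 0) (b := θ) f p
  rw [zero_add] at this
  rw [← this]
  simp only [h]

/-! ### The stationary density and the Poisson equation on the circle -/

/-- The coefficients of a non-degenerate diffusion on the circle. -/
structure IsCircleDiffusion (D q : ℝ → ℝ) : Prop where
  anD : IsAnalytic D
  anq : IsAnalytic q
  perD : ∀ θ, D (θ + 2 * Real.pi) = D θ
  perq : ∀ θ, q (θ + 2 * Real.pi) = q θ
  pos : ∀ θ, 0 < D θ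

section Circle

variable (D q : ℝ → ℝ)

/-- The logarithm of the integrating factor. -/
def logFactor (θ : ℝ) : ℝ := ∫ t in (0 : ℝ)..θ, 2 * q t / D t

/-- The derivative of the scale function. -/
def scaleDeriv (θ : ℝ) : ℝ := 2 * (Real.sqrt (D θ))⁻¹ * Real.exp (-logFactor D q θ)

/-- The scale function. -/
def scaleFun (θ : ℝ) : ℝ := ∫ t in (0 : ℝ)..θ, scaleDeriv D q t

/-- The constant which makes the stationary density periodic. -/
def fluxConst : ℝ :=
  (Real.exp (-logFactor D q (2 * Real.pi)) - 1) / scaleFun D q (2 * Real.pi)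

/-- The stationary density before normalization. -/
def statDensity (θ : ℝ) : ℝ :=
  Real.exp (logFactor D q θ) / Real.sqrt (D θ) * (fluxConst D q * scaleFun D q θ + 1)

variable {D q} (h : IsCircleDiffusion D q)
include h

namespace IsCircleDiffusion

lemma an_drift : IsAnalytic fun t => 2 * q t / D t := fun x =>
  (analyticAt_const.mul (h.anq x)).div (h.anD x) (h.pos x).ne'

lemma an_logFactor : IsAnalytic (logFactor D q) := h.an_drift.integral

lemma hasDerivAt_logFactor (θ : ℝ) : HasDerivAt (logFactor D q) (2 * q θ / D θ) θ :=
  hasDerivAt_integral h.an_drift.continuous θ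

lemma an_scaleDeriv : IsAnalytic (scaleDeriv D q) := fun x =>
  (analyticAt_const.mul (h.anD.inv_sqrt h.pos x)).mul (AnalyticAt.rexp (h.an_logFactor x).neg)

lemma an_scaleFun : IsAnalytic (scaleFun D q) := h.an_scaleDeriv.integral

lemma hasDerivAt_scaleFun (θ : ℝ) : HasDerivAt (scaleFun D q) (scaleDeriv D q θ) θ :=
  hasDerivAt_integral h.an_scaleDeriv.continuous θ

lemma an_statDensity : IsAnalytic (statDensity D q) := fun x => by
  have := ((AnalyticAt.rexp (h.an_logFactor x)).mul (h.anD.inv_sqrt h.pos x)).mul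
    ((analyticAt_const (v := fluxConst D q)).mul (h.an_scaleFun x) |>.add (analyticAt_const (v := 1)))
  exact this

lemma logFactor_add (θ : ℝ) :
    logFactor D q (θ + 2 * Real.pi) = logFactor D q (2 * Real.pi) + logFactor D q θ := by
  have := integral_add_period h.an_drift.continuous (p := 2 * Real.pi) (c := 1)
    (fun t => by rw [h.perD, h.perq, one_mul]) θ
  rwa [one_mul] at this

/-- Since `logFactor` is additive over a period, the integrand is multiplied by `exp (-logFactor D q
(2 * π))` from one period to the next. -/
lemma scaleFun_add (θ : ℝ) : scaleFun D q (θ + 2 * Real.pi)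
    = scaleFun D q (2 * Real.pi) + Real.exp (-logFactor D q (2 * Real.pi)) * scaleFun D q θ :=
  integral_add_period h.an_scaleDeriv.continuous (fun t => by
    unfold scaleDeriv
    rw [h.perD, h.logFactor_add, neg_add, Real.exp_add]; ring) θ

omit h in
lemma scaleFun_zero : scaleFun D q 0 = 0 := by simp [scaleFun]

lemma scaleDeriv_pos (θ : ℝ) : 0 < scaleDeriv D q θ := by
  have := Real.sqrt_pos.mpr (h.pos θ)
  unfold scaleDeriv; positivity

lemma strictMono_scaleFun : StrictMono (scaleFun D q) :=
  strictMono_of_deriv_pos fun x => by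
    rw [(h.hasDerivAt_scaleFun x).deriv]; exact h.scaleDeriv_pos x

lemma scaleFun_two_pi_pos : 0 < scaleFun D q (2 * Real.pi) := by
  have := h.strictMono_scaleFun (show (0 : ℝ) < 2 * Real.pi by positivity)
  rwa [scaleFun_zero] at this

lemma fluxConst_mul :
    fluxConst D q * scaleFun D q (2 * Real.pi) = Real.exp (-logFactor D q (2 * Real.pi)) - 1 :=
  div_mul_cancel₀ _ h.scaleFun_two_pi_pos.ne'

/-- Over a period `fluxConst * scaleFun + 1` is multiplied by `exp (-logFactor D q (2 * π))`, by the
choice of `fluxConst`; this cancels the gain of the exponential prefactor. -/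
lemma statDensity_add (θ : ℝ) : statDensity D q (θ + 2 * Real.pi) = statDensity D q θ := by
  have h1 : fluxConst D q * scaleFun D q (θ + 2 * Real.pi) + 1
      = Real.exp (-logFactor D q (2 * Real.pi)) * (fluxConst D q * scaleFun D q θ + 1) := by
    rw [h.scaleFun_add, mul_add, h.fluxConst_mul]; ring
  unfold statDensity
  rw [h1, h.perD, h.logFactor_add, Real.exp_add, Real.exp_neg]
  have := Real.exp_pos (logFactor D q (2 * Real.pi))
  field_simp

/-- By periodicity one period suffices. There `fluxConst * scaleFun + 1` is affine in the increasing
scale function, with values `1` and `exp (-logFactor D q (2 * π)) > 0` at the two ends. -/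
lemma statDensity_pos (θ : ℝ) : 0 < statDensity D q θ := by
  obtain ⟨y, ⟨hy0, hy1⟩, hy⟩ := Function.Periodic.exists_mem_Ico₀
    (f := statDensity D q) h.statDensity_add (by positivity) θ
  rw [hy]
  have hK0 : 0 ≤ scaleFun D q y := by
    rw [← scaleFun_zero (D := D) (q := q)]; exact h.strictMono_scaleFun.monotone hy0
  have hK1 : scaleFun D q y < scaleFun D q (2 * Real.pi) := h.strictMono_scaleFun hy1
  have hK := h.scaleFun_two_pi_pos
  have hlin : 0 < fluxConst D q * scaleFun D q y + 1 := by
    have hE := Real.exp_pos (-logFactor D q (2 * Real.pi))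
    have hC := h.fluxConst_mul
    by_contra! hneg
    have h1 : fluxConst D q * scaleFun D q (2 * Real.pi) > -1 := by linarith
    have hCneg : fluxConst D q < 0 := by
      by_contra! h2
      have := mul_nonneg h2 hK0
      linarith
    nlinarith
  have := Real.sqrt_pos.mpr (h.pos y)
  unfold statDensity; positivity

lemma integral_statDensity_pos : 0 < ∫ t in (0 : ℝ)..(2 * Real.pi), statDensity D q t :=
  intervalIntegral.intervalIntegral_pos_of_pos
    (h.an_statDensity.continuous.intervalIntegrable _ _) h.statDensity_pos (by positivity)

lemma hasDerivAt_inv_sqrt {d : ℝ} {θ : ℝ} (hd : HasDerivAt D d θ) :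
    HasDerivAt (fun θ => (Real.sqrt (D θ))⁻¹) (-(d / (2 * D θ)) * (Real.sqrt (D θ))⁻¹) θ := by
  have h1 := (hd.sqrt (h.pos θ).ne').inv (Real.sqrt_pos.mpr (h.pos θ)).ne'
  refine h1.congr_deriv ?_
  have h2 := Real.sqrt_pos.mpr (h.pos θ)
  have h3 := Real.sq_sqrt (h.pos θ).le
  rw [h3]
  have := h.pos θ
  field_simp

/-- The probability flux of the stationary density is constant. -/
lemma statDensity_flux {d : ℝ} {θ : ℝ} (hd : HasDerivAt D d θ) :
    (1 / 2) * D θ * deriv (statDensity D q) θ + (1 / 2) * (d / 2) * statDensity D q θ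
      - q θ * statDensity D q θ = fluxConst D q := by
  have h1 := (((h.hasDerivAt_logFactor θ).exp.mul (h.hasDerivAt_inv_sqrt hd)).mul
    (((h.hasDerivAt_scaleFun θ).const_mul (fluxConst D q)).add_const 1))
  have h2 : HasDerivAt (statDensity D q) _ θ := h1
  rw [h2.deriv]
  simp only [statDensity, scaleDeriv, Real.exp_neg, div_eq_mul_inv, Pi.mul_apply]
  have hs := Real.sqrt_pos.mpr (h.pos θ)
  have hs2 := Real.sq_sqrt (h.pos θ).le
  have he := Real.exp_pos (logFactor D q θ)
  set r := Real.sqrt (D θ)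
  rw [← hs2]
  field_simp
  ring

/-- The Poisson equation on the circle is solvable when its right-hand side is orthogonal to the
stationary density. -/
theorem exists_poisson_solution {g : ℝ → ℝ} (hg : IsAnalytic g)
    (hgper : ∀ θ, g (θ + 2 * Real.pi) = g θ)
    (horth : ∫ t in (0 : ℝ)..(2 * Real.pi), statDensity D q t * g t = 0) :
    ∃ φ u : ℝ → ℝ, IsAnalytic u ∧ (∀ θ, φ (θ + 2 * Real.pi) = φ θ) ∧
      (∀ θ, u (θ + 2 * Real.pi) = u θ) ∧ (∀ θ, HasDerivAt φ (u θ) θ) ∧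
      ∀ θ, (1 / 2) * D θ * deriv u θ + ((1 / 2) * (deriv D θ / 2) + q θ) * u θ = g θ := by
  set κ := logFactor D q with hκ
  set K := scaleFun D q with hK
  -- Variation of constants: `(sqrt D)⁻¹ * exp (-κ)` solves the homogeneous equation for `u = φ'`,
  -- and `G'` is the derivative of the varying coefficient.
  set G' : ℝ → ℝ := fun t => 2 * Real.exp (κ t) * (Real.sqrt (D t))⁻¹ * g t with hG'
  set G : ℝ → ℝ := fun θ => ∫ t in (0 : ℝ)..θ, G' t with hG
  have anG' : IsAnalytic G' := fun x => ((analyticAt_const.mul (AnalyticAt.rexp (h.an_logFactor x))).mul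
    (h.anD.inv_sqrt h.pos x)).mul (hg x)
  have anG : IsAnalytic G := anG'.integral
  have hGd : ∀ θ, HasDerivAt G (G' θ) θ := fun θ => hasDerivAt_integral anG'.continuous θ
  set p := 2 * Real.pi with hp
  have hKp : 0 < K p := h.scaleFun_two_pi_pos
  have hGadd : ∀ θ, G (θ + p) = G p + Real.exp (κ p) * G θ :=
    integral_add_period anG'.continuous (fun t => by
      simp only [hG']
      rw [h.perD, hκ, h.logFactor_add, Real.exp_add, hgper]; ring)
  set J := ∫ t in (0 : ℝ)..p, K t * G' t with hJ
  -- The orthogonality hypothesis, rewritten in terms of `G` and `K`.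
  have hCJ : fluxConst D q * J + G p = 0 := by
    have h1 : (fun t => statDensity D q t * g t)
        = fun t => (1 / 2) * (fluxConst D q * (K t * G' t) + G' t) := by
      ext t; simp only [statDensity, hG', hκ, hK]; ring
    rw [h1, intervalIntegral.integral_const_mul, intervalIntegral.integral_add,
      intervalIntegral.integral_const_mul] at horth
    · have : fluxConst D q * J + G p = 2 * (1 / 2 * (fluxConst D q * J + G p)) := by ring
      rw [this]; simp only [hJ, hG]; rw [horth, mul_zero]
    · exact (continuous_const.mul
        (h.an_scaleFun.continuous.mul anG'.continuous)).intervalIntegrable _ _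
    · exact anG'.continuous.intervalIntegrable _ _
  -- The constant of integration for which `u` has mean zero, so that `φ` is periodic. That the same
  -- constant makes `u` periodic is the solvability condition `hCJ`.
  set a := -G p + J / K p with ha
  set u : ℝ → ℝ := fun θ => (Real.sqrt (D θ))⁻¹ * Real.exp (-κ θ) * (a + G θ) with hu
  have anu : IsAnalytic u := fun x =>
    ((h.anD.inv_sqrt h.pos x).mul (AnalyticAt.rexp (h.an_logFactor x).neg)).mul
      (analyticAt_const.add (anG x))
  have hE : Real.exp (-κ p) * (a + G p) = a := by
    have hC := h.fluxConst_mul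
    rw [← hκ, ← hK, ← hp] at hC
    have h1 : Real.exp (-κ p) = fluxConst D q * K p + 1 := by linarith
    have h2 : G p = -(fluxConst D q * J) := by linarith
    rw [h1, ha, h2]
    field_simp
    ring
  have huper : ∀ θ, u (θ + p) = u θ := by
    intro θ
    simp only [hu]
    rw [h.perD, hGadd, hκ, h.logFactor_add, ← hκ, neg_add, Real.exp_add]
    have h1 : Real.exp (-κ p) * (a + (G p + Real.exp (κ p) * G θ)) = a + G θ := by
      rw [← add_assoc, mul_add, hE, ← mul_assoc, ← Real.exp_add]; simp
    calc _ = (Real.sqrt (D θ))⁻¹ * Real.exp (-κ θ)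
          * (Real.exp (-κ p) * (a + (G p + Real.exp (κ p) * G θ))) := by ring
      _ = _ := by rw [h1]
  -- Up to the factor 1/2, the integral is `a * K p` plus the integral of `K' * G`; integration by
  -- parts turns the latter into `K p * G p - J`.
  have hu0 : ∫ t in (0 : ℝ)..p, u t = 0 := by
    have hparts := intervalIntegral.integral_mul_deriv_eq_deriv_mul (a := 0) (b := p)
      (u := K) (v := G) (u' := scaleDeriv D q) (v' := G')
      (fun x _ => h.hasDerivAt_scaleFun x) (fun x _ => hGd x)
      (h.an_scaleDeriv.continuous.intervalIntegrable _ _) (anG'.continuous.intervalIntegrable _ _)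
    have hK0 : K 0 = 0 := scaleFun_zero
    rw [hK0, zero_mul, sub_zero, ← hJ] at hparts
    have h1 : u = fun t => (1 / 2) * (a * scaleDeriv D q t + scaleDeriv D q t * G t) := by
      ext t; simp only [hu, scaleDeriv, hκ]; ring
    have h2 : ∫ t in (0 : ℝ)..p, scaleDeriv D q t = K p := rfl
    rw [h1, intervalIntegral.integral_const_mul, intervalIntegral.integral_add,
      intervalIntegral.integral_const_mul, h2]
    · have h3 : ∫ t in (0 : ℝ)..p, scaleDeriv D q t * G t = K p * G p - J := by linarith
      rw [h3, ha]; field_simp; ring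
    · exact (continuous_const.mul h.an_scaleDeriv.continuous).intervalIntegrable _ _
    · exact (h.an_scaleDeriv.continuous.mul anG.continuous).intervalIntegrable _ _
  refine ⟨fun θ => ∫ t in (0 : ℝ)..θ, u t, u, anu, fun θ => ?_, huper,
    hasDerivAt_integral anu.continuous, fun θ => ?_⟩
  · dsimp only
    rw [integral_add_period anu.continuous (c := 1) (fun t => by rw [huper, one_mul]) θ, hu0]
    ring
  · have hd : HasDerivAt D (deriv D θ) θ := (h.anD θ).differentiableAt.hasDerivAt
    have h1 : HasDerivAt u _ θ := ((h.hasDerivAt_inv_sqrt hd).mul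
      (h.hasDerivAt_logFactor θ).neg.exp).mul ((hGd θ).const_add a)
    rw [h1.deriv]
    simp only [hu, hG', hκ, Real.exp_neg, Pi.mul_apply, Pi.neg_apply]
    have hs := Real.sqrt_pos.mpr (h.pos θ)
    have hs2 := Real.sq_sqrt (h.pos θ).le
    have he := Real.exp_pos (logFactor D q θ)
    set r := Real.sqrt (D θ)
    rw [← hs2]
    field_simp
    ring

end IsCircleDiffusion

end Circle

end Anomaly

end
noncomputable section

namespace Anomaly

/-! ### Uniform second order expansions -/

/-- Taylor's formula of second order with a uniform remainder. -/
lemma taylor_two_remainder {f : ℝ → ℝ} (hf : ContDiff ℝ 3 f) {C x y : ℝ}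
    (hC : ∀ t ∈ Set.uIcc x (x + y), |iteratedDeriv 3 f t| ≤ C) :
    |f (x + y) - (f x + deriv f x * y + iteratedDeriv 2 f x / 2 * y ^ 2)| ≤ C * |y| ^ 3 := by
  rcases eq_or_ne y 0 with rfl | hy
  · simp
  have hne : x ≠ x + y := by simpa using hy
  have hu : UniqueDiffOn ℝ (Set.uIcc x (x + y)) := uniqueDiffOn_uIcc hne
  have hsub := Set.uIoo_subset_uIcc_self (a := x) (b := x + y)
  have heq : ∀ (k : ℕ), k ≤ 3 → ∀ t ∈ Set.uIcc x (x + y),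
      iteratedDerivWithin k f (Set.uIcc x (x + y)) t = iteratedDeriv k f t := fun k hk t ht =>
    iteratedDerivWithin_eq_iteratedDeriv hu (hf.contDiffAt.of_le (by exact_mod_cast hk)) ht
  obtain ⟨t, ht, h⟩ := taylor_mean_remainder_lagrange (n := 2) hne
    (hf.contDiffOn.of_le (by norm_num))
    ((hf.contDiffOn.differentiableOn_iteratedDerivWithin (m := 2) (by norm_num) hu).mono hsub)
  have hx : x ∈ Set.uIcc x (x + y) := Set.left_mem_uIcc
  rw [heq 3 le_rfl t (hsub ht)] at h
  have h2 : taylorWithinEval f 2 (Set.uIcc x (x + y)) x (x + y)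
      = f x + deriv f x * y + iteratedDeriv 2 f x / 2 * y ^ 2 := by
    simp only [taylorWithinEval_succ, taylor_within_zero_eval, heq _ (by norm_num : 1 ≤ 3) x hx,
      zero_add, heq _ (by norm_num : 1 + 1 ≤ 3) x hx, iteratedDeriv_one]
    norm_num [Nat.factorial]
    ring
  rw [← h2, h, add_sub_cancel_left, abs_div, abs_mul, abs_pow]
  have h3 := hC t (hsub ht)
  have hC0 : 0 ≤ C := (abs_nonneg _).trans h3
  rw [div_le_iff₀ (by norm_num [Nat.factorial])]
  have h6 : |((2 + 1).factorial : ℝ)| = 6 := by norm_num [Nat.factorial]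
  rw [h6]
  have : |iteratedDeriv 3 f t| * |y| ^ 3 ≤ C * |y| ^ 3 := by gcongr
  have h7 : 0 ≤ C * |y| ^ 3 := by positivity
  norm_num at *
  linarith

/-! ### Calculus of second order expansions with uniform remainders. -/

section Expansion

variable {Z : Type*} {F : Filter Z} {l : Z → ℝ}

/-- `f = f₀ + l f₁ + l² f₂ + O(l³)` with bounded coefficients. -/
structure HasExpansion₂ (F : Filter Z) (l f f₀ f₁ f₂ : Z → ℝ) : Prop where
  b₀ : f₀ =O[F] fun _ => (1 : ℝ)
  b₁ : f₁ =O[F] fun _ => (1 : ℝ)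
  b₂ : f₂ =O[F] fun _ => (1 : ℝ)
  rem : (fun z => f z - (f₀ z + l z * f₁ z + l z ^ 2 * f₂ z)) =O[F] fun z => l z ^ 3

lemma isBigO_pow_of_le (hl : Tendsto l F (𝓝 0)) {m n : ℕ} (h : m ≤ n) :
    (fun z => l z ^ n) =O[F] fun z => l z ^ m := by
  obtain ⟨k, rfl⟩ := Nat.exists_eq_add_of_le h
  have h1 : (fun z => l z ^ k) =O[F] fun _ => (1 : ℝ) := by
    simpa using (hl.isBigO_one ℝ).pow k
  simpa [pow_add] using (isBigO_refl (fun z => l z ^ m) F).mul h1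

lemma isBigO_pow_mul_bdd {f : Z → ℝ} (hl : Tendsto l F (𝓝 0)) (hf : f =O[F] fun _ => (1 : ℝ))
    {m n : ℕ} (h : m ≤ n) : (fun z => l z ^ n * f z) =O[F] fun z => l z ^ m := by
  simpa using (isBigO_pow_of_le hl h).mul hf

lemma IsBigO_one_mul {f g : Z → ℝ} (hf : f =O[F] fun _ => (1 : ℝ)) (hg : g =O[F] fun _ => (1 : ℝ)) :
    (fun z => f z * g z) =O[F] fun _ => (1 : ℝ) := by simpa using hf.mul hg

namespace HasExpansion₂

variable {f f₀ f₁ f₂ g g₀ g₁ g₂ : Z → ℝ}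

lemma congr (hf : HasExpansion₂ F l f f₀ f₁ f₂) {f' f₀' f₁' f₂' : Z → ℝ} (h : ∀ z, f z = f' z)
    (h₀ : ∀ z, f₀ z = f₀' z) (h₁ : ∀ z, f₁ z = f₁' z) (h₂ : ∀ z, f₂ z = f₂' z) :
    HasExpansion₂ F l f' f₀' f₁' f₂' := by
  rw [← funext h, ← funext h₀, ← funext h₁, ← funext h₂]; exact hf

lemma congr_eventually (hf : HasExpansion₂ F l f f₀ f₁ f₂) {f' : Z → ℝ} (h : ∀ᶠ z in F, f z = f' z) :
    HasExpansion₂ F l f' f₀ f₁ f₂ :=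
  ⟨hf.b₀, hf.b₁, hf.b₂, hf.rem.congr' (h.mono fun z hz => by dsimp only; rw [hz]) EventuallyEq.rfl⟩

lemma of_bdd (hf : f =O[F] fun _ => (1 : ℝ)) :
    HasExpansion₂ F l f f (fun _ => 0) (fun _ => 0) :=
  ⟨hf, isBigO_zero _ _, isBigO_zero _ _, by simpa using isBigO_zero _ _⟩

lemma add (hf : HasExpansion₂ F l f f₀ f₁ f₂) (hg : HasExpansion₂ F l g g₀ g₁ g₂) :
    HasExpansion₂ F l (fun z => f z + g z) (fun z => f₀ z + g₀ z) (fun z => f₁ z + g₁ z)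
      (fun z => f₂ z + g₂ z) :=
  ⟨hf.b₀.add hg.b₀, hf.b₁.add hg.b₁, hf.b₂.add hg.b₂,
    (hf.rem.add hg.rem).congr_left fun z => by ring⟩

variable (hl : Tendsto l F (𝓝 0))
include hl

lemma bdd_rem (hf : HasExpansion₂ F l f f₀ f₁ f₂) :
    (fun z => f z - (f₀ z + l z * f₁ z + l z ^ 2 * f₂ z)) =O[F] fun _ => (1 : ℝ) := by
  have := hf.rem.trans (isBigO_pow_of_le hl (Nat.zero_le 3))
  simpa using this

lemma bdd (hf : HasExpansion₂ F l f f₀ f₁ f₂) : f =O[F] fun _ => (1 : ℝ) := by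
  have hl1 := hl.isBigO_one ℝ
  have h := (((hf.b₀.add (IsBigO_one_mul hl1 hf.b₁)).add
    (IsBigO_one_mul (IsBigO_one_mul hl1 hl1) hf.b₂)).add (hf.bdd_rem hl))
  exact h.congr_left fun z => by ring

lemma mul (hf : HasExpansion₂ F l f f₀ f₁ f₂) (hg : HasExpansion₂ F l g g₀ g₁ g₂) :
    HasExpansion₂ F l (fun z => f z * g z) (fun z => f₀ z * g₀ z)
      (fun z => f₀ z * g₁ z + f₁ z * g₀ z) (fun z => f₀ z * g₂ z + f₁ z * g₁ z + f₂ z * g₀ z) := by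
  refine ⟨IsBigO_one_mul hf.b₀ hg.b₀, (IsBigO_one_mul hf.b₀ hg.b₁).add (IsBigO_one_mul hf.b₁ hg.b₀),
    ((IsBigO_one_mul hf.b₀ hg.b₂).add (IsBigO_one_mul hf.b₁ hg.b₁)).add (IsBigO_one_mul hf.b₂ hg.b₀),
    ?_⟩
  have e1 : (fun z => (f z - (f₀ z + l z * f₁ z + l z ^ 2 * f₂ z)) * g z) =O[F] fun z => l z ^ 3 := by
    simpa using hf.rem.mul (hg.bdd hl)
  have hl1 := hl.isBigO_one ℝ
  have hb : (fun z => f₀ z + l z * f₁ z + l z ^ 2 * f₂ z) =O[F] fun _ => (1 : ℝ) :=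
    ((hf.b₀.add (IsBigO_one_mul hl1 hf.b₁)).add
      (IsBigO_one_mul (IsBigO_one_mul hl1 hl1) hf.b₂)).congr_left fun z => by ring
  have e2 : (fun z => (f₀ z + l z * f₁ z + l z ^ 2 * f₂ z) *
      (g z - (g₀ z + l z * g₁ z + l z ^ 2 * g₂ z))) =O[F] fun z => l z ^ 3 := by
    simpa using hb.mul hg.rem
  have e3 := isBigO_pow_mul_bdd hl
    ((IsBigO_one_mul hf.b₁ hg.b₂).add (IsBigO_one_mul hf.b₂ hg.b₁)) (le_refl 3)
  have e4 := isBigO_pow_mul_bdd hl (IsBigO_one_mul hf.b₂ hg.b₂) (show 3 ≤ 4 by norm_num)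
  exact (((e1.add e2).add e3).add e4).congr_left fun z => by ring

lemma const_mul (hf : HasExpansion₂ F l f f₀ f₁ f₂) (hg : g =O[F] fun _ => (1 : ℝ)) :
    HasExpansion₂ F l (fun z => g z * f z) (fun z => g z * f₀ z)
      (fun z => g z * f₁ z) (fun z => g z * f₂ z) :=
  ((of_bdd hg).mul hl hf).congr (fun _ => rfl) (fun _ => rfl) (fun _ => by ring) (fun _ => by ring)

lemma isBigO_self (hf : HasExpansion₂ F l f (fun _ => 0) f₁ f₂) : f =O[F] l := by
  have h1 := isBigO_pow_mul_bdd hl hf.b₁ (le_refl 1)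
  have h2 := isBigO_pow_mul_bdd hl hf.b₂ (show 1 ≤ 2 by norm_num)
  have h3 := hf.rem.trans (isBigO_pow_of_le hl (show 1 ≤ 3 by norm_num))
  have h := (h1.add h2).add h3
  simp only [pow_one] at h
  exact h.congr_left fun z => by ring

/-- Substituting a small quantity into functions with a uniform Taylor expansion. -/
lemma comp (hf : HasExpansion₂ F l f (fun _ => 0) f₁ f₂) {h : Z → ℝ → ℝ} {h₀ h₁ h₂ : Z → ℝ}
    (b₀ : h₀ =O[F] fun _ => (1 : ℝ)) (b₁ : h₁ =O[F] fun _ => (1 : ℝ))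
    (b₂ : h₂ =O[F] fun _ => (1 : ℝ)) {C : ℝ}
    (hh : ∀ z y, |y| ≤ 1 / 2 → |h z y - (h₀ z + h₁ z * y + h₂ z * y ^ 2)| ≤ C * |y| ^ 3) :
    HasExpansion₂ F l (fun z => h z (f z)) h₀ (fun z => h₁ z * f₁ z)
      (fun z => h₁ z * f₂ z + h₂ z * f₁ z ^ 2) := by
  have hfl := hf.isBigO_self hl
  have hf0 : Tendsto f F (𝓝 0) := hfl.trans_tendsto hl
  have e1 : (fun z => h z (f z) - (h₀ z + h₁ z * f z + h₂ z * f z ^ 2)) =O[F] fun z => l z ^ 3 := by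
    refine IsBigO.trans (IsBigO.of_bound C ?_) (hfl.pow 3)
    filter_upwards [hf0 (Metric.closedBall_mem_nhds 0 (show (0 : ℝ) < 1 / 2 by norm_num))] with z hz
    have hz' : |f z| ≤ 1 / 2 := by simpa using hz
    simpa using hh z (f z) hz'
  have e2 := (((of_bdd (F := F) (l := l) b₀).add (hf.const_mul hl b₁)).add
    ((hf.mul hl hf).const_mul hl b₂))
  have e3 : HasExpansion₂ F l (fun z => h₀ z + h₁ z * f z + h₂ z * f z ^ 2) h₀ (fun z => h₁ z * f₁ z)
      (fun z => h₁ z * f₂ z + h₂ z * f₁ z ^ 2) :=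
    e2.congr (fun z => by ring) (fun z => by ring) (fun z => by ring) (fun z => by ring)
  exact ⟨e3.b₀, e3.b₁, e3.b₂, (e1.add e3.rem).congr_left fun z => by ring⟩

end HasExpansion₂

end Expansion

/-! ### Cubic remainders for the logarithm, the inverse and the arctangent. -/

lemma abs_log_one_add_sub_le {y : ℝ} (hy : |y| ≤ 1 / 2) :
    |Real.log (1 + y) - (0 + 1 * y + (-1 / 2) * y ^ 2)| ≤ 2 * |y| ^ 3 := by
  have h := Real.abs_log_sub_add_sum_range_le (x := -y) (by rw [abs_neg]; linarith) 2
  rw [abs_neg] at h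
  simp only [Finset.sum_range_succ, Finset.sum_range_zero, sub_neg_eq_add] at h
  have h1 : |y| ^ (2 + 1) / (1 - |y|) ≤ 2 * |y| ^ 3 := by
    rw [div_le_iff₀ (by linarith)]
    have : 0 ≤ |y| ^ 3 * (1 - 2 * |y|) := mul_nonneg (by positivity) (by linarith)
    norm_num
    linarith
  refine le_trans (le_of_eq ?_) (h.trans h1)
  congr 1
  push_cast
  ring

lemma abs_inv_one_add_sub_le {y : ℝ} (hy : |y| ≤ 1 / 2) :
    |(1 + y)⁻¹ - (1 + (-1) * y + 1 * y ^ 2)| ≤ 2 * |y| ^ 3 := by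
  have h0 := abs_le.mp hy
  have hpos : 1 / 2 ≤ 1 + y := by linarith
  have h1 : (1 + y)⁻¹ - (1 + (-1) * y + 1 * y ^ 2) = -(y ^ 3) / (1 + y) := by
    field_simp; ring
  rw [h1, abs_div, abs_neg, abs_pow, abs_of_pos (by linarith : 0 < 1 + y),
    div_le_iff₀ (by linarith)]
  have : 0 ≤ |y| ^ 3 := by positivity
  nlinarith

lemma abs_arctan_sub_le (y : ℝ) :
    |Real.arctan y - (0 + 1 * y + 0 * y ^ 2)| ≤ 1 * |y| ^ 3 := by
  have hd : ∀ x ∈ Metric.closedBall (0 : ℝ) |y|,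
      HasDerivWithinAt (fun x => Real.arctan x - x) (1 / (1 + x ^ 2) - 1) (Metric.closedBall 0 |y|) x :=
    fun x _ => ((Real.hasDerivAt_arctan x).sub (hasDerivAt_id x)).hasDerivWithinAt
  have hb : ∀ x ∈ Metric.closedBall (0 : ℝ) |y|, ‖1 / (1 + x ^ 2) - 1‖ ≤ |y| ^ 2 := by
    intro x hx
    have hx' : |x| ≤ |y| := by simpa using hx
    have h1 : 1 / (1 + x ^ 2) - 1 = -(x ^ 2 / (1 + x ^ 2)) := by field_simp; ring
    rw [h1, norm_neg, Real.norm_of_nonneg (by positivity)]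
    calc x ^ 2 / (1 + x ^ 2) ≤ x ^ 2 := div_le_self (sq_nonneg _) (by nlinarith [sq_nonneg x])
      _ = |x| ^ 2 := (sq_abs x).symm
      _ ≤ _ := by gcongr
  have h := (convex_closedBall (0 : ℝ) |y|).norm_image_sub_le_of_norm_hasDerivWithin_le hd hb
    (Metric.mem_closedBall_self (abs_nonneg y)) (by simp : y ∈ Metric.closedBall (0 : ℝ) |y|)
  simp only [Real.arctan_zero, sub_zero, Real.norm_eq_abs] at h
  calc |Real.arctan y - (0 + 1 * y + 0 * y ^ 2)| = |Real.arctan y - y| := by congr 1; ring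
    _ ≤ |y| ^ 2 * |y| := h
    _ = _ := by ring

end Anomaly

end
noncomputable section

namespace Anomaly

/-! ### Matrix elements in the rotating frame -/

/-- The diagonal matrix element `⟨e_θ|A|e_θ⟩`. -/
def rad (A : Mat2) (θ : ℝ) : ℝ :=
  A 0 0 * Real.cos θ ^ 2 + (A 0 1 + A 1 0) * (Real.sin θ * Real.cos θ) + A 1 1 * Real.sin θ ^ 2

lemma sqrt_two_sq : (Real.sqrt 2 : ℂ) ^ 2 = 2 := by
  rw [← Complex.ofReal_pow, Real.sq_sqrt (by norm_num)]; norm_num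

lemma sqrt_two_ne : (Real.sqrt 2 : ℂ) ≠ 0 := by
  rw [Complex.ofReal_ne_zero]; positivity

/-- As `⟨v|x⟩ = (x₀ + i x₁) / √2`, pairing with `v` identifies the plane with ℂ and the quotient is
multiplication by `exp (-iθ)`. Hence `phase A θ` is the component of `A e_θ` orthogonal to `e_θ`. -/
lemma phase_eq (A : Mat2) (θ : ℝ) : phase A θ = A 1 0 * Real.cos θ ^ 2
    + (A 1 1 - A 0 0) * (Real.sin θ * Real.cos θ) - A 0 1 * Real.sin θ ^ 2 := by
  have h2 := sqrt_two_ne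
  have hcs := Real.sin_sq_add_cos_sq θ
  have hden : star v ⬝ᵥ eC θ = ((Real.cos θ : ℂ) + Real.sin θ * Complex.I) / Real.sqrt 2 := by
    simp [v, eC, e, dotProduct, Fin.sum_univ_two]
    field_simp
  have hnum : braket v A (eC θ) = (((A 0 0 * Real.cos θ + A 0 1 * Real.sin θ : ℝ) : ℂ)
      + (A 1 0 * Real.cos θ + A 1 1 * Real.sin θ : ℝ) * Complex.I) / Real.sqrt 2 := by
    simp [braket, v, eC, e, dotProduct, Matrix.mulVec, Fin.sum_univ_two]
    field_simp
  have hunit : ((Real.cos θ : ℂ) + Real.sin θ * Complex.I)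
      * ((Real.cos θ : ℂ) - Real.sin θ * Complex.I) = 1 := by
    have : ((Real.sin θ : ℂ)) ^ 2 + (Real.cos θ : ℂ) ^ 2 = 1 := by exact_mod_cast hcs
    linear_combination this - (Real.sin θ : ℂ) ^ 2 * Complex.I_sq
  have hne : ((Real.cos θ : ℂ) + Real.sin θ * Complex.I) ≠ 0 := left_ne_zero_of_mul_eq_one hunit
  have hquot : braket v A (eC θ) / (star v ⬝ᵥ eC θ)
      = (((A 0 0 * Real.cos θ + A 0 1 * Real.sin θ : ℝ) : ℂ)
        + (A 1 0 * Real.cos θ + A 1 1 * Real.sin θ : ℝ) * Complex.I)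
        * ((Real.cos θ : ℂ) - Real.sin θ * Complex.I) := by
    rw [hnum, hden, div_div_div_cancel_right₀ h2, div_eq_iff hne, mul_assoc, mul_comm (_ - _), hunit,
      mul_one]
  rw [phase, hquot]
  simp only [Complex.mul_im, Complex.add_im, Complex.add_re, Complex.sub_re, Complex.sub_im,
    Complex.ofReal_re, Complex.ofReal_im, Complex.mul_re, Complex.I_re, Complex.I_im]
  ring

lemma offDiag_eq (A : Mat2) :
    offDiag A = ((A 0 0 - A 1 1 : ℝ) - (A 0 1 + A 1 0 : ℝ) * Complex.I) / 2 := by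
  have h2 := sqrt_two_ne
  simp only [offDiag, braket, v, dotProduct, Matrix.mulVec, Fin.sum_univ_two, star_star]
  simp only [Matrix.cons_val_zero, Matrix.cons_val_one, Matrix.map_apply, Matrix.cons_val_fin_one]
  have h3 := sqrt_two_sq
  push_cast
  field_simp
  rw [h3]
  linear_combination 2 * (A 1 1 : ℂ) * Complex.I_sq

lemma nsq_mulVec_e (A : Mat2) (θ : ℝ) : nsq (A *ᵥ e θ) = rad A θ ^ 2 + phase A θ ^ 2 := by
  have h := Real.sin_sq_add_cos_sq θ
  simp only [nsq, rad, phase_eq, mulVec_zero_apply, mulVec_one_apply, e, Matrix.cons_val_zero,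
    Matrix.cons_val_one, Matrix.cons_val_fin_one]
  generalize Real.sin θ = x at *
  generalize Real.cos θ = y at *
  have : (A 0 0 * y + A 0 1 * x) ^ 2 + (A 1 0 * y + A 1 1 * x) ^ 2
      = ((A 0 0 * y + A 0 1 * x) ^ 2 + (A 1 0 * y + A 1 1 * x) ^ 2) * (x ^ 2 + y ^ 2) := by
    rw [h, mul_one]
  rw [this]; ring

/-- In the orthonormal frame of `e_θ` and its rotation by a right angle, `A e_θ` has the coordinates
`rad A θ` and `phase A θ`. -/
lemma mulVec_e (A : Mat2) (θ : ℝ) : A *ᵥ e θ = ![rad A θ * Real.cos θ - phase A θ * Real.sin θ,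
    rad A θ * Real.sin θ + phase A θ * Real.cos θ] := by
  have h := Real.sin_sq_add_cos_sq θ
  ext i
  fin_cases i
  · simp only [Fin.zero_eta, mulVec_zero_apply, rad, phase_eq, e, Matrix.cons_val_zero,
      Matrix.cons_val_one, Matrix.cons_val_fin_one]
    linear_combination -(A 0 0 * Real.cos θ + A 0 1 * Real.sin θ) * h
  · simp only [Fin.mk_one, mulVec_one_apply, rad, phase_eq, e, Matrix.cons_val_zero,
      Matrix.cons_val_one, Matrix.cons_val_fin_one]
    linear_combination -(A 1 0 * Real.cos θ + A 1 1 * Real.sin θ) * h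

lemma wedge_mulVec_e (A : Mat2) (θ : ℝ) : wedge (e θ) (A *ᵥ e θ) = phase A θ := by
  have h := Real.sin_sq_add_cos_sq θ
  rw [mulVec_e]
  simp only [wedge, e, Matrix.cons_val_zero, Matrix.cons_val_one, Matrix.cons_val_fin_one]
  linear_combination phase A θ * h

lemma nsq_e (θ : ℝ) : nsq (e θ) = 1 := by
  simp [nsq, e]

lemma ell_e (θ : ℝ) : ell (e θ) = 0 := by simp [ell, nsq_e]

lemma e_ne_zero (θ : ℝ) : e θ ≠ 0 := ne_zero_of_nsq_pos (by rw [nsq_e]; exact one_pos)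

/-- The second order part of `2 log ‖T e_θ‖`. -/
lemma re_lyap_pointwise {P : Mat2} (hP : P 1 1 = -P 0 0) {Q : Mat2} (hQ : Q 1 1 = -Q 0 0) (θ : ℝ) :
    (((‖offDiag P‖ ^ 2 : ℝ) : ℂ) + offDiag (Pᵀ * P + (2 : ℝ) • Q) * Complex.exp (2 * Complex.I * θ)
      - offDiag P ^ 2 * Complex.exp (4 * Complex.I * θ)).re
      = 2 * rad (Q + (1 / 2 : ℝ) • (P * P)) θ + phase P θ ^ 2 - rad P θ ^ 2 := by
  have h := Real.sin_sq_add_cos_sq θ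
  have e1 : Complex.exp (2 * Complex.I * θ) = (Real.cos θ + Real.sin θ * Complex.I) ^ 2 := by
    rw [show 2 * Complex.I * θ = ((2 : ℕ) : ℂ) * (θ * Complex.I) by push_cast; ring,
      Complex.exp_nat_mul, Complex.exp_mul_I]
    simp
  have e2 : Complex.exp (4 * Complex.I * θ) = (Real.cos θ + Real.sin θ * Complex.I) ^ 4 := by
    rw [show 4 * Complex.I * θ = ((4 : ℕ) : ℂ) * (θ * Complex.I) by push_cast; ring,
      Complex.exp_nat_mul, Complex.exp_mul_I]
    simp
  have e3 : ‖offDiag P‖ ^ 2 = P 0 0 ^ 2 + ((P 0 1 + P 1 0) / 2) ^ 2 := by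
    rw [Complex.sq_norm, offDiag_eq, hP, Complex.normSq_apply]
    simp
    ring
  rw [e1, e2, e3, offDiag_eq, offDiag_eq, phase_eq, rad, rad]
  simp only [Matrix.add_apply, Matrix.smul_apply, Matrix.mul_apply, Fin.sum_univ_two,
    Matrix.transpose_apply, smul_eq_mul, hP, hQ]
  generalize Real.sin θ = x at *
  generalize Real.cos θ = y at *
  generalize P 0 0 = a
  generalize P 0 1 = b
  generalize P 1 0 = c
  generalize Q 0 0 = a'
  generalize Q 0 1 = b'
  generalize Q 1 0 = c'
  simp only [pow_succ, pow_zero, one_mul, Complex.add_re, Complex.sub_re, Complex.mul_re, Complex.mul_im,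
    Complex.add_im, Complex.sub_im, Complex.ofReal_re, Complex.ofReal_im, Complex.I_re, Complex.I_im,
    Complex.div_ofNat_re, Complex.div_ofNat_im]
  have hx : x ^ 2 = 1 - y ^ 2 := by linarith
  have hx3 : x ^ 3 = x * (1 - y ^ 2) := by rw [← hx]; ring
  have hx4 : x ^ 4 = (1 - y ^ 2) ^ 2 := by rw [← hx]; ring
  ring_nf
  rw [hx, hx3, hx4]
  ring

/-! ### Averages over the random parameter -/

section Averages

variable {S : Type*} [MeasurableSpace S]

/-- Bounded measurable functions. -/
def IsBM {E : Type*} [NormedRing E] [MeasurableSpace E] (f : S → E) : Prop :=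
  Measurable f ∧ ∃ C, ∀ s, ‖f s‖ ≤ C

lemma IsBM.integrable {f : S → ℝ} (hf : IsBM f) (μ : Measure S) [IsProbabilityMeasure μ] :
    Integrable f μ :=
  Integrable.of_bound hf.1.aestronglyMeasurable hf.2.choose (ae_of_all _ hf.2.choose_spec)

lemma IsBM.integrable_complex {f : S → ℂ} (hf : IsBM f) (μ : Measure S) [IsProbabilityMeasure μ] :
    Integrable f μ :=
  Integrable.of_bound hf.1.aestronglyMeasurable hf.2.choose (ae_of_all _ hf.2.choose_spec)

section
variable {E : Type*} [NormedRing E] [MeasurableSpace E] [BorelSpace E] [SecondCountableTopology E]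

lemma IsBM.add {f g : S → E} (hf : IsBM f) (hg : IsBM g) : IsBM fun s => f s + g s := by
  obtain ⟨C, hC⟩ := hf.2
  obtain ⟨D, hD⟩ := hg.2
  exact ⟨hf.1.add hg.1, C + D, fun s => (norm_add_le _ _).trans (add_le_add (hC s) (hD s))⟩

lemma IsBM.sub {f g : S → E} (hf : IsBM f) (hg : IsBM g) : IsBM fun s => f s - g s := by
  obtain ⟨C, hC⟩ := hf.2
  obtain ⟨D, hD⟩ := hg.2
  exact ⟨hf.1.sub hg.1, C + D, fun s => (norm_sub_le _ _).trans (add_le_add (hC s) (hD s))⟩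

lemma IsBM.mul {f g : S → E} (hf : IsBM f) (hg : IsBM g) : IsBM fun s => f s * g s := by
  obtain ⟨C, hC⟩ := hf.2
  obtain ⟨D, hD⟩ := hg.2
  exact ⟨hf.1.mul hg.1, C * D, fun s => (norm_mul_le _ _).trans
    (mul_le_mul (hC s) (hD s) (norm_nonneg _) ((norm_nonneg _).trans (hC s)))⟩

omit [BorelSpace E] [SecondCountableTopology E] in
lemma isBM_const (c : E) : IsBM fun _ : S => c := ⟨measurable_const, ‖c‖, fun _ => le_rfl⟩

lemma IsBM.sq {f : S → E} (hf : IsBM f) : IsBM fun s => f s ^ 2 := by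
  simpa [pow_two] using hf.mul hf

end

lemma IsBM.ofReal {f : S → ℝ} (hf : IsBM f) : IsBM fun s => (f s : ℂ) :=
  ⟨Complex.measurable_ofReal.comp hf.1, hf.2.imp fun C hC s => by simpa using hC s⟩

/-- Bounded measurable families of traceless matrices. -/
structure IsBddTraceless (P : S → Mat2) : Prop where
  bm : ∀ i j, IsBM fun s => P s i j
  trace : ∀ s, P s 1 1 = -P s 0 0

lemma IsBddTraceless.phase {P : S → Mat2} (hP : IsBddTraceless P) (θ : ℝ) :
    IsBM fun s => phase (P s) θ := by
  simp only [phase_eq]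
  exact (((hP.bm 1 0).mul (isBM_const _)).add (((hP.bm 1 1).sub (hP.bm 0 0)).mul (isBM_const _))).sub
    ((hP.bm 0 1).mul (isBM_const _))

lemma isBM_rad {P : S → Mat2} (hP : ∀ i j, IsBM fun s => P s i j) (θ : ℝ) :
    IsBM fun s => rad (P s) θ := by
  unfold rad
  exact (((hP 0 0).mul (isBM_const _)).add (((hP 0 1).add (hP 1 0)).mul (isBM_const _))).add
    ((hP 1 1).mul (isBM_const _))

lemma isBM_mul_entry {P Q : S → Mat2} (hP : ∀ i j, IsBM fun s => P s i j)
    (hQ : ∀ i j, IsBM fun s => Q s i j) (i j : Fin 2) : IsBM fun s => (P s * Q s) i j := by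
  simp only [Matrix.mul_apply, Fin.sum_univ_two]
  exact ((hP i 0).mul (hQ 0 j)).add ((hP i 1).mul (hQ 1 j))

lemma isBM_offDiag {P : S → Mat2} (hP : ∀ i j, IsBM fun s => P s i j) :
    IsBM fun s => offDiag (P s) := by
  simp only [offDiag_eq, div_eq_mul_inv]
  exact ((((hP 0 0).sub (hP 1 1)).ofReal).sub
    ((((hP 0 1).add (hP 1 0)).ofReal).mul (isBM_const _))).mul (isBM_const _)

lemma integral_sum_mul {n : ℕ} (μ : Measure S) [IsProbabilityMeasure μ] {m : Fin n → S → ℝ}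
    (hm : ∀ k, IsBM (m k)) (t : Fin n → ℝ) :
    ∫ s, ∑ k, m k s * t k ∂μ = ∑ k, (∫ s, m k s ∂μ) * t k := by
  rw [integral_finsetSum _ fun k _ => ((hm k).integrable μ).mul_const _]
  simp only [integral_mul_const]

/-- A finite sum of products of bounded coefficients and analytic functions has an analytic
average, which may be differentiated under the integral. -/
lemma analytic_average {n : ℕ} (μ : Measure S) [IsProbabilityMeasure μ] {m : Fin n → S → ℝ}
    (hm : ∀ k, IsBM (m k)) {t : Fin n → ℝ → ℝ} (ht : ∀ k, IsAnalytic (t k)) {f : S → ℝ → ℝ}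
    (hf : ∀ s θ, f s θ = ∑ k, m k s * t k θ) :
    IsAnalytic (fun θ => ∫ s, f s θ ∂μ) ∧
      ∀ θ, deriv (fun θ => ∫ s, f s θ ∂μ) θ = ∫ s, deriv (f s) θ ∂μ := by
  have h1 : (fun θ => ∫ s, f s θ ∂μ) = fun θ => ∑ k, (∫ s, m k s ∂μ) * t k θ := by
    ext θ; simp only [hf]; exact integral_sum_mul μ hm fun k => t k θ
  have h2 : ∀ (c : Fin n → ℝ) θ, HasDerivAt (fun θ => ∑ k, c k * t k θ)
      (∑ k, c k * deriv (t k) θ) θ := fun c θ =>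
    HasDerivAt.fun_sum fun k _ => ((ht k θ).differentiableAt.hasDerivAt).const_mul (c k)
  constructor
  · rw [h1]
    intro θ
    exact Finset.analyticAt_fun_sum _ fun k _ => analyticAt_const.mul (ht k θ)
  · intro θ
    have h3 : ∀ s, deriv (f s) θ = ∑ k, m k s * deriv (t k) θ := fun s => by
      rw [show f s = fun θ => ∑ k, m k s * t k θ from funext (hf s)]
      exact (h2 (fun k => m k s) θ).deriv
    rw [h1, (h2 _ θ).deriv]
    simp only [h3]
    exact (integral_sum_mul μ hm fun k => deriv (t k) θ).symm

lemma isAnalytic_sin : IsAnalytic Real.sin := fun _ => Real.analyticAt_sin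
lemma isAnalytic_cos : IsAnalytic Real.cos := fun _ => Real.analyticAt_cos

lemma phase_add_two_pi (A : Mat2) (θ : ℝ) : phase A (θ + 2 * Real.pi) = phase A θ := by
  simp [phase_eq]

lemma rad_add_two_pi (A : Mat2) (θ : ℝ) : rad A (θ + 2 * Real.pi) = rad A θ := by
  simp [rad]

lemma isAnalytic_phase (A : Mat2) : IsAnalytic (phase A) := by
  intro x
  have h : phase A = fun θ => A 1 0 * Real.cos θ ^ 2
    + (A 1 1 - A 0 0) * (Real.sin θ * Real.cos θ) - A 0 1 * Real.sin θ ^ 2 := funext (phase_eq A)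
  rw [h]
  have hs := isAnalytic_sin x
  have hc := isAnalytic_cos x
  exact ((analyticAt_const.mul (hc.pow 2)).add (analyticAt_const.mul (hs.mul hc))).sub
    (analyticAt_const.mul (hs.pow 2))

variable {μ : Measure S} [IsProbabilityMeasure μ] {P Q : S → Mat2}

/-- For traceless `P` the square of the phase is a sum of six products of entries with fixed
trigonometric polynomials, so `analytic_average` applies. -/
lemma analytic_diffusion (hP : IsBddTraceless P) :
    IsAnalytic (diffusion μ P) ∧
      ∀ θ, ∫ s, phase (P s) θ * deriv (phase (P s)) θ ∂μ = deriv (diffusion μ P) θ / 2 := by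
  have h := analytic_average μ (f := fun s θ => phase (P s) θ ^ 2)
    (m := ![fun s => P s 1 0 ^ 2, fun s => P s 0 0 ^ 2, fun s => P s 0 1 ^ 2,
      fun s => P s 1 0 * P s 0 0, fun s => P s 1 0 * P s 0 1, fun s => P s 0 0 * P s 0 1])
    (t := ![fun θ => Real.cos θ ^ 4, fun θ => 4 * (Real.sin θ ^ 2 * Real.cos θ ^ 2),
      fun θ => Real.sin θ ^ 4, fun θ => -4 * (Real.sin θ * Real.cos θ ^ 3),
      fun θ => -2 * (Real.sin θ ^ 2 * Real.cos θ ^ 2), fun θ => 4 * (Real.sin θ ^ 3 * Real.cos θ)])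
    (by
      intro k; fin_cases k
      · exact (hP.bm 1 0).sq
      · exact (hP.bm 0 0).sq
      · exact (hP.bm 0 1).sq
      · exact (hP.bm 1 0).mul (hP.bm 0 0)
      · exact (hP.bm 1 0).mul (hP.bm 0 1)
      · exact (hP.bm 0 0).mul (hP.bm 0 1))
    (by
      intro k x
      have hs := isAnalytic_sin x
      have hc := isAnalytic_cos x
      fin_cases k
      · exact hc.pow 4
      · exact analyticAt_const.mul ((hs.pow 2).mul (hc.pow 2))
      · exact hs.pow 4
      · exact analyticAt_const.mul (hs.mul (hc.pow 3))
      · exact analyticAt_const.mul ((hs.pow 2).mul (hc.pow 2))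
      · exact analyticAt_const.mul ((hs.pow 3).mul hc))
    (by
      intro s θ
      simp only [Fin.sum_univ_six, phase_eq, hP.trace]
      simp
      ring)
  refine ⟨h.1, fun θ => ?_⟩
  have h2 := h.2 θ
  have h3 : ∀ s, deriv (fun θ => phase (P s) θ ^ 2) θ = 2 * (phase (P s) θ * deriv (phase (P s)) θ) := by
    intro s
    have h4 : HasDerivAt (fun θ => phase (P s) θ ^ 2) _ θ :=
      (isAnalytic_phase (P s) θ).differentiableAt.hasDerivAt.pow 2
    rw [h4.deriv]
    push_cast; ring
  simp only [h3, integral_const_mul] at h2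
  have h4 : deriv (diffusion μ P) θ = 2 * ∫ s, phase (P s) θ * deriv (phase (P s)) θ ∂μ := h2
  rw [h4]; ring

lemma analytic_meanQ (hQ : IsBddTraceless Q) : IsAnalytic (meanQ μ Q) :=
  (analytic_average μ (f := fun s θ => phase (Q s) θ)
    (m := ![fun s => Q s 1 0, fun s => Q s 0 0, fun s => Q s 0 1])
    (t := ![fun θ => Real.cos θ ^ 2, fun θ => -2 * (Real.sin θ * Real.cos θ),
      fun θ => -1 * Real.sin θ ^ 2])
    (by
      intro k; fin_cases k
      · exact hQ.bm 1 0
      · exact hQ.bm 0 0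
      · exact hQ.bm 0 1)
    (by
      intro k x
      have hs := isAnalytic_sin x
      have hc := isAnalytic_cos x
      fin_cases k
      · exact hc.pow 2
      · exact analyticAt_const.mul (hs.mul hc)
      · exact analyticAt_const.mul (hs.pow 2))
    (by
      intro s θ
      simp only [Fin.sum_univ_three, phase_eq, hQ.trace]
      simp
      ring)).1

lemma isCircleDiffusion (hP : IsBddTraceless P) (hQ : IsBddTraceless Q)
    (hp : ∀ θ, 0 < ∫ s, phase (P s) θ ^ 2 ∂μ) :
    IsCircleDiffusion (diffusion μ P) (meanQ μ Q) where
  anD := (analytic_diffusion hP).1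
  anq := analytic_meanQ hQ
  perD θ := by simp only [diffusion, phase_add_two_pi]
  perq θ := by simp only [meanQ, phase_add_two_pi]
  pos := hp

/-- This expresses E(p · rad), which appears in the second order drift of the angle, through E(p p')
= D' / 2. -/
lemma deriv_phase {A : Mat2} (hA : A 1 1 = -A 0 0) (θ : ℝ) : deriv (phase A) θ = -2 * rad A θ := by
  have h : phase A = fun θ => A 1 0 * Real.cos θ ^ 2
    + (A 1 1 - A 0 0) * (Real.sin θ * Real.cos θ) - A 0 1 * Real.sin θ ^ 2 := funext (phase_eq A)
  have hs := Real.hasDerivAt_sin θ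
  have hc := Real.hasDerivAt_cos θ
  have hd := (((hc.pow 2).const_mul (A 1 0)).add ((hs.mul hc).const_mul (A 1 1 - A 0 0))).sub
    ((hs.pow 2).const_mul (A 0 1))
  have hd' : HasDerivAt (phase A) (-2 * rad A θ) θ := by
    rw [h]
    refine hd.congr_deriv ?_
    rw [rad, hA]
    push_cast
    ring
  exact hd'.deriv

/-- The average of the second order part of `log ‖T e_θ‖`. -/
lemma re_lyapIntegrand (hP : IsBddTraceless P) (hQ : IsBddTraceless Q) (θ : ℝ) :
    (lyapIntegrand μ P Q θ).re
      = ∫ s, (2 * rad (Q s + (1 / 2 : ℝ) • (P s * P s)) θ + phase (P s) θ ^ 2 - rad (P s) θ ^ 2) ∂μ := by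
  have hβ := isBM_offDiag hP.bm
  have hn : IsBM fun s => ‖offDiag (P s)‖ ^ 2 := by
    obtain ⟨C, hC⟩ := hβ.2
    have : IsBM fun s => ‖offDiag (P s)‖ := ⟨hβ.1.norm, C, fun s => by simpa using hC s⟩
    exact this.sq
  have hm : IsBM fun s => offDiag ((P s)ᵀ * P s + (2 : ℝ) • Q s) := by
    refine isBM_offDiag fun i j => ?_
    simp only [Matrix.add_apply, Matrix.smul_apply, smul_eq_mul]
    exact (isBM_mul_entry (P := fun s => (P s)ᵀ) (fun i j => hP.bm j i) hP.bm i j).add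
      ((isBM_const _).mul (hQ.bm i j))
  have h1 : lyapIntegrand μ P Q θ = ∫ s, (((‖offDiag (P s)‖ ^ 2 : ℝ) : ℂ)
      + offDiag ((P s)ᵀ * P s + (2 : ℝ) • Q s) * Complex.exp (2 * Complex.I * θ)
      - offDiag (P s) ^ 2 * Complex.exp (4 * Complex.I * θ)) ∂μ := by
    rw [integral_sub, integral_add, integral_mul_const, integral_mul_const, integral_complex_ofReal]
    · rfl
    · exact hn.ofReal.integrable_complex μ
    · exact (hm.integrable_complex μ).mul_const _
    · exact (hn.ofReal.add (hm.mul (isBM_const _))).integrable_complex μ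
    · exact (hβ.sq.mul (isBM_const _)).integrable_complex μ
  have hi : Integrable (fun s => ((‖offDiag (P s)‖ ^ 2 : ℝ) : ℂ)
      + offDiag ((P s)ᵀ * P s + (2 : ℝ) • Q s) * Complex.exp (2 * Complex.I * θ)
      - offDiag (P s) ^ 2 * Complex.exp (4 * Complex.I * θ)) μ :=
    ((hn.ofReal.add (hm.mul (isBM_const _))).sub (hβ.sq.mul (isBM_const _))).integrable_complex μ
  have h2 := Complex.reCLM.integral_comp_comm hi
  rw [h1]
  simp only [Complex.reCLM_apply] at h2
  rw [← h2]
  congr 1; ext s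
  exact re_lyap_pointwise (hP.trace s) (hQ.trace s) θ

omit [IsProbabilityMeasure μ] in
lemma isAnalytic_re_lyapIntegrand : IsAnalytic fun θ => (lyapIntegrand μ P Q θ).re := by
  intro x
  have h : (fun θ => (lyapIntegrand μ P Q θ).re) = fun θ : ℝ =>
      (∫ s, ‖offDiag (P s)‖ ^ 2 ∂μ)
      + ((∫ s, offDiag ((P s)ᵀ * P s + (2 : ℝ) • Q s) ∂μ).re * Real.cos (2 * θ)
        - (∫ s, offDiag ((P s)ᵀ * P s + (2 : ℝ) • Q s) ∂μ).im * Real.sin (2 * θ))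
      - ((∫ s, offDiag (P s) ^ 2 ∂μ).re * Real.cos (4 * θ)
        - (∫ s, offDiag (P s) ^ 2 ∂μ).im * Real.sin (4 * θ)) := by
    ext θ
    have e : ∀ k : ℝ, Complex.exp (k * Complex.I * θ)
        = (Real.cos (k * θ) : ℂ) + Real.sin (k * θ) * Complex.I := by
      intro k
      rw [show (k : ℂ) * Complex.I * θ = ((k * θ : ℝ) : ℂ) * Complex.I by push_cast; ring,
        Complex.exp_mul_I, Complex.ofReal_cos, Complex.ofReal_sin]
    have e2 := e 2
    have e4 := e 4
    push_cast at e2 e4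
    simp only [lyapIntegrand, e2, e4]
    rw [← Complex.ofReal_ofNat, ← Complex.ofReal_ofNat, ← Complex.ofReal_mul, ← Complex.ofReal_mul,
      ← Complex.ofReal_cos, ← Complex.ofReal_cos, ← Complex.ofReal_sin, ← Complex.ofReal_sin]
    simp only [Complex.sub_re, Complex.add_re, Complex.mul_re, Complex.ofReal_re, Complex.ofReal_im,
      Complex.I_re, Complex.I_im, Complex.add_im, Complex.mul_im]
    ring
  rw [h]
  have hlin : ∀ k : ℝ, AnalyticAt ℝ (fun θ : ℝ => k * θ) x := fun k =>
    analyticAt_const.mul analyticAt_id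
  have hc : ∀ k : ℝ, AnalyticAt ℝ (fun θ : ℝ => Real.cos (k * θ)) x := fun k =>
    AnalyticAt.fun_comp (isAnalytic_cos _) (hlin k)
  have hs : ∀ k : ℝ, AnalyticAt ℝ (fun θ : ℝ => Real.sin (k * θ)) x := fun k =>
    AnalyticAt.fun_comp (isAnalytic_sin _) (hlin k)
  exact (analyticAt_const.add ((analyticAt_const.mul (hc 2)).sub (analyticAt_const.mul (hs 2)))).sub
    ((analyticAt_const.mul (hc 4)).sub (analyticAt_const.mul (hs 4)))

end Averages

end Anomaly

end
noncomputable section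

namespace Anomaly

/-! ### Functions of the angle -/

/-- The function on the plane which is constant along rays and given by `φ` on the circle. -/
def angular (φ : ℝ → ℝ) (x : Vec) : ℝ := φ (Complex.arg (x 0 + x 1 * Complex.I))

lemma measurable_angular {φ : ℝ → ℝ} (hφ : Measurable φ) : Measurable (angular φ) := by
  refine hφ.comp (Complex.measurable_arg.comp ?_)
  exact (Complex.measurable_ofReal.comp (measurable_pi_apply 0)).add
    ((Complex.measurable_ofReal.comp (measurable_pi_apply 1)).mul_const _)

/-- The argument recovers `α` only modulo `2 * π`, which is enough for periodic `φ`. -/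
lemma angular_polar {φ : ℝ → ℝ} (hφ : ∀ θ, φ (θ + 2 * Real.pi) = φ θ) {r : ℝ} (hr : 0 < r) (α : ℝ) :
    angular φ ![r * Real.cos α, r * Real.sin α] = φ α := by
  have h := Complex.arg_mul_cos_add_sin_mul_I_coe_angle hr (α : Real.Angle)
  rw [Real.Angle.cos_coe, Real.Angle.sin_coe] at h
  obtain ⟨k, hk⟩ := Real.Angle.angle_eq_iff_two_pi_dvd_sub.mp h
  have hp : Function.Periodic φ (2 * Real.pi) := hφ
  unfold angular
  have h1 : ((![r * Real.cos α, r * Real.sin α] : Vec) 0 : ℂ)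
      + ((![r * Real.cos α, r * Real.sin α] : Vec) 1 : ℂ) * Complex.I
      = (r : ℂ) * ((Real.cos α : ℂ) + (Real.sin α : ℂ) * Complex.I) := by
    simp; ring
  rw [h1]
  set a := Complex.arg ((r : ℂ) * ((Real.cos α : ℂ) + (Real.sin α : ℂ) * Complex.I))
  have h2 : a = α + k * (2 * Real.pi) := by linarith
  rw [h2]
  exact hp.int_mul k α

lemma smul_e (r θ : ℝ) : r • e θ = ![r * Real.cos θ, r * Real.sin θ] := by
  ext i; fin_cases i <;> simp [e]

lemma angular_e {φ : ℝ → ℝ} (hφ : ∀ θ, φ (θ + 2 * Real.pi) = φ θ) (θ : ℝ) :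
    angular φ (e θ) = φ θ := by
  have := angular_polar hφ one_pos θ
  rwa [← smul_e, one_smul] at this

lemma exists_polar {x : Vec} (hx : x ≠ 0) : ∃ r : ℝ, 0 < r ∧ ∃ θ, x = r • e θ := by
  set z : ℂ := x 0 + x 1 * Complex.I with hz
  have hre : z.re = x 0 := by simp [hz]
  have him : z.im = x 1 := by simp [hz]
  refine ⟨‖z‖, norm_pos_iff.mpr fun h => hx ?_, Complex.arg z, ?_⟩
  · rw [h] at hre him
    ext i; fin_cases i
    · simpa using hre.symm
    · simpa using him.symm
  · rw [smul_e, Complex.norm_mul_cos_arg, Complex.norm_mul_sin_arg, hre, him]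
    ext i; fin_cases i <;> rfl

lemma nsq_smul (r : ℝ) (x : Vec) : nsq (r • x) = r ^ 2 * nsq x := by
  simp only [nsq, Pi.smul_apply, smul_eq_mul]; ring

lemma ell_smul {r : ℝ} (hr : 0 < r) {x : Vec} (hx : x ≠ 0) : ell (r • x) = Real.log r + ell x := by
  rw [ell, nsq_smul, Real.log_mul (by positivity) (nsq_pos hx).ne', Real.log_pow, ell]
  push_cast; ring

lemma angular_smul (φ : ℝ → ℝ) {r : ℝ} (hr : 0 < r) (x : Vec) : angular φ (r • x) = angular φ x := by
  unfold angular
  have : (((r • x) 0 : ℝ) : ℂ) + (((r • x) 1 : ℝ) : ℂ) * Complex.I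
      = (r : ℂ) * (x 0 + x 1 * Complex.I) := by
    simp; ring
  rw [this, Complex.arg_real_mul _ hr]

/-- When `rad A θ` is positive, `A e_θ` lies within a right angle of `e_θ`, and the arctangent of
the ratio of its frame coordinates is the angle turned. -/
lemma angular_mulVec_e {φ : ℝ → ℝ} (hφ : ∀ θ, φ (θ + 2 * Real.pi) = φ θ) {A : Mat2} {θ : ℝ}
    (hX : 0 < rad A θ) :
    angular φ (A *ᵥ e θ) = φ (θ + Real.arctan (phase A θ * (rad A θ)⁻¹)) := by
  set δ := Real.arctan (phase A θ * (rad A θ)⁻¹) with hδ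
  have hc : 0 < Real.cos δ := Real.cos_arctan_pos _
  have ht : Real.sin δ / Real.cos δ = phase A θ * (rad A θ)⁻¹ := by
    rw [← Real.tan_eq_sin_div_cos, hδ, Real.tan_arctan]
  have hs : rad A θ * Real.sin δ = phase A θ * Real.cos δ := by
    field_simp at ht
    linarith
  have hs' : rad A θ / Real.cos δ * Real.sin δ = phase A θ := by
    rw [div_mul_eq_mul_div, hs, mul_div_cancel_right₀ _ hc.ne']
  rw [← angular_polar hφ (div_pos hX hc) (θ + δ), mulVec_e, Real.cos_add, Real.sin_add]
  have hc' : rad A θ / Real.cos δ * Real.cos δ = rad A θ := div_mul_cancel₀ _ hc.ne'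
  congr 1
  ext i; fin_cases i
  · simp only [Fin.zero_eta, Matrix.cons_val_zero]
    linear_combination -Real.cos θ * hc' + Real.sin θ * hs'
  · simp only [Fin.mk_one, Matrix.cons_val_one, Matrix.cons_val_fin_one]
    linear_combination -Real.sin θ * hc' - Real.cos θ * hs'

lemma bounded_of_periodic {f : ℝ → ℝ} (hf : Continuous f) (hp : ∀ θ, f (θ + 2 * Real.pi) = f θ) :
    ∃ C, ∀ x, |f x| ≤ C := by
  have hper : Function.Periodic f (2 * Real.pi) := hp
  obtain ⟨C, hC⟩ := (hper.isBounded_of_continuous (by positivity) hf).exists_norm_le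
  exact ⟨C, fun x => hC _ ⟨x, rfl⟩⟩

lemma pos_min_of_periodic {f : ℝ → ℝ} (hf : Continuous f) (hp : ∀ θ, f (θ + 2 * Real.pi) = f θ)
    (hpos : ∀ θ, 0 < f θ) : ∃ c > 0, ∀ x, c ≤ f x := by
  obtain ⟨C, hC⟩ := bounded_of_periodic (hf.inv₀ fun x => (hpos x).ne')
    (f := fun x => (f x)⁻¹) (fun θ => by rw [hp])
  have hC0 : 0 < C := lt_of_lt_of_le (by have := hpos 0; positivity) (hC 0)
  refine ⟨C⁻¹, by positivity, fun x => ?_⟩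
  have := (le_abs_self _).trans (hC x)
  exact inv_le_of_inv_le₀ (hpos x) this

lemma deriv_periodic {f : ℝ → ℝ} (hp : ∀ θ, f (θ + 2 * Real.pi) = f θ) (θ : ℝ) :
    deriv f (θ + 2 * Real.pi) = deriv f θ := by
  rw [← deriv_comp_add_const f (2 * Real.pi) θ]
  congr 1; ext x; exact hp x

/-! ### Uniform families -/

variable {S : Type*}

lemma isBigO_one_of_bdd {Z : Type*} {F : Filter Z} {f : Z → ℝ} {C : ℝ} (h : ∀ z, |f z| ≤ C) :
    f =O[F] fun _ => (1 : ℝ) :=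
  IsBigO.of_bound C (Eventually.of_forall fun z => by simpa using h z)

/-- A uniform remainder estimate read off from the product filter. -/
lemma exists_uniform_bound {Y : Type*} {f : ℝ × Y → ℝ} {n : ℕ}
    (hf : f =O[𝓝 (0 : ℝ) ×ˢ ⊤] fun z => z.1 ^ n) :
    ∃ C, 0 ≤ C ∧ ∀ᶠ l in 𝓝 (0 : ℝ), ∀ y, |f (l, y)| ≤ C * |l| ^ n := by
  obtain ⟨C, hC0, hC⟩ := hf.exists_nonneg
  refine ⟨C, hC0, ?_⟩
  have := mem_prod_top.mp hC.bound
  filter_upwards [this] with l hl y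
  simpa using hl y

lemma tendsto_fst_prod_top {Y : Type*} :
    Tendsto (fun z : ℝ × Y => z.1) (𝓝 (0 : ℝ) ×ˢ ⊤) (𝓝 0) := tendsto_fst

lemma HasExpansion₂.comp_tendsto {Z Z' : Type*} {F : Filter Z} {F' : Filter Z'} {l f f₀ f₁ f₂ : Z → ℝ}
    (h : HasExpansion₂ F l f f₀ f₁ f₂) {k : Z' → Z} (hk : Tendsto k F' F) :
    HasExpansion₂ F' (fun z => l (k z)) (fun z => f (k z)) (fun z => f₀ (k z)) (fun z => f₁ (k z))
      (fun z => f₂ (k z)) :=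
  ⟨h.b₀.comp_tendsto hk, h.b₁.comp_tendsto hk, h.b₂.comp_tendsto hk, h.rem.comp_tendsto hk⟩

variable [MeasurableSpace S]

/-- A family of unimodular random matrices `1 + l P + l² (Q + P² / 2) + O(l³)`, uniformly in the
random parameter. -/
structure IsUniformFamily (A : ℝ → S → Mat2) (P Q : S → Mat2) : Prop where
  meas : ∀ l i j, Measurable fun s => A l s i j
  det : ∀ l s, (A l s).det = 1
  hP : IsBddTraceless P
  hQ : IsBddTraceless Q
  expand : ∀ i j, HasExpansion₂ (𝓝 (0 : ℝ) ×ˢ ⊤) (fun z : ℝ × S => z.1) (fun z => A z.1 z.2 i j)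
    (fun _ => (1 : Mat2) i j) (fun z => P z.2 i j)
    (fun z => (Q z.2 + (1 / 2 : ℝ) • (P z.2 * P z.2)) i j)

namespace IsUniformFamily

variable {A : ℝ → S → Mat2} {P Q : S → Mat2} (hA : IsUniformFamily A P Q)
include hA

lemma expand_circle (i j : Fin 2) :
    HasExpansion₂ (𝓝 (0 : ℝ) ×ˢ ⊤) (fun z : ℝ × (S × ℝ) => z.1) (fun z => A z.1 z.2.1 i j)
    (fun _ => (1 : Mat2) i j) (fun z => P z.2.1 i j)
    (fun z => (Q z.2.1 + (1 / 2 : ℝ) • (P z.2.1 * P z.2.1)) i j) :=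
  (hA.expand i j).comp_tendsto (k := fun z : ℝ × (S × ℝ) => (z.1, z.2.1))
    (tendsto_fst.prodMk (tendsto_top))

lemma expand_trig {t : ℝ → ℝ} {C : ℝ} (ht : ∀ θ, |t θ| ≤ C) (i j : Fin 2) :
    HasExpansion₂ (𝓝 (0 : ℝ) ×ˢ ⊤) (fun z : ℝ × (S × ℝ) => z.1)
    (fun z => t z.2.2 * A z.1 z.2.1 i j)
    (fun z => t z.2.2 * (1 : Mat2) i j) (fun z => t z.2.2 * P z.2.1 i j)
    (fun z => t z.2.2 * (Q z.2.1 + (1 / 2 : ℝ) • (P z.2.1 * P z.2.1)) i j) :=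
  (hA.expand_circle i j).const_mul tendsto_fst_prod_top (isBigO_one_of_bdd fun z => ht z.2.2)

lemma expand_rad : HasExpansion₂ (𝓝 (0 : ℝ) ×ˢ ⊤) (fun z : ℝ × (S × ℝ) => z.1)
    (fun z => rad (A z.1 z.2.1) z.2.2) (fun _ => 1) (fun z => rad (P z.2.1) z.2.2)
    (fun z => rad (Q z.2.1 + (1 / 2 : ℝ) • (P z.2.1 * P z.2.1)) z.2.2) := by
  have hc : ∀ θ, |Real.cos θ ^ 2| ≤ 1 := fun θ => by
    rw [abs_of_nonneg (sq_nonneg _)]; exact Real.cos_sq_le_one θ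
  have hs : ∀ θ, |Real.sin θ ^ 2| ≤ 1 := fun θ => by
    rw [abs_of_nonneg (sq_nonneg _)]; exact Real.sin_sq_le_one θ
  have hsc : ∀ θ, |Real.sin θ * Real.cos θ| ≤ 1 := fun θ => by
    rw [abs_mul]; exact mul_le_one₀ (Real.abs_sin_le_one θ) (abs_nonneg _) (Real.abs_cos_le_one θ)
  have h := (((hA.expand_trig hc 0 0).add (hA.expand_trig hsc 0 1)).add
    (hA.expand_trig hsc 1 0)).add (hA.expand_trig hs 1 1)
  refine h.congr (fun z => ?_) (fun z => ?_) (fun z => ?_) (fun z => ?_)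
  · rw [rad]; ring
  · simp
  · rw [rad]; ring
  · rw [rad]; ring

/-- The square of a traceless matrix is scalar, so `P * P` has no phase and only `Q` contributes at
second order. -/
lemma expand_phase : HasExpansion₂ (𝓝 (0 : ℝ) ×ˢ ⊤) (fun z : ℝ × (S × ℝ) => z.1)
    (fun z => phase (A z.1 z.2.1) z.2.2) (fun _ => 0) (fun z => phase (P z.2.1) z.2.2)
    (fun z => phase (Q z.2.1) z.2.2) := by
  have hc : ∀ θ, |Real.cos θ ^ 2| ≤ 1 := fun θ => by
    rw [abs_of_nonneg (sq_nonneg _)]; exact Real.cos_sq_le_one θ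
  have hs : ∀ θ, |(-Real.sin θ ^ 2)| ≤ 1 := fun θ => by
    rw [abs_neg, abs_of_nonneg (sq_nonneg _)]; exact Real.sin_sq_le_one θ
  have hsc : ∀ θ, |Real.sin θ * Real.cos θ| ≤ 1 := fun θ => by
    rw [abs_mul]; exact mul_le_one₀ (Real.abs_sin_le_one θ) (abs_nonneg _) (Real.abs_cos_le_one θ)
  have hsc' : ∀ θ, |(-(Real.sin θ * Real.cos θ))| ≤ 1 := fun θ => by rw [abs_neg]; exact hsc θ
  have h := (((hA.expand_trig hc 1 0).add (hA.expand_trig hsc 1 1)).add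
    (hA.expand_trig hsc' 0 0)).add (hA.expand_trig hs 0 1)
  refine h.congr (fun z => ?_) (fun z => ?_) (fun z => ?_) (fun z => ?_)
  · rw [phase_eq]; ring
  · simp
  · rw [phase_eq]; ring
  · rw [phase_eq]
    simp only [Matrix.add_apply, Matrix.smul_apply, Matrix.mul_apply, Fin.sum_univ_two, smul_eq_mul,
      hA.hP.trace]
    ring

lemma expand_ell : HasExpansion₂ (𝓝 (0 : ℝ) ×ˢ ⊤) (fun z : ℝ × (S × ℝ) => z.1)
    (fun z => ell (A z.1 z.2.1 *ᵥ e z.2.2)) (fun _ => 0) (fun z => rad (P z.2.1) z.2.2)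
    (fun z => (1 / 2) * (2 * rad (Q z.2.1 + (1 / 2 : ℝ) • (P z.2.1 * P z.2.1)) z.2.2
      + phase (P z.2.1) z.2.2 ^ 2 - rad (P z.2.1) z.2.2 ^ 2)) := by
  have hl := tendsto_fst_prod_top (Y := S × ℝ)
  have hX := hA.expand_rad
  have hY := hA.expand_phase
  have hm1 : HasExpansion₂ (𝓝 (0 : ℝ) ×ˢ ⊤) (fun z : ℝ × (S × ℝ) => z.1) (fun _ => (-1 : ℝ))
      (fun _ => (-1 : ℝ)) (fun _ => 0) (fun _ => 0) :=
    HasExpansion₂.of_bdd (isBigO_one_of_bdd (C := 1) fun z => by simp)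
  -- The squared norm `rad ^ 2 + phase ^ 2`, minus `1`, is the small quantity put into `log (1 +
  -- y)`.
  have hw := ((hX.mul hl hX).add (hY.mul hl hY)).add hm1
  have hw' := hw.congr (f₀' := fun _ => 0) (fun z => rfl) (fun z => by ring) (fun z => rfl)
    (fun z => rfl)
  have hlog := hw'.comp hl (h := fun _ y => Real.log (1 + y)) (h₀ := fun _ => 0) (h₁ := fun _ => 1)
    (h₂ := fun _ => -1 / 2) (isBigO_one_of_bdd (C := 0) (by simp))
    (isBigO_one_of_bdd (C := 1) (by simp)) (isBigO_one_of_bdd (C := 1) fun z => by norm_num [abs_le])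
    (C := 2) (fun _ y hy => abs_log_one_add_sub_le hy)
  refine (hlog.const_mul hl (g := fun _ => (1 / 2 : ℝ))
    (isBigO_one_of_bdd (C := 1) fun z => by norm_num [abs_le])).congr (fun z => ?_) (fun z => by ring)
    (fun z => by ring) (fun z => by ring)
  rw [ell, nsq_mulVec_e]
  ring_nf

/-- The arctangent has no quadratic term, so the correction `-p * rad` comes only from expanding `1
/ rad`. -/
lemma expand_angle : HasExpansion₂ (𝓝 (0 : ℝ) ×ˢ ⊤) (fun z : ℝ × (S × ℝ) => z.1)
    (fun z => Real.arctan (phase (A z.1 z.2.1) z.2.2 * (rad (A z.1 z.2.1) z.2.2)⁻¹)) (fun _ => 0)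
    (fun z => phase (P z.2.1) z.2.2)
    (fun z => phase (Q z.2.1) z.2.2 - phase (P z.2.1) z.2.2 * rad (P z.2.1) z.2.2) := by
  have hl := tendsto_fst_prod_top (Y := S × ℝ)
  have hm1 : HasExpansion₂ (𝓝 (0 : ℝ) ×ˢ ⊤) (fun z : ℝ × (S × ℝ) => z.1) (fun _ => (-1 : ℝ))
      (fun _ => (-1 : ℝ)) (fun _ => 0) (fun _ => 0) :=
    HasExpansion₂.of_bdd (isBigO_one_of_bdd (C := 1) fun z => by simp)
  have hX1 := (hA.expand_rad.add hm1).congr (f₀' := fun _ => 0) (fun z => rfl) (fun z => by ring)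
    (fun z => rfl) (fun z => rfl)
  have hinv := hX1.comp hl (h := fun _ y => (1 + y)⁻¹) (h₀ := fun _ => 1) (h₁ := fun _ => -1)
    (h₂ := fun _ => 1) (isBigO_one_of_bdd (C := 1) (by simp))
    (isBigO_one_of_bdd (C := 1) (by simp)) (isBigO_one_of_bdd (C := 1) (by simp))
    (C := 2) (fun _ y hy => abs_inv_one_add_sub_le hy)
  have hYX := (hA.expand_phase.mul hl hinv).congr (f₀' := fun _ => 0) (fun z => rfl)
    (fun z => by ring) (fun z => rfl) (fun z => rfl)
  have hat := hYX.comp hl (h := fun _ y => Real.arctan y) (h₀ := fun _ => 0) (h₁ := fun _ => 1)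
    (h₂ := fun _ => 0) (isBigO_one_of_bdd (C := 1) (by simp))
    (isBigO_one_of_bdd (C := 1) (by simp)) (isBigO_one_of_bdd (C := 1) (by simp))
    (C := 1) (fun _ y _ => abs_arctan_sub_le y)
  refine hat.congr (fun z => ?_) (fun z => rfl) (fun z => by ring) (fun z => by ring)
  ring_nf

lemma eventually_rad_pos : ∀ᶠ z : ℝ × (S × ℝ) in 𝓝 (0 : ℝ) ×ˢ ⊤, 0 < rad (A z.1 z.2.1) z.2.2 := by
  have hl := tendsto_fst_prod_top (Y := S × ℝ)
  have hm1 : HasExpansion₂ (𝓝 (0 : ℝ) ×ˢ ⊤) (fun z : ℝ × (S × ℝ) => z.1) (fun _ => (-1 : ℝ))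
      (fun _ => (-1 : ℝ)) (fun _ => 0) (fun _ => 0) :=
    HasExpansion₂.of_bdd (isBigO_one_of_bdd (C := 1) fun z => by simp)
  have hX1 := (hA.expand_rad.add hm1).congr (f₀' := fun _ => 0) (fun z => rfl) (fun z => by ring)
    (fun z => rfl) (fun z => rfl)
  have ht := (hX1.isBigO_self hl).trans_tendsto hl
  filter_upwards [ht.eventually (lt_mem_nhds (show (-1 : ℝ) < 0 by norm_num))] with z hz
  linarith

/-- The expansion of a function of the angle after one step. -/
lemma expand_angular {φ u : ℝ → ℝ} (hφ : ∀ θ, φ (θ + 2 * Real.pi) = φ θ)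
    (hu : IsAnalytic u) (huper : ∀ θ, u (θ + 2 * Real.pi) = u θ) (hd : ∀ θ, HasDerivAt φ (u θ) θ) :
    HasExpansion₂ (𝓝 (0 : ℝ) ×ˢ ⊤) (fun z : ℝ × (S × ℝ) => z.1)
      (fun z => angular φ (A z.1 z.2.1 *ᵥ e z.2.2)) (fun z => φ z.2.2)
      (fun z => u z.2.2 * phase (P z.2.1) z.2.2)
      (fun z => u z.2.2 * (phase (Q z.2.1) z.2.2 - phase (P z.2.1) z.2.2 * rad (P z.2.1) z.2.2)
        + deriv u z.2.2 / 2 * phase (P z.2.1) z.2.2 ^ 2) := by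
  have hl := tendsto_fst_prod_top (Y := S × ℝ)
  have hφan : IsAnalytic φ := fun x => (hu x).of_hasDerivAt hd
  have hdu : deriv φ = u := funext fun θ => (hd θ).deriv
  have hd2 : iteratedDeriv 2 φ = deriv u := by
    rw [iteratedDeriv_succ, iteratedDeriv_one, hdu]
  have hd3 : iteratedDeriv 3 φ = deriv (deriv u) := by rw [iteratedDeriv_succ, hd2]
  have hu'an : IsAnalytic (deriv u) := fun x => (hu x).deriv
  have hu''an : IsAnalytic (deriv (deriv u)) := fun x => (hu'an x).deriv
  obtain ⟨C0, hC0⟩ := bounded_of_periodic hφan.continuous hφ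
  obtain ⟨C1, hC1⟩ := bounded_of_periodic hu.continuous huper
  obtain ⟨C2, hC2⟩ := bounded_of_periodic hu'an.continuous (deriv_periodic huper)
  obtain ⟨C3, hC3⟩ := bounded_of_periodic hu''an.continuous (deriv_periodic (deriv_periodic huper))
  have h := hA.expand_angle.comp hl (h := fun z y => φ (z.2.2 + y)) (h₀ := fun z => φ z.2.2)
    (h₁ := fun z => u z.2.2) (h₂ := fun z => deriv u z.2.2 / 2)
    (isBigO_one_of_bdd fun z => hC0 z.2.2) (isBigO_one_of_bdd fun z => hC1 z.2.2)
    (isBigO_one_of_bdd (C := C2 / 2) fun z => by rw [abs_div, abs_two]; gcongr; exact hC2 _)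
    (C := C3) (fun z y _ => by
      have := taylor_two_remainder (C := C3) (x := z.2.2) (y := y) (hφan.contDiff (n := 3))
        (fun t _ => by rw [hd3]; exact hC3 t)
      rwa [hdu, hd2] at this)
  -- The formula for the new angle requires `rad > 0`, which holds for small `l` uniformly in the
  -- random parameter and the angle.
  refine h.congr_eventually ?_
  filter_upwards [hA.eventually_rad_pos] with z hz
  exact (angular_mulVec_e hφ hz).symm

end IsUniformFamily

end Anomaly

end
noncomputable section

namespace Anomaly

section Asymptotics

variable {S : Type*} [MeasurableSpace S] {μ : Measure S} [IsProbabilityMeasure μ]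
  {P Q : S → Mat2}

/-! ### The stationary density of the anomaly -/

/-- `rho` is by definition the normalized `statDensity` for the coefficients `diffusion` and
`meanQ`; its flux is a constant, whose derivative vanishes. -/
lemma rho_properties (hP : IsBddTraceless P) (hQ : IsBddTraceless Q)
    (hp : ∀ θ : ℝ, 0 < ∫ s, phase (P s) θ ^ 2 ∂μ) :
    (∀ θ, 0 < rho μ P Q θ) ∧ (∀ θ, rho μ P Q (θ + 2 * Real.pi) = rho μ P Q θ) ∧
      (∀ θ, AnalyticAt ℝ (rho μ P Q) θ) ∧
      (1 / (2 * Real.pi)) * (∫ θ in (0 : ℝ)..(2 * Real.pi), rho μ P Q θ) = 1 ∧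
      (∀ θ, HasDerivAt (flux μ P Q (rho μ P Q)) 0 θ) := by
  have h := isCircleDiffusion hP hQ hp
  have hpi := Real.pi_pos
  have hI := h.integral_statDensity_pos
  set w := statDensity (diffusion μ P) (meanQ μ Q) with hw
  set n := (∫ t in (0 : ℝ)..(2 * Real.pi), w t) / (2 * Real.pi) with hn
  have hn0 : 0 < n := by positivity
  have hrho : rho μ P Q = fun θ => n⁻¹ * w θ := rfl
  refine ⟨fun θ => ?_, fun θ => ?_, fun θ => ?_, ?_, fun θ => ?_⟩
  · rw [hrho]; exact mul_pos (inv_pos.mpr hn0) (h.statDensity_pos θ)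
  · rw [hrho]; dsimp only; rw [hw, h.statDensity_add]
  · rw [hrho]; exact analyticAt_const.mul (h.an_statDensity θ)
  · rw [hrho, intervalIntegral.integral_const_mul]
    have : ∫ t in (0 : ℝ)..(2 * Real.pi), w t = n * (2 * Real.pi) := by rw [hn]; field_simp
    rw [this]; field_simp
  · have hflux : flux μ P Q (rho μ P Q)
        = fun _ => n⁻¹ * fluxConst (diffusion μ P) (meanQ μ Q) := by
      ext θ
      have hd := (h.anD θ).differentiableAt.hasDerivAt
      have h1 := h.statDensity_flux hd
      rw [← h1, flux, (analytic_diffusion hP).2 θ, hrho, deriv_const_mul _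
        (h.an_statDensity θ).differentiableAt]
      ring
    rw [hflux]
    exact hasDerivAt_const θ _

/-- Subtracting the mean with respect to the stationary density gives a right-hand side for which
the Poisson equation is solvable. -/
lemma lyapCoefficient_eq (hP : IsBddTraceless P) (hQ : IsBddTraceless Q)
    (hp : ∀ θ : ℝ, 0 < ∫ s, phase (P s) θ ^ 2 ∂μ) :
    ∫ t in (0 : ℝ)..(2 * Real.pi), statDensity (diffusion μ P) (meanQ μ Q) t
      * ((1 / 2) * (lyapIntegrand μ P Q t).re - lyapCoefficient μ P Q / 2) = 0 := by
  have h := isCircleDiffusion hP hQ hp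
  have hpi := Real.pi_pos
  have hI := h.integral_statDensity_pos
  set w := statDensity (diffusion μ P) (meanQ μ Q) with hw
  set I := ∫ t in (0 : ℝ)..(2 * Real.pi), w t with hIdef
  have hrho : rho μ P Q = fun θ => (I / (2 * Real.pi))⁻¹ * w θ := rfl
  have hwc : Continuous w := h.an_statDensity.continuous
  have hfc : Continuous fun θ => (lyapIntegrand μ P Q θ).re := isAnalytic_re_lyapIntegrand.continuous
  have hLc : Continuous (lyapIntegrand μ P Q) := by
    unfold lyapIntegrand; fun_prop
  have hΛ : lyapCoefficient μ P Q
      = I⁻¹ * ∫ t in (0 : ℝ)..(2 * Real.pi), w t * (lyapIntegrand μ P Q t).re := by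
    have h1 : ∫ θ in (0 : ℝ)..(2 * Real.pi), ((rho μ P Q θ : ℂ) * lyapIntegrand μ P Q θ).re
        = (∫ θ in (0 : ℝ)..(2 * Real.pi), (rho μ P Q θ : ℂ) * lyapIntegrand μ P Q θ).re := by
      have hi : IntervalIntegrable (fun θ => (rho μ P Q θ : ℂ) * lyapIntegrand μ P Q θ) volume
          0 (2 * Real.pi) := by
        refine Continuous.intervalIntegrable ?_ _ _
        rw [hrho]
        exact (Complex.continuous_ofReal.comp (continuous_const.mul hwc)).mul hLc
      exact (Complex.reCLM.intervalIntegral_comp_comm hi)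
    have h2 : ((1 / (2 * Real.pi) : ℂ)) = ((1 / (2 * Real.pi) : ℝ) : ℂ) := by push_cast; rfl
    rw [lyapCoefficient, h2, Complex.re_ofReal_mul, ← h1]
    simp only [Complex.re_ofReal_mul, hrho, mul_assoc]
    rw [intervalIntegral.integral_const_mul]
    field_simp
  have h3 : (fun t => w t * ((1 / 2) * (lyapIntegrand μ P Q t).re - lyapCoefficient μ P Q / 2))
      = fun t => (1 / 2) * (w t * (lyapIntegrand μ P Q t).re) - (lyapCoefficient μ P Q / 2) * w t := by
    ext t; ring
  rw [h3, intervalIntegral.integral_sub, intervalIntegral.integral_const_mul,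
    intervalIntegral.integral_const_mul, ← hIdef, hΛ]
  · field_simp; ring
  · exact (continuous_const.mul (hwc.mul hfc)).intervalIntegrable _ _
  · exact (continuous_const.mul hwc).intervalIntegrable _ _

/-! ### Asymptotics of the Lyapunov exponent -/

namespace IsUniformFamily

variable {A : ℝ → S → Mat2} (hA : IsUniformFamily A P Q)
include hA

omit [IsProbabilityMeasure μ] in
lemma eventually_bounded : ∃ B, ∀ᶠ l in 𝓝 (0 : ℝ), IsBoundedUnimodular (A l) B := by
  have h : ∀ i j, ∃ C, 0 ≤ C ∧ ∀ᶠ l in 𝓝 (0 : ℝ), ∀ s, |A l s i j| ≤ C * |l| ^ 0 := fun i j =>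
    exists_uniform_bound (n := 0) (by simpa using (hA.expand i j).bdd tendsto_fst_prod_top)
  choose C _ hC using h
  refine ⟨C 0 0 ^ 2 + C 0 1 ^ 2 + C 1 0 ^ 2 + C 1 1 ^ 2, ?_⟩
  filter_upwards [hC 0 0, hC 0 1, hC 1 0, hC 1 1] with l h0 h1 h2 h3
  refine ⟨hA.meas l, hA.det l, fun s => ?_⟩
  have e : ∀ {x c : ℝ}, |x| ≤ c * |l| ^ 0 → x ^ 2 ≤ c ^ 2 := fun h => by
    rw [pow_zero, mul_one] at h
    rw [← sq_abs]; exact pow_le_pow_left₀ (abs_nonneg _) h 2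
  unfold frob
  linarith [e (h0 s), e (h1 s), e (h2 s), e (h3 s)]

/-- A non-degenerate anomaly moves every direction. -/
lemma eventually_moves (hp : ∀ θ : ℝ, 0 < ∫ s, phase (P s) θ ^ 2 ∂μ) :
    ∀ᶠ l in 𝓝 (0 : ℝ), l ≠ 0 → ∃ z₀ > 0, ∀ x ≠ 0,
      z₀ * nsq x ^ 2 ≤ ∫ s, wedge x (A l s *ᵥ x) ^ 2 ∂μ := by
  have h := isCircleDiffusion hA.hP hA.hQ hp
  obtain ⟨d, hd0, hd⟩ := pos_min_of_periodic h.anD.continuous h.perD h.pos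
  obtain ⟨B, hB⟩ := hA.eventually_bounded
  have hY := hA.expand_phase
  obtain ⟨C, hC0, hC⟩ := exists_uniform_bound (n := 3) (hY.mul tendsto_fst_prod_top hY).rem
  have hsmall : ∀ᶠ l in 𝓝 (0 : ℝ), C * |l| < d / 2 := by
    have : Tendsto (fun l : ℝ => C * |l|) (𝓝 0) (𝓝 (C * |(0 : ℝ)|)) :=
      (continuous_const.mul continuous_abs).tendsto 0
    rw [abs_zero, mul_zero] at this
    exact this.eventually (gt_mem_nhds (by positivity))
  filter_upwards [hB, hC, hsmall] with l hBl hCl hsl hl0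
  -- The mean square phase is at least `l ^ 2 * d - C * |l| ^ 3`, with `d` a lower bound for the
  -- diffusion coefficient, and `C * |l| < d / 2`.
  refine ⟨l ^ 2 * (d / 2), by positivity, fun x hx => ?_⟩
  obtain ⟨r, hr, θ, rfl⟩ := exists_polar hx
  have hw : ∀ s, wedge (r • e θ) (A l s *ᵥ (r • e θ)) = r ^ 2 * phase (A l s) θ := by
    intro s
    rw [← wedge_mulVec_e, Matrix.mulVec_smul]
    simp only [wedge, Pi.smul_apply, smul_eq_mul]; ring
  simp only [hw, mul_pow]
  rw [integral_const_mul, nsq_smul, nsq_e, mul_one, mul_comm ((r ^ 2) ^ 2)]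
  have hpt : ∀ s, l ^ 2 * phase (P s) θ ^ 2 - C * |l| ^ 3 ≤ phase (A l s) θ ^ 2 := by
    intro s
    have := (abs_le.mp (hCl (s, θ))).1
    dsimp only at this
    linarith
  have hpi := (hA.hP.phase θ).sq.integrable μ
  have hph : Integrable (fun s => phase (A l s) θ ^ 2) μ := by
    have hm : Measurable fun s => wedge (e θ) (A l s *ᵥ e θ) := hBl.measurable_wedge _
    simp only [wedge_mulVec_e] at hm
    refine Integrable.of_bound (hm.pow_const 2).aestronglyMeasurable B (ae_of_all _ fun s => ?_)
    rw [Real.norm_of_nonneg (sq_nonneg _)]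
    have h1 := nsq_mulVec_le (A l s) (e θ)
    rw [nsq_mulVec_e, nsq_e, mul_one] at h1
    have := hBl.bound s
    nlinarith [sq_nonneg (rad (A l s) θ)]
  have hint := integral_mono ((hpi.const_mul (l ^ 2)).sub (integrable_const (C * |l| ^ 3))) hph hpt
  simp only [Pi.sub_apply] at hint
  rw [integral_sub (hpi.const_mul _) (integrable_const _), integral_const_mul, integral_const,
    probReal_univ, one_smul] at hint
  have h3 : l ^ 2 * (d / 2) ≤ l ^ 2 * ∫ s, phase (P s) θ ^ 2 ∂μ - C * |l| ^ 3 := by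
    have e1 : d ≤ ∫ s, phase (P s) θ ^ 2 ∂μ := hd θ
    have e2 : C * |l| ^ 3 = l ^ 2 * (C * |l|) := by rw [← sq_abs l]; ring
    rw [e2, ← mul_sub]
    apply mul_le_mul_of_nonneg_left _ (sq_nonneg _)
    linarith
  have h4 : 0 ≤ (r ^ 2) ^ 2 := by positivity
  exact mul_le_mul_of_nonneg_right (h3.trans hint) h4

/-- Here E(p · rad) = -D' / 4 turns the averaged second order part of the corrector into the left
side of the Poisson equation, so that only the constant `c` survives. -/
lemma integral_second_order {u : ℝ → ℝ} {c : ℝ}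
    (hu : ∀ θ, (1 / 2) * diffusion μ P θ * deriv u θ
      + ((1 / 2) * (deriv (diffusion μ P) θ / 2) + meanQ μ Q θ) * u θ
      = (1 / 2) * (lyapIntegrand μ P Q θ).re - c) (θ : ℝ) :
    ∫ s, ((1 / 2) * (2 * rad (Q s + (1 / 2 : ℝ) • (P s * P s)) θ + phase (P s) θ ^ 2 - rad (P s) θ ^ 2)
      - (u θ * (phase (Q s) θ - phase (P s) θ * rad (P s) θ) + deriv u θ / 2 * phase (P s) θ ^ 2)) ∂μ
      = c := by
  have hPθ := hA.hP.phase θ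
  have hQθ := hA.hQ.phase θ
  have hr := isBM_rad hA.hP.bm θ
  have hr2 : IsBM fun s => rad (Q s + (1 / 2 : ℝ) • (P s * P s)) θ := by
    refine isBM_rad (P := fun s => Q s + (1 / 2 : ℝ) • (P s * P s)) (fun i j => ?_) θ
    simp only [Matrix.add_apply, Matrix.smul_apply, smul_eq_mul]
    exact (hA.hQ.bm i j).add ((isBM_const _).mul (isBM_mul_entry hA.hP.bm hA.hP.bm i j))
  have h1 : Integrable (fun s => (1 / 2) * (2 * rad (Q s + (1 / 2 : ℝ) • (P s * P s)) θ
      + phase (P s) θ ^ 2 - rad (P s) θ ^ 2)) μ :=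
    ((isBM_const _).mul ((((isBM_const _).mul hr2).add hPθ.sq).sub hr.sq)).integrable μ
  have h2 : Integrable (fun s => u θ * (phase (Q s) θ - phase (P s) θ * rad (P s) θ)) μ :=
    ((isBM_const _).mul (hQθ.sub (hPθ.mul hr))).integrable μ
  have h3 : Integrable (fun s => deriv u θ / 2 * phase (P s) θ ^ 2) μ :=
    ((isBM_const _).mul hPθ.sq).integrable μ
  have h4 : ∫ s, phase (P s) θ * rad (P s) θ ∂μ = -(deriv (diffusion μ P) θ / 4) := by
    have e1 := (analytic_diffusion (μ := μ) hA.hP).2 θ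
    have e2 : ∀ s, phase (P s) θ * deriv (phase (P s)) θ = -2 * (phase (P s) θ * rad (P s) θ) :=
      fun s => by rw [deriv_phase (hA.hP.trace s)]; ring
    simp only [e2, integral_const_mul] at e1
    linarith
  have h5 := hu θ
  have h6 := integral_sub h1 (h2.add h3)
  simp only [Pi.add_apply] at h6
  rw [h6, integral_add h2 h3, integral_const_mul, integral_const_mul,
    integral_const_mul, integral_sub (hQθ.integrable μ) ((hPθ.mul hr).integrable μ), h4,
    ← re_lyapIntegrand hA.hP hA.hQ]
  simp only [diffusion, meanQ] at h5 ⊢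
  linarith

omit hA [IsProbabilityMeasure μ] in
-- The integrand is linear in the entries of `P`, with coefficients that do not depend on the random
-- parameter.
lemma integral_first_order (hmean : ∀ i j, ∫ s, P s i j ∂μ = 0)
    (hint : ∀ i j, Integrable (fun s => P s i j) μ) (u θ : ℝ) :
    ∫ s, (rad (P s) θ - u * phase (P s) θ) ∂μ = 0 := by
  have h : ∀ s, rad (P s) θ - u * phase (P s) θ
      = (Real.cos θ ^ 2 + u * (Real.sin θ * Real.cos θ)) * P s 0 0
        + (Real.sin θ * Real.cos θ + u * Real.sin θ ^ 2) * P s 0 1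
        + (Real.sin θ * Real.cos θ - u * Real.cos θ ^ 2) * P s 1 0
        + (Real.sin θ ^ 2 - u * (Real.sin θ * Real.cos θ)) * P s 1 1 := by
    intro s; rw [rad, phase_eq]; ring
  simp only [h]
  rw [integral_add, integral_add, integral_add]
  · simp only [integral_const_mul, hmean, mul_zero, add_zero]
  · exact (hint 0 0).const_mul _
  · exact (hint 0 1).const_mul _
  · exact ((hint 0 0).const_mul _).add ((hint 0 1).const_mul _)
  · exact (hint 1 0).const_mul _
  · exact (((hint 0 0).const_mul _).add ((hint 0 1).const_mul _)).add ((hint 1 0).const_mul _)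
  · exact (hint 1 1).const_mul _

/-- The Lyapunov exponent of a uniform family to second order in the coupling. -/
theorem lyapunov_asymptotics (hmean : ∀ i j, ∫ s, P s i j ∂μ = 0)
    (hp : ∀ θ : ℝ, 0 < ∫ s, phase (P s) θ ^ 2 ∂μ) :
    ∃ C, ∀ᶠ l in 𝓝 (0 : ℝ), l ≠ 0 → ∃ γ,
      (∀ x ≠ 0, Tendsto (fun N : ℕ => (1 / (N : ℝ)) * (step (A l) μ)^[N] ell x) atTop (𝓝 γ)) ∧
      |γ - l ^ 2 / 2 * lyapCoefficient μ P Q| ≤ C * |l| ^ 3 := by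
  have h := isCircleDiffusion hA.hP hA.hQ hp
  have hPi : ∀ i j, Integrable (fun s => P s i j) μ := fun i j => (hA.hP.bm i j).integrable μ
  set c := lyapCoefficient μ P Q / 2 with hc
  have hgan : IsAnalytic fun θ => (1 / 2) * (lyapIntegrand μ P Q θ).re - c := fun x =>
    (analyticAt_const.mul (isAnalytic_re_lyapIntegrand x)).sub analyticAt_const
  -- The corrector `φ` cancels the dependence of the second order growth on the angle.
  obtain ⟨φ, u, huan, hφper, huper, hφd, hu⟩ := h.exists_poisson_solution hgan
    (fun θ => by
      rw [re_lyapIntegrand hA.hP hA.hQ, re_lyapIntegrand hA.hP hA.hQ]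
      simp only [phase_add_two_pi, rad_add_two_pi])
    (lyapCoefficient_eq hA.hP hA.hQ hp)
  have hφan : IsAnalytic φ := fun x => (huan x).of_hasDerivAt hφd
  have hl := tendsto_fst_prod_top (Y := S × ℝ)
  have hang := hA.expand_angular hφper huan huper hφd
  have hF := hA.expand_ell.add (hang.const_mul hl (g := fun _ => (-1 : ℝ))
    (isBigO_one_of_bdd (C := 1) (by simp)))
  obtain ⟨C, hC0, hC⟩ := exists_uniform_bound (n := 3) hF.rem
  obtain ⟨B, hB⟩ := hA.eventually_bounded
  obtain ⟨M, hM⟩ := bounded_of_periodic hφan.continuous hφper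
  refine ⟨C, ?_⟩
  filter_upwards [hC, hB, hA.eventually_moves hp] with l hCl hBl hmove hl0
  obtain ⟨z₀, hz₀, hz⟩ := hmove hl0
  obtain ⟨γ, hγ⟩ := hBl.exists_tendsto_growth hz₀ hz
  refine ⟨γ, hγ, ?_⟩
  set Φ := angular φ with hΦ
  have hΦm : Measurable Φ := measurable_angular hφan.continuous.measurable
  have hΦb : ∀ x, |Φ x| ≤ M := fun x => hM _
  have hΦl : LocBdd Φ := locBdd_of_bound hΦm hΦb
  refine hBl.abs_growth_sub_le (e_ne_zero 0) (hγ _ (e_ne_zero 0)) hΦm hΦb fun y hy => ?_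
  -- Scaling by `r` adds `log r` to `ell` both before and after the step and leaves `Φ` unchanged,
  -- so unit vectors suffice.
  obtain ⟨r, hr, θ, rfl⟩ := exists_polar hy
  have he := e_ne_zero θ
  have hie := hBl.integrable_mulVec (μ := μ) locBdd_ell he
  have hiΦ := hBl.integrable_mulVec (μ := μ) hΦl he
  have hs1 : step (A l) μ ell (r • e θ) = Real.log r + step (A l) μ ell (e θ) := by
    have : ∀ s, ell (A l s *ᵥ (r • e θ)) = Real.log r + ell (A l s *ᵥ e θ) := fun s => by
      rw [Matrix.mulVec_smul, ell_smul hr (mulVec_ne_zero (hA.det l s) he)]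
    simp only [step, this]
    rw [integral_add (integrable_const _) hie]
    simp
  have hs2 : step (A l) μ Φ (r • e θ) = step (A l) μ Φ (e θ) := by
    simp only [step, Matrix.mulVec_smul, hΦ, angular_smul φ hr]
  rw [hs1, hs2, ell_smul hr he, ell_e, hΦ, angular_smul φ hr, angular_e hφper, ← hΦ]
  have hrP := isBM_rad hA.hP.bm θ
  have hG1 : Integrable (fun s => rad (P s) θ - u θ * phase (P s) θ) μ :=
    (hrP.sub ((isBM_const _).mul (hA.hP.phase θ))).integrable μ
  set g₂ : S → ℝ := fun s => (1 / 2) * (2 * rad (Q s + (1 / 2 : ℝ) • (P s * P s)) θ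
      + phase (P s) θ ^ 2 - rad (P s) θ ^ 2)
      - (u θ * (phase (Q s) θ - phase (P s) θ * rad (P s) θ) + deriv u θ / 2 * phase (P s) θ ^ 2)
    with hg₂
  have hG2int : ∫ s, g₂ s ∂μ = c := hA.integral_second_order hu θ
  have hG2 : Integrable g₂ μ := by
    have hr2 : IsBM fun s => rad (Q s + (1 / 2 : ℝ) • (P s * P s)) θ := by
      refine isBM_rad (P := fun s => Q s + (1 / 2 : ℝ) • (P s * P s)) (fun i j => ?_) θ
      simp only [Matrix.add_apply, Matrix.smul_apply, smul_eq_mul]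
      exact (hA.hQ.bm i j).add ((isBM_const _).mul (isBM_mul_entry hA.hP.bm hA.hP.bm i j))
    exact (((isBM_const _).mul ((((isBM_const _).mul hr2).add (hA.hP.phase θ).sq).sub hrP.sq)).sub
      (((isBM_const _).mul ((hA.hQ.phase θ).sub ((hA.hP.phase θ).mul hrP))).add
        ((isBM_const _).mul (hA.hP.phase θ).sq))).integrable μ
  -- One constant `C` serves all parameters and angles. After averaging, the first order term
  -- vanishes and the second order term equals `l ^ 2 * c`.
  have hbound : ∀ᵐ s ∂μ, ‖(ell (A l s *ᵥ e θ) - Φ (A l s *ᵥ e θ))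
      - (-φ θ + (l * (rad (P s) θ - u θ * phase (P s) θ) + l ^ 2 * g₂ s))‖ ≤ C * |l| ^ 3 := by
    refine ae_of_all _ fun s => ?_
    have := hCl (s, θ)
    dsimp only at this
    rw [Real.norm_eq_abs]
    refine le_trans (le_of_eq ?_) this
    congr 1
    simp only [hg₂, hΦ]
    ring
  have hnorm := norm_integral_le_of_norm_le_const hbound
  have i1 := hie.sub hiΦ
  have i2 := (hG1.const_mul l).add (hG2.const_mul (l ^ 2))
  have i3 := (integrable_const (μ := μ) (-φ θ)).add i2
  have e1 := integral_sub i1 i3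
  have e2 := integral_sub hie hiΦ
  have e3 := integral_add (integrable_const (μ := μ) (-φ θ)) i2
  have e4 := integral_add (hG1.const_mul l) (hG2.const_mul (l ^ 2))
  simp only [Pi.sub_apply, Pi.add_apply] at e1 e2 e3 e4
  rw [integral_const_mul, integral_const_mul, integral_first_order hmean hPi, hG2int] at e4
  rw [integral_const, probReal_univ, one_smul, e4] at e3
  rw [e1, e2, e3, probReal_univ, mul_one, Real.norm_eq_abs] at hnorm
  refine le_trans (le_of_eq ?_) hnorm
  congr 1
  simp only [step, hc]
  ring

end IsUniformFamily

end Asymptotics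

end Anomaly

end
noncomputable section

namespace Anomaly

/-! ### The exponential expansion -/

section Exp

open scoped Matrix.Norms.Operator

lemma exp_sub_quadratic_isBigO :
    (fun y : Mat2 => NormedSpace.exp y - (1 + y + (1 / 2 : ℝ) • (y * y))) =O[𝓝 0]
      fun y => ‖y‖ ^ 3 := by
  have h := (NormedSpace.exp_hasFPowerSeriesAt_zero (𝕂 := ℝ) (𝔸 := Mat2)).isBigO_sub_partialSum_pow 3
  refine h.congr_left fun y => ?_
  simp only [FormalMultilinearSeries.partialSum, Finset.sum_range_succ, Finset.sum_range_zero,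
    NormedSpace.expSeries_apply_eq, zero_add]
  simp [Nat.factorial, pow_two]
  rfl

lemma isBigO_matrix {R : ℝ → Mat2} {g : ℝ → ℝ} {F : Filter ℝ}
    (h : ∀ i j, (fun l => R l i j) =O[F] g) : R =O[F] g := by
  have h1 : R = fun l => ∑ i, ∑ j, R l i j • Matrix.single i j (1 : ℝ) := by
    ext l : 1
    conv_lhs => rw [Matrix.matrix_eq_sum_single (R l)]
    simp [Matrix.smul_single]
  rw [h1]
  have h2 : ∀ i j, (fun l => R l i j • (Matrix.single i j (1 : ℝ) : Mat2)) =O[F] g := fun i j =>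
    (IsBigO.of_bound ‖(Matrix.single i j (1 : ℝ) : Mat2)‖
      (Eventually.of_forall fun l => by rw [norm_smul, mul_comm])).trans (h i j)
  simp only [Fin.sum_univ_two]
  exact ((h2 0 0).add (h2 0 1)).add ((h2 1 0).add (h2 1 1))

lemma isBigO_entry {R : ℝ → Mat2} {g : ℝ → ℝ} {F : Filter ℝ} (h : R =O[F] g) (i j : Fin 2) :
    (fun l => R l i j) =O[F] g :=
  ((LinearMap.toContinuousLinearMap (Matrix.entryLinearMap ℝ ℝ i j)).isBigO_comp R F).trans h

/-- With `X` the exponent, `X = O(l)` leaves a cubic remainder in the exponential series, and `X *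
X` agrees with `l ^ 2 • (P * P)` to the same order. -/
lemma exp_expansion {P Q : Mat2} {R : ℝ → Mat2}
    (hR : ∀ i j, (fun l => R l i j) =O[𝓝 0] fun l : ℝ => l ^ 3) (i j : Fin 2) :
    (fun l : ℝ => NormedSpace.exp (l • P + l ^ 2 • Q + R l) i j
      - (1 + l • P + l ^ 2 • (Q + (1 / 2 : ℝ) • (P * P))) i j) =O[𝓝 0] fun l : ℝ => l ^ 3 := by
  refine isBigO_entry (R := fun l : ℝ => NormedSpace.exp (l • P + l ^ 2 • Q + R l)
      - (1 + l • P + l ^ 2 • (Q + (1 / 2 : ℝ) • (P * P)))) ?_ i j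
  have hR' : R =O[𝓝 0] fun l : ℝ => l ^ 3 := isBigO_matrix hR
  have hpow : ∀ {m n : ℕ}, m ≤ n → (fun l : ℝ => l ^ n) =O[𝓝 0] fun l : ℝ => l ^ m := fun h =>
    isBigO_pow_of_le (l := id) tendsto_id h
  have hsm : ∀ (n : ℕ) (M : Mat2), (fun l : ℝ => l ^ n • M) =O[𝓝 0] fun l : ℝ => l ^ n := by
    intro n M
    refine IsBigO.of_bound ‖M‖ (Eventually.of_forall fun l => ?_)
    rw [norm_smul, mul_comm]
  set X : ℝ → Mat2 := fun l => l • P + l ^ 2 • Q + R l with hX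
  have hX1 : X =O[𝓝 0] fun l : ℝ => l := by
    have h1 := hsm 1 P
    have h2 := (hsm 2 Q).trans (hpow (show 1 ≤ 2 by norm_num))
    have h3 := hR'.trans (hpow (show 1 ≤ 3 by norm_num))
    simpa using (h1.add h2).add h3
  have hX0 : Tendsto X (𝓝 0) (𝓝 0) := hX1.trans_tendsto tendsto_id
  have e1 := exp_sub_quadratic_isBigO.comp_tendsto hX0
  have e2 : (fun l => NormedSpace.exp (X l) - (1 + X l + (1 / 2 : ℝ) • (X l * X l)))
      =O[𝓝 0] fun l : ℝ => l ^ 3 :=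
    e1.trans ((hX1.norm_left).pow 3)
  set W : ℝ → Mat2 := fun l => l ^ 2 • Q + R l with hW
  have hW2 : W =O[𝓝 0] fun l : ℝ => l ^ 2 :=
    (hsm 2 Q).add (hR'.trans (hpow (show 2 ≤ 3 by norm_num)))
  have e3 : (fun l => X l * X l - l ^ 2 • (P * P)) =O[𝓝 0] fun l : ℝ => l ^ 3 := by
    have h1 : (fun l : ℝ => (l • P) * W l) =O[𝓝 0] fun l : ℝ => l ^ 3 := by
      refine ((hsm 1 P).mul hW2).congr (fun l => by simp) (fun l => by ring)
    have h2 : (fun l : ℝ => W l * X l) =O[𝓝 0] fun l : ℝ => l ^ 3 :=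
      (hW2.mul hX1).congr (fun l => rfl) (fun l => by ring)
    refine (h1.add h2).congr_left fun l => ?_
    have : X l = l • P + W l := by simp only [hX, hW, add_assoc]
    have hPP : l ^ 2 • (P * P) = (l • P) * (l • P) := by rw [smul_mul_smul_comm, pow_two]
    rw [this, hPP]
    generalize l • P = Y
    noncomm_ring
  have e4 := (e2.add (e3.const_smul_left (1 / 2 : ℝ))).add hR'
  refine e4.congr_left fun l => ?_
  simp only [Pi.smul_apply, hX, smul_sub, smul_add]
  rw [smul_comm (1 / 2 : ℝ) (l ^ 2)]
  abel

end Exp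

/-- The matrix entries of a family with an exponential expansion. -/
lemma HasExpansion.entries {A : ℝ → Mat2} {P Q : Mat2} (h : HasExpansion A P Q) :
    ∃ ε : ℝ, (ε = 1 ∨ ε = -1) ∧ A 0 = ε • (1 : Mat2) ∧
      ∀ i j, (fun l : ℝ => ε * A l i j - ((1 : Mat2) i j + P i j * l
        + (Q + (1 / 2 : ℝ) • (P * P)) i j * l ^ 2)) =O[𝓝 0] fun l : ℝ => l ^ 3 := by
  obtain ⟨-, -, ε, hε, R, hR, hA⟩ := h
  refine ⟨ε, hε, ?_, fun i j => ?_⟩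
  · have hR0 : R 0 = 0 := by
      ext i j
      have := (hR i j).eq_zero_imp.self_of_nhds
      simpa using this
    rw [hA.self_of_nhds, hR0]
    simp [NormedSpace.exp_zero]
  · have hsq : ε * ε = 1 := by rcases hε with rfl | rfl <;> norm_num
    refine (exp_expansion (P := P) (Q := Q) hR i j).congr' ?_ EventuallyEq.rfl
    filter_upwards [hA] with l hl
    rw [hl, Matrix.smul_apply, smul_eq_mul, ← mul_assoc, hsq, one_mul]
    simp only [Matrix.add_apply, Matrix.smul_apply, smul_eq_mul]
    ring

/-- A quadratic polynomial of third order at the origin vanishes. -/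
lemma quadratic_eq_zero {a b c : ℝ}
    (h : (fun l : ℝ => a + b * l + c * l ^ 2) =O[𝓝 0] fun l : ℝ => l ^ 3) :
    a = 0 ∧ b = 0 ∧ c = 0 := by
  have hpow : ∀ {m n : ℕ}, m < n → (fun l : ℝ => l ^ n) =o[𝓝 0] fun l : ℝ => l ^ m := fun h =>
    isLittleO_pow_pow h
  have ha : a = 0 := by
    have := h.eq_zero_imp.self_of_nhds
    simpa using this
  subst ha
  have key : ∀ n : ℕ, ∀ x : ℝ, (fun l : ℝ => x * l ^ n) =o[𝓝 0] (fun l : ℝ => l ^ n) → x = 0 := by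
    intro n x hx
    by_contra hne
    have h1 : (fun l : ℝ => l ^ n) =o[𝓝 0] fun l : ℝ => l ^ n :=
      (isBigO_const_mul_self x⁻¹ (fun l : ℝ => x * l ^ n) (𝓝 0) |>.congr_left
        (fun l => by field_simp)).trans_isLittleO hx
    have h2 : ∃ᶠ l : ℝ in 𝓝 0, l ^ n ≠ 0 := by
      have : ∃ᶠ l : ℝ in 𝓝[≠] 0, l ^ n ≠ 0 := by
        refine Eventually.frequently ?_
        filter_upwards [self_mem_nhdsWithin] with l hl
        have : l ≠ 0 := hl
        exact pow_ne_zero n this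
      exact this.filter_mono nhdsWithin_le_nhds
    exact isLittleO_irrefl h2 h1
  have hb : b = 0 := by
    apply key 1
    have h1 := h.trans_isLittleO (hpow (show 1 < 3 by norm_num))
    have h2 := (hpow (show 1 < 2 by norm_num)).const_mul_left c
    exact (h1.sub h2).congr_left fun l => by ring
  subst hb
  refine ⟨rfl, rfl, key 2 c ?_⟩
  have h1 := h.trans_isLittleO (hpow (show 2 < 3 by norm_num))
  exact h1.congr_left fun l => by ring

/-! ### Smooth families -/

section Smooth

variable {S : Type*} [TopologicalSpace S]

/-- Scalar functions which are smooth in the coupling, with jointly continuous derivatives. -/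
def IsSmoothScalar (f : ℝ → S → ℝ) : Prop :=
  (∀ s, ContDiff ℝ ∞ fun l => f l s) ∧
    ∀ k : ℕ, Continuous fun x : ℝ × S => iteratedDeriv k (fun l => f l x.2) x.1

lemma IsSmoothScalar.add {f g : ℝ → S → ℝ} (hf : IsSmoothScalar f) (hg : IsSmoothScalar g) :
    IsSmoothScalar fun l s => f l s + g l s := by
  refine ⟨fun s => (hf.1 s).add (hg.1 s), fun k => ?_⟩
  have : ∀ x : ℝ × S, iteratedDeriv k (fun l => f l x.2 + g l x.2) x.1
      = iteratedDeriv k (fun l => f l x.2) x.1 + iteratedDeriv k (fun l => g l x.2) x.1 := fun x =>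
    iteratedDeriv_fun_add ((hf.1 x.2).contDiffAt.of_le (by exact_mod_cast le_top))
      ((hg.1 x.2).contDiffAt.of_le (by exact_mod_cast le_top))
  simp only [this]
  exact (hf.2 k).add (hg.2 k)

lemma IsSmoothScalar.const_mul {f : ℝ → S → ℝ} (hf : IsSmoothScalar f) {c : S → ℝ}
    (hc : Continuous c) : IsSmoothScalar fun l s => c s * f l s := by
  refine ⟨fun s => contDiff_const.mul (hf.1 s), fun k => ?_⟩
  simp only [iteratedDeriv_const_mul_field]
  exact (hc.comp continuous_snd).mul (hf.2 k)

/-- Pointwise expansions of a smooth family are continuous in the parameter, and uniform on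
compact sets. -/
lemma IsSmoothScalar.expansion {f : ℝ → S → ℝ} (hf : IsSmoothScalar f) {p₀ p₁ p₂ : S → ℝ}
    (h : ∀ s, (fun l : ℝ => f l s - (p₀ s + p₁ s * l + p₂ s * l ^ 2)) =O[𝓝 0] fun l : ℝ => l ^ 3) :
    Continuous p₁ ∧ Continuous p₂ ∧ ∀ K : Set S, IsCompact K → ∃ C, 0 ≤ C ∧
      ∀ s ∈ K, ∀ l : ℝ, |l| ≤ 1 → |f l s - (p₀ s + p₁ s * l + p₂ s * l ^ 2)| ≤ C * |l| ^ 3 := by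
  have hbound : ∀ K : Set S, IsCompact K → ∃ C, 0 ≤ C ∧ ∀ s ∈ K, ∀ l : ℝ, |l| ≤ 1 →
      |f l s - (f 0 s + deriv (fun l => f l s) 0 * l
        + iteratedDeriv 2 (fun l => f l s) 0 / 2 * l ^ 2)| ≤ C * |l| ^ 3 := by
    intro K hK
    -- The third derivative is jointly continuous, hence bounded on the compact set `[-1, 1] × K`.
    obtain ⟨C, hC⟩ := ((isCompact_Icc (a := (-1 : ℝ)) (b := 1)).prod hK).exists_bound_of_continuousOn
      (hf.2 3).continuousOn
    refine ⟨max C 0, le_max_right _ _, fun s hs l hl => ?_⟩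
    have := taylor_two_remainder (C := max C 0) (x := 0) (y := l)
      (contDiff_infty.mp (hf.1 s) 3) (fun t ht => by
        refine (hC (t, s) ⟨?_, hs⟩).trans (le_max_left _ _)
        rw [zero_add] at ht
        have hl' := abs_le.mp hl
        exact Set.uIcc_subset_Icc ⟨by norm_num, by norm_num⟩ hl' ht)
    simpa using this
  -- Uniqueness of the second order expansion identifies the given coefficients with the Taylor
  -- coefficients, from which they inherit continuity in the parameter.
  have hcoef : ∀ s, p₀ s = f 0 s ∧ p₁ s = deriv (fun l => f l s) 0
      ∧ p₂ s = iteratedDeriv 2 (fun l => f l s) 0 / 2 := by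
    intro s
    obtain ⟨C, -, hC⟩ := hbound {s} isCompact_singleton
    have h1 : (fun l => f l s - (f 0 s + deriv (fun l => f l s) 0 * l
        + iteratedDeriv 2 (fun l => f l s) 0 / 2 * l ^ 2)) =O[𝓝 0] fun l : ℝ => l ^ 3 := by
      refine IsBigO.of_bound C ?_
      filter_upwards [Metric.closedBall_mem_nhds (0 : ℝ) one_pos] with l hl
      have hl' : |l| ≤ 1 := by simpa using hl
      simpa using hC s rfl l hl'
    obtain ⟨e0, e1, e2⟩ := quadratic_eq_zero (((h s).sub h1).congr_left (f₂ := fun l =>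
      (f 0 s - p₀ s) + (deriv (fun l => f l s) 0 - p₁ s) * l
        + (iteratedDeriv 2 (fun l => f l s) 0 / 2 - p₂ s) * l ^ 2) fun l => by ring)
    exact ⟨by linarith, by linarith, by linarith⟩
  have hcont : ∀ k : ℕ, Continuous fun s => iteratedDeriv k (fun l => f l s) 0 := fun k =>
    (hf.2 k).comp (continuous_const.prodMk continuous_id)
  refine ⟨?_, ?_, fun K hK => ?_⟩
  · rw [show p₁ = fun s => iteratedDeriv 1 (fun l => f l s) 0 from funext fun s => by
      rw [(hcoef s).2.1, iteratedDeriv_one]]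
    exact hcont 1
  · rw [show p₂ = fun s => iteratedDeriv 2 (fun l => f l s) 0 / 2 from funext fun s =>
      (hcoef s).2.2]
    exact (hcont 2).div_const 2
  · obtain ⟨C, hC0, hC⟩ := hbound K hK
    refine ⟨C, hC0, fun s hs l hl => ?_⟩
    rw [(hcoef s).1, (hcoef s).2.1, (hcoef s).2.2]
    exact hC s hs l hl

end Smooth

end Anomaly

end
noncomputable section

namespace Anomaly

/-! ### Reduction to uniform families -/

section Reduction

variable {S : Type*}

lemma IsSmoothScalar.measurable [TopologicalSpace S] [MeasurableSpace S] [OpensMeasurableSpace S]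
    {f : ℝ → S → ℝ} (hf : IsSmoothScalar f) (l : ℝ) : Measurable (f l) := by
  have := (hf.2 0).comp (continuous_const.prodMk continuous_id : Continuous fun s : S => (l, s))
  simp only [iteratedDeriv_zero] at this
  exact Continuous.measurable this

open Classical in
lemma isBM_ite [TopologicalSpace S] [MeasurableSpace S] [OpensMeasurableSpace S] {G K : Set S}
    (hG : MeasurableSet G) (hGK : G ⊆ K) (hK : IsCompact K) {f : S → ℝ} (hf : Continuous f) :
    IsBM fun s => if s ∈ G then f s else 0 := by
  obtain ⟨C, hC⟩ := hK.exists_bound_of_continuousOn hf.continuousOn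
  refine ⟨Measurable.ite hG hf.measurable measurable_const, max C 0, fun s => ?_⟩
  dsimp only
  split_ifs with h
  · exact (hC s (hGK h)).trans (le_max_left _ _)
  · simp

/-- The family conjugated by a fixed matrix. -/
lemma smooth_conj [TopologicalSpace S] {T : ℝ → S → SL2} (hT : IsSmoothFamily T) (M : SL2)
    {ε : S → ℝ} (hε : Continuous ε) (i j : Fin 2) :
    IsSmoothScalar fun l s => ε s * (M * T l s * M⁻¹).1 i j := by
  have h : ∀ a b, IsSmoothScalar fun l s => (ε s * (M.1 i a * (M⁻¹).1 b j)) * (T l s).1 a b :=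
    fun a b => IsSmoothScalar.const_mul (f := fun l s => (T l s).1 a b)
      ⟨fun s => hT.1 s a b, fun k => hT.2 k a b⟩ (hε.mul continuous_const)
  have h2 := ((h 0 0).add (h 0 1)).add ((h 1 0).add (h 1 1))
  convert h2 using 3 with l s
  simp only [Matrix.SpecialLinearGroup.coe_mul, Matrix.mul_apply, Fin.sum_univ_two]
  ring

open Classical in
-- The sign is that of `T 0 s` and is continuous in `s`, so multiplying by it preserves smoothness.
-- Taylor bounds are uniform only over the compact support; off a measurable subset of it of full
-- measure the matrices are replaced by the identity, and `P`, `Q` by zero.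
lemma exists_isUniformFamily [TopologicalSpace S] [MeasurableSpace S] [OpensMeasurableSpace S]
    {μ : Measure S} (hμ : ∃ K : Set S, IsCompact K ∧ μ Kᶜ = 0)
    {T : ℝ → S → SL2} (hT : IsSmoothFamily T) (hanomaly : IsFirstOrderAnomaly T)
    {M : SL2} {P Q : S → Mat2}
    (hPQ : ∀ s, HasExpansion (fun l => (M * T l s * M⁻¹).1) (P s) (Q s)) :
    ∃ (A : ℝ → S → Mat2) (P' Q' : S → Mat2), IsUniformFamily A P' Q' ∧ P =ᵐ[μ] P' ∧ Q =ᵐ[μ] Q' ∧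
      (∀ l, ∀ᵐ s ∂μ, ∃ ε : ℝ, (ε = 1 ∨ ε = -1) ∧ A l s = ε • (M * T l s * M⁻¹).1) ∧
      ∀ s, A 0 s = 1 := by
  obtain ⟨K, hK, hμK⟩ := hμ
  set ε : S → ℝ := fun s => (T 0 s).1 0 0 with hεdef
  have hεc : Continuous ε := by
    have := (hT.2 0 0 0).comp
      (continuous_const.prodMk continuous_id : Continuous fun s : S => ((0 : ℝ), s))
    simp only [iteratedDeriv_zero] at this
    exact this
  have hε : ∀ s, (ε s = 1 ∨ ε s = -1) ∧ (T 0 s).1 = ε s • (1 : Mat2) := by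
    intro s
    rcases hanomaly s with h | h
    · have : ε s = 1 := by simp only [hεdef, h]; simp
      exact ⟨Or.inl this, by rw [this, h, one_smul]⟩
    · have : ε s = -1 := by simp only [hεdef, h]; simp
      exact ⟨Or.inr this, by rw [this, h, neg_smul, one_smul]⟩
  have hsq : ∀ s, ε s * ε s = 1 := fun s => by
    rcases (hε s).1 with h | h <;> rw [h] <;> norm_num
  have hMM : M.1 * (M⁻¹).1 = 1 := by
    rw [← Matrix.SpecialLinearGroup.coe_mul, mul_inv_cancel, Matrix.SpecialLinearGroup.coe_one]
  have hconj0 : ∀ s, (M * T 0 s * M⁻¹).1 = ε s • (1 : Mat2) := fun s => by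
    rw [Matrix.SpecialLinearGroup.coe_mul, Matrix.SpecialLinearGroup.coe_mul, (hε s).2,
      mul_smul_comm, mul_one, smul_mul_assoc, hMM]
  set R : S → Mat2 := fun s => Q s + (1 / 2 : ℝ) • (P s * P s) with hR
  have hexp : ∀ i j s, (fun l : ℝ => ε s * (M * T l s * M⁻¹).1 i j
      - ((1 : Mat2) i j + P s i j * l + R s i j * l ^ 2)) =O[𝓝 0] fun l : ℝ => l ^ 3 := by
    intro i j s
    obtain ⟨ε', -, h0, h⟩ := (hPQ s).entries
    -- At `l = 0` the conjugated matrix is `ε s • 1`, so the sign in the expansion has no other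
    -- choice.
    have : ε' = ε s := by
      have := congrFun (congrFun (h0.symm.trans (hconj0 s)) 0) 0
      simpa using this
    rw [← this]
    exact h i j
  have hsm := fun i j => smooth_conj hT M hεc i j
  have hcoef := fun i j => (hsm i j).expansion (p₀ := fun _ => (1 : Mat2) i j)
    (p₁ := fun s => P s i j) (p₂ := fun s => R s i j) (hexp i j)
  have hPc : ∀ i j, Continuous fun s => P s i j := fun i j => (hcoef i j).1
  have hQc : ∀ i j, Continuous fun s => Q s i j := by
    intro i j
    have : ∀ s, Q s i j = R s i j - (1 / 2) * (P s i 0 * P s 0 j + P s i 1 * P s 1 j) := by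
      intro s
      simp [hR, Matrix.mul_apply, Fin.sum_univ_two]
    simp only [this]
    exact (hcoef i j).2.1.sub (continuous_const.mul
      (((hPc i 0).mul (hPc 0 j)).add ((hPc i 1).mul (hPc 1 j))))
  -- A compact set need not be measurable in this generality; the complement of a measurable hull of
  -- `Kᶜ` takes its place.
  obtain ⟨G, hG, hGK, hGae⟩ : ∃ G : Set S, MeasurableSet G ∧ G ⊆ K ∧ ∀ᵐ s ∂μ, s ∈ G := by
    refine ⟨(toMeasurable μ Kᶜ)ᶜ, (measurableSet_toMeasurable μ Kᶜ).compl,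
      Set.compl_subset_comm.mp (subset_toMeasurable μ Kᶜ), ?_⟩
    rw [ae_iff]
    simp only [Set.mem_compl_iff, not_not]
    exact (measure_toMeasurable Kᶜ).trans hμK
  set A : ℝ → S → Mat2 := fun l s => if s ∈ G then ε s • (M * T l s * M⁻¹).1 else 1 with hA
  set P' : S → Mat2 := fun s => if s ∈ G then P s else 0 with hP'
  set Q' : S → Mat2 := fun s => if s ∈ G then Q s else 0 with hQ'
  have hPbm : ∀ i j, IsBM fun s => P' s i j := fun i j => by
    have : (fun s => P' s i j) = fun s => if s ∈ G then P s i j else 0 := by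
      ext s; simp only [hP']; split_ifs <;> rfl
    rw [this]; exact isBM_ite hG hGK hK (hPc i j)
  have hQbm : ∀ i j, IsBM fun s => Q' s i j := fun i j => by
    have : (fun s => Q' s i j) = fun s => if s ∈ G then Q s i j else 0 := by
      ext s; simp only [hQ']; split_ifs <;> rfl
    rw [this]; exact isBM_ite hG hGK hK (hQc i j)
  have htr : ∀ X : Mat2, X.trace = 0 → X 1 1 = -X 0 0 := fun X h => by
    rw [Matrix.trace_fin_two] at h; linarith
  refine ⟨A, P', Q', ⟨fun l i j => ?_, fun l s => ?_, ⟨hPbm, fun s => ?_⟩, ⟨hQbm, fun s => ?_⟩,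
    fun i j => ⟨?_, ?_, ?_, ?_⟩⟩, ?_, ?_, fun l => ?_, fun s => ?_⟩
  · have : (fun s => A l s i j)
        = fun s => if s ∈ G then ε s * (M * T l s * M⁻¹).1 i j else (1 : Mat2) i j := by
      ext s; simp only [hA]; split_ifs <;> rfl
    rw [this]
    exact Measurable.ite hG ((hsm i j).measurable l) measurable_const
  · simp only [hA]
    split_ifs
    · rw [Matrix.det_smul, (M * T l s * M⁻¹).2, Fintype.card_fin, pow_two, hsq, mul_one]
    · exact Matrix.det_one
  · simp only [hP']
    split_ifs
    · exact htr _ (hPQ s).1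
    · simp
  · simp only [hQ']
    split_ifs
    · exact htr _ (hPQ s).2.1
    · simp
  · exact isBigO_one_of_bdd fun _ => le_rfl
  · obtain ⟨C, hC⟩ := (hPbm i j).2
    exact isBigO_one_of_bdd fun z => hC z.2
  · obtain ⟨C, hC⟩ := ((hQbm i j).add ((isBM_const (1 / 2 : ℝ)).mul
      (isBM_mul_entry hPbm hPbm i j))).2
    exact isBigO_one_of_bdd fun z => hC z.2
  · obtain ⟨C, hC0, hC⟩ := (hcoef i j).2.2 K hK
    refine IsBigO.of_bound C ?_
    refine mem_prod_top.mpr ?_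
    filter_upwards [Metric.closedBall_mem_nhds (0 : ℝ) one_pos] with l hl s
    have hl' : |l| ≤ 1 := by simpa using hl
    by_cases hs : s ∈ G
    · have := hC s (hGK hs) l hl'
      simp only [hA, hP', hQ', if_pos hs, Real.norm_eq_abs, abs_pow]
      refine le_trans (le_of_eq ?_) this
      simp only [hR, Matrix.smul_apply, smul_eq_mul]
      congr 1; ring
    · simp only [hA, hP', hQ', if_neg hs]
      simp
      positivity
  · filter_upwards [hGae] with s hs
    simp only [hP', if_pos hs]
  · filter_upwards [hGae] with s hs
    simp only [hQ', if_pos hs]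
  · filter_upwards [hGae] with s hs
    exact ⟨ε s, (hε s).1, by simp only [hA, if_pos hs]⟩
  · simp only [hA]
    split_ifs
    · rw [hconj0, smul_smul, hsq, one_smul]
    · rfl

end Reduction

/-! ### Dependence on the law only -/

section Congr

variable {S : Type*} [MeasurableSpace S] {μ : Measure S} {P P' Q Q' : S → Mat2}

lemma diffusion_congr (h : P =ᵐ[μ] P') : diffusion μ P = diffusion μ P' :=
  funext fun θ => integral_congr_ae (h.mono fun s hs => by dsimp only; rw [hs])

lemma meanQ_congr (h : Q =ᵐ[μ] Q') : meanQ μ Q = meanQ μ Q' :=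
  funext fun θ => integral_congr_ae (h.mono fun s hs => by dsimp only; rw [hs])

lemma rho_congr (hP : P =ᵐ[μ] P') (hQ : Q =ᵐ[μ] Q') : rho μ P Q = rho μ P' Q' := by
  have hk : kappa μ P Q = kappa μ P' Q' := by
    unfold kappa; rw [diffusion_congr hP, meanQ_congr hQ]
  have hK : bigK μ P Q = bigK μ P' Q' := by unfold bigK; rw [diffusion_congr hP, hk]
  have hC : bigC μ P Q = bigC μ P' Q' := by unfold bigC; rw [hk, hK]
  have hd : preDensity μ P Q = preDensity μ P' Q' := by
    unfold preDensity; rw [diffusion_congr hP, hk, hK, hC]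
  unfold rho; rw [hd]

lemma flux_congr (hP : P =ᵐ[μ] P') (hQ : Q =ᵐ[μ] Q') : flux μ P Q = flux μ P' Q' := by
  have h : ∀ θ, ∫ s, phase (P s) θ * deriv (phase (P s)) θ ∂μ
      = ∫ s, phase (P' s) θ * deriv (phase (P' s)) θ ∂μ := fun θ =>
    integral_congr_ae (hP.mono fun s hs => by dsimp only; rw [hs])
  unfold flux
  simp only [diffusion_congr hP, meanQ_congr hQ, h]

lemma lyapCoefficient_congr (hP : P =ᵐ[μ] P') (hQ : Q =ᵐ[μ] Q') :
    lyapCoefficient μ P Q = lyapCoefficient μ P' Q' := by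
  have h1 : ∫ s, ‖offDiag (P s)‖ ^ 2 ∂μ = ∫ s, ‖offDiag (P' s)‖ ^ 2 ∂μ :=
    integral_congr_ae (hP.mono fun s hs => by dsimp only; rw [hs])
  have h2 : ∫ s, offDiag ((P s)ᵀ * P s + (2 : ℝ) • Q s) ∂μ
      = ∫ s, offDiag ((P' s)ᵀ * P' s + (2 : ℝ) • Q' s) ∂μ :=
    integral_congr_ae (by filter_upwards [hP, hQ] with s hs ht; rw [hs, ht])
  have h3 : ∫ s, offDiag (P s) ^ 2 ∂μ = ∫ s, offDiag (P' s) ^ 2 ∂μ :=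
    integral_congr_ae (hP.mono fun s hs => by dsimp only; rw [hs])
  unfold lyapCoefficient lyapIntegrand
  rw [h1, h2, h3, rho_congr hP hQ]

end Congr

/-! ### The Lyapunov exponent -/

section Lyapunov

lemma log_norm_toLp (x : Vec) :
    Real.log ‖(WithLp.toLp 2 x : EuclideanSpace ℝ (Fin 2))‖ = ell x := by
  rw [EuclideanSpace.norm_eq, Real.log_sqrt (by positivity), ell, nsq]
  simp [Fin.sum_univ_two]

lemma ell_sign_smul {ε : ℝ} (hε : ε = 1 ∨ ε = -1) (x : Vec) : ell (ε • x) = ell x := by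
  rcases hε with rfl | rfl <;> simp [ell, nsq]

variable {S : Type*}

lemma cocycle_eq_conj {A : S → Mat2} {T : ℝ → S → SL2} {l : ℝ} {M : SL2} {w : ℕ → S}
    (h : ∀ n, ∃ ε : ℝ, (ε = 1 ∨ ε = -1) ∧ A (w n) = ε • (M * T l (w n) * M⁻¹).1) (N : ℕ) :
    ∃ ε : ℝ, (ε = 1 ∨ ε = -1) ∧ cocycle A w N = ε • (M * transfer T l w N * M⁻¹).1 := by
  induction N with
  | zero =>
    refine ⟨1, Or.inl rfl, ?_⟩
    simp only [cocycle, transfer, mul_one, mul_inv_cancel, one_smul,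
      Matrix.SpecialLinearGroup.coe_one]
  | succ N ih =>
    obtain ⟨ε, hε, hc⟩ := ih
    obtain ⟨δ, hδ, hd⟩ := h N
    refine ⟨δ * ε, ?_, ?_⟩
    · rcases hε with rfl | rfl <;> rcases hδ with rfl | rfl <;> norm_num
    · rw [cocycle, hc, hd, smul_mul_smul_comm, ← Matrix.SpecialLinearGroup.coe_mul, transfer]
      congr 2
      simp only [mul_assoc, inv_mul_cancel_left]
      rfl

variable [MeasurableSpace S] {μ : Measure S} [IsProbabilityMeasure μ]

/-- Conjugation moves the starting vector to `M e_θ` and changes the logarithm of the final norm by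
at most a constant; signs change nothing. Both effects vanish after division by `N`. -/
lemma isLyapunovExponent_of_conj {A : S → Mat2} {B : ℝ} (hA : IsBoundedUnimodular A B)
    {T : ℝ → S → SL2} {l : ℝ} {M : SL2}
    (h : ∀ᵐ s ∂μ, ∃ ε : ℝ, (ε = 1 ∨ ε = -1) ∧ A s = ε • (M * T l s * M⁻¹).1) {γ : ℝ}
    (hγ : ∀ x ≠ 0, Tendsto (fun N : ℕ => (1 / (N : ℝ)) * (step A μ)^[N] ell x) atTop (𝓝 γ)) :
    IsLyapunovExponent μ T l γ := by
  intro θ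
  set x : Vec := M.1 *ᵥ e θ with hx
  have hx0 : x ≠ 0 := mulVec_ne_zero M.2 (e_ne_zero θ)
  set D : ℝ := Real.log (frob (M⁻¹).1) / 2 with hD
  have hMl : ∀ y : Vec, y ≠ 0 → |ell ((M⁻¹).1 *ᵥ y) - ell y| ≤ D := fun y hy =>
    ell_mulVec_le (M⁻¹).2 le_rfl hy
  set φ : Vec → ℝ := fun y => ell ((M⁻¹).1 *ᵥ y) with hφ
  have hφm : Measurable φ := by
    refine measurable_ell.comp (measurable_pi_lambda _ fun i => ?_)
    simp only [Matrix.mulVec, dotProduct, Fin.sum_univ_two]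
    fun_prop
  have hD0 : 0 ≤ D := (abs_nonneg _).trans (hMl (e θ) (e_ne_zero θ))
  have hφb : LocBdd φ := by
    have h1 : LocBdd fun y => φ y - ell y := by
      refine locBdd_of_bound (C := D) (hφm.sub measurable_ell) fun y => ?_
      rcases eq_or_ne y 0 with rfl | hy
      · simpa only [hφ, Matrix.mulVec_zero, sub_self, abs_zero] using hD0
      · exact hMl y hy
    simpa using locBdd_ell.add h1
  set ν := Measure.infinitePi fun _ : ℕ => μ with hν
  -- The relation holds for almost every letter, hence almost surely for all of the countably many
  -- letters of a word.
  have hae : ∀ᵐ w ∂ν, ∀ n, ∃ ε : ℝ, (ε = 1 ∨ ε = -1) ∧ A (w n) = ε • (M * T l (w n) * M⁻¹).1 :=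
    ae_all_iff.mpr fun n =>
      (measurePreserving_eval_infinitePi (fun _ : ℕ => μ) n).quasiMeasurePreserving.ae h
  have heq : ∀ N, (fun w => φ (cocycle A w N *ᵥ x)) =ᵐ[ν] logGrowth T l θ N := by
    intro N
    filter_upwards [hae] with w hw
    obtain ⟨ε, hε, hc⟩ := cocycle_eq_conj hw N
    have hmat : (M⁻¹).1 * (cocycle A w N * M.1) = ε • (transfer T l w N).1 := by
      rw [hc, smul_mul_assoc, mul_smul_comm, ← Matrix.SpecialLinearGroup.coe_mul,
        ← Matrix.SpecialLinearGroup.coe_mul]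
      congr 2
      simp only [mul_assoc, inv_mul_cancel_left, inv_mul_cancel, mul_one]
      rfl
    simp only [hφ, logGrowth, log_norm_toLp, hx, Matrix.mulVec_mulVec, hmat, Matrix.smul_mulVec]
    rw [ell_sign_smul hε]
  have hiφ := fun N => hA.integrable_cocycle (μ := μ) hφb hx0 N
  have hie := fun N => hA.integrable_cocycle (μ := μ) locBdd_ell hx0 N
  refine ⟨fun N => (hiφ N).congr (heq N), ?_⟩
  have hdiff : ∀ N, |(∫ w, logGrowth T l θ N w ∂ν) - (step A μ)^[N] ell x| ≤ D := by
    intro N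
    rw [← integral_congr_ae (heq N), ← hA.integral_cocycle locBdd_ell N x hx0,
      ← integral_sub (hiφ N) (hie N)]
    have := norm_integral_le_of_norm_le_const (μ := ν) (C := D)
      (f := fun w => φ (cocycle A w N *ᵥ x) - ell (cocycle A w N *ᵥ x))
      (ae_of_all _ fun w => hMl _ (mulVec_ne_zero (hA.det_cocycle w N) hx0))
    simpa using this
  have h0 : Tendsto (fun N : ℕ => (1 / (N : ℝ))
      * ((∫ w, logGrowth T l θ N w ∂ν) - (step A μ)^[N] ell x)) atTop (𝓝 0) := by
    refine squeeze_zero_norm (a := fun N : ℕ => (1 / (N : ℝ)) * D) (fun N => ?_) ?_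
    · rw [norm_mul, Real.norm_of_nonneg (by positivity)]
      exact mul_le_mul_of_nonneg_left (hdiff N) (by positivity)
    · simpa using tendsto_one_div_atTop_nhds_zero_nat.mul_const D
  simpa [← mul_add] using h0.add (hγ x hx0)

/-- The trivial random matrix has zero growth. -/
lemma tendsto_growth_one {A : S → Mat2} (h : ∀ s, A s = 1) (x : Vec) :
    Tendsto (fun N : ℕ => (1 / (N : ℝ)) * (step A μ)^[N] ell x) atTop (𝓝 0) := by
  have hfix : step A μ ell = ell := by
    ext x
    simp [step, h]
  simp only [Function.iterate_fixed hfix]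
  simpa using tendsto_one_div_atTop_nhds_zero_nat.mul_const (ell x)

end Lyapunov

end Anomaly

end

theorem mainTheorem1 {S : Type*} [TopologicalSpace S] [MeasurableSpace S]
    [OpensMeasurableSpace S] (μ : Measure S) [IsProbabilityMeasure μ]
    (hμ : ∃ K : Set S, IsCompact K ∧ μ Kᶜ = 0)
    (T : ℝ → S → Anomaly.SL2) (hT : Anomaly.IsSmoothFamily T)
    (hanomaly : Anomaly.IsFirstOrderAnomaly T)
    (M : Anomaly.SL2) (P Q : S → Anomaly.Mat2)
    (hPQ : ∀ s, Anomaly.HasExpansion (fun l => (M * T l s * M⁻¹).1) (P s) (Q s))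
    (hdegree : Anomaly.IsSecondDegree μ P)
    (hp : ∀ θ : ℝ, 0 < ∫ s, Anomaly.phase (P s) θ ^ 2 ∂μ) :
    ((∀ θ, 0 < Anomaly.rho μ P Q θ) ∧
      (∀ θ, Anomaly.rho μ P Q (θ + 2 * Real.pi) = Anomaly.rho μ P Q θ) ∧
      (∀ θ, AnalyticAt ℝ (Anomaly.rho μ P Q) θ) ∧
      (1 / (2 * Real.pi)) * (∫ θ in (0 : ℝ)..(2 * Real.pi), Anomaly.rho μ P Q θ) = 1 ∧
      (∀ θ, HasDerivAt (Anomaly.flux μ P Q (Anomaly.rho μ P Q)) 0 θ)) ∧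
    ∃ γ : ℝ → ℝ,
      (∀ᶠ l in 𝓝 (0 : ℝ), Anomaly.IsLyapunovExponent μ T l (γ l)) ∧
      (fun l => γ l - l ^ 2 / 2 * Anomaly.lyapCoefficient μ P Q)
        =O[𝓝 0] (fun l : ℝ => l ^ 3) := by
  obtain ⟨A, P', Q', hA, hPP, hQQ, hconj, hA0⟩ :=
    Anomaly.exists_isUniformFamily hμ hT hanomaly hPQ
  have hp' : ∀ θ : ℝ, 0 < ∫ s, Anomaly.phase (P' s) θ ^ 2 ∂μ := fun θ => by
    rw [← show ∫ s, Anomaly.phase (P s) θ ^ 2 ∂μ = ∫ s, Anomaly.phase (P' s) θ ^ 2 ∂μ from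
      congrFun (Anomaly.diffusion_congr hPP) θ]
    exact hp θ
  have hmean : ∀ i j, ∫ s, P' s i j ∂μ = 0 := fun i j => by
    rw [← (hdegree.1 i j).2]
    exact integral_congr_ae (hPP.mono fun s hs => by dsimp only; rw [hs])
  rw [Anomaly.rho_congr hPP hQQ, Anomaly.flux_congr hPP hQQ, Anomaly.lyapCoefficient_congr hPP hQQ]
  refine ⟨Anomaly.rho_properties hA.hP hA.hQ hp', ?_⟩
  obtain ⟨C, hC⟩ := hA.lyapunov_asymptotics hmean hp'
  obtain ⟨B, hB⟩ := hA.eventually_bounded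
  have hex : ∀ᶠ l in 𝓝 (0 : ℝ), ∃ γ, Anomaly.IsLyapunovExponent μ T l γ ∧
      |γ - l ^ 2 / 2 * Anomaly.lyapCoefficient μ P' Q'| ≤ C * |l| ^ 3 := by
    filter_upwards [hC, hB] with l hCl hBl
    -- At `l = 0` no direction moves and the existence argument does not apply, but every `A 0 s` is
    -- the identity and the exponent is `0`.
    rcases eq_or_ne l 0 with rfl | hl
    · exact ⟨0, Anomaly.isLyapunovExponent_of_conj hBl (hconj 0)
        fun x _ => Anomaly.tendsto_growth_one hA0 x, by simp⟩
    · obtain ⟨γ, hγ, hbound⟩ := hCl hl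
      exact ⟨γ, Anomaly.isLyapunovExponent_of_conj hBl (hconj l) hγ, hbound⟩
  -- The constant `C` does not depend on `l`, so the exponents may be chosen separately for each
  -- coupling.
  obtain ⟨γ, hγ⟩ := hex.choice
  refine ⟨γ, hγ.mono fun l hl => hl.1, IsBigO.of_bound C ?_⟩
  filter_upwards [hγ] with l hl
  simpa using hl.2
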